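/- Let $(M,g)$ be a closed (compact, without boundary) smooth Riemannian manifold of dimension $2n$ equipped with an $SU(n)$-structure, that is, with a smooth almost complex structure $J$ such that $g(JX,JY)=g(X,Y)$ and a smooth complex volume form $\Psi$ (a complex-valued $n$-form of type $(n,0)$) with $\langle\Psi,\Psi\rangle_{\mathbb C}=1$. Let $\nabla$ be the Levi-Civita connection, $R(X,Y)=[\nabla_X,\nabla_Y]-\nabla_{[X,Y]}$, and, for an orthonormal basis $(e_i)$, $$s=\sum_{i,j} g(R(e_j,e_i)e_i,e_j),\qquad s^{\ast}=\sum_{i,j} g(R(e_j,e_i)Je_i,Je_j)$$ the scalar and the $\ast$-scalar curvature. The intrinsic torsion of the $SU(n)$-structure is the tensor $\xi_XY=\nabla^{SU(n)}_XY-\nabla_XY$, where $\nabla^{SU(n)}$ is the connection that preserves $g,J,\Psi$ and for which every $\xi_X$ lies in $\mathfrak{su}(n)^{\bot}\subset\mathfrak{so}(TM)$. Let $\mathcal W_1$ be the space of tensors $\xi$ with $\xi_X\in\mathfrak{so}(TM)$, $\xi_XJ=-J\xi_X$ and $\xi_XY=-\xi_YX$, and let $\mathcal W_5$ be the space of tensors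 of the form $\eta_XY=\eta(JX)JY$ with $\eta$ a $1$-form. If the $SU(n)$-structure is of type $\mathcal W_1\oplus\mathcal W_5$, i.e. $\xi\in\mathcal W_1\oplus\mathcal W_5$ at every point, then $s$ and $s^{\ast}$ are integrable and $$\int_M s\,\mathrm{vol}_M=5\int_M s^{\ast}\,\mathrm{vol}_M .$$ -/

import Mathlib

open Bundle Manifold ContDiff MeasureTheory FiberBundle VectorField

set_option linter.unusedSectionVars false

namespace SUStr

/-! ## Linear algebra of special unitary structures -/

noncomputable section LinearAlgebra

variable {V : Type*} [NormedAddCommGroup V] [InnerProductSpace ℝ V]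

/-- The Lie algebra `so(V)` of skew-symmetric endomorphisms. -/
def so (V : Type*) [NormedAddCommGroup V] [InnerProductSpace ℝ V] : Submodule ℝ (V →L[ℝ] V) where
  carrier := {A | ∀ v w : V, inner ℝ (A v) w = - inner ℝ v (A w)}
  zero_mem' := by simp
  add_mem' {A B} hA hB v w := by
    have h1 := hA v w
    have h2 := hB v w
    simp only [add_apply, inner_add_left, inner_add_right]
    linarith
  smul_mem' c A hA v w := by
    have h1 := hA v w
    simp [inner_smul_left, inner_smul_right, h1]

/-- The trace form `(A, B) ↦ tr (A ∘ B)`. -/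
def traceComp (A B : V →L[ℝ] V) : ℝ := LinearMap.trace ℝ V (A.toLinearMap ∘ₗ B.toLinearMap)

/-- `su(V, J) = {A ∈ so(V) | A J = J A, tr (A J) = 0}`. -/
def su (J : V →L[ℝ] V) : Set (V →L[ℝ] V) :=
  {A | A ∈ so V ∧ (∀ v, A (J v) = J (A v)) ∧ traceComp A J = 0}

/-- The orthogonal complement of `su(V, J)` in `so(V)` with respect to the trace form. -/
def suPerp (J : V →L[ℝ] V) : Set (V →L[ℝ] V) :=
  {A | A ∈ so V ∧ ∀ B ∈ su J, traceComp A B = 0}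

/-- `u(V, J)^⊥ = {A ∈ so(V) | A J = - J A}`. -/
def uPerp (J : V →L[ℝ] V) : Submodule ℝ (V →L[ℝ] V) where
  carrier := {A | A ∈ so V ∧ ∀ v, A (J v) = - J (A v)}
  zero_mem' := ⟨zero_mem _, by simp⟩
  add_mem' {A B} hA hB := ⟨add_mem hA.1 hB.1, fun v => by
    simp only [add_apply, hA.2 v, hB.2 v, map_add]; abel⟩
  smul_mem' c A hA := ⟨Submodule.smul_mem _ c hA.1, fun v => by simp [hA.2 v]⟩

/-- The class `W₁`: tensors `ξ ∈ V* ⊗ u(V, J)^⊥` with `ξ_X Y = - ξ_Y X`. -/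
def W1 (J : V →L[ℝ] V) : Submodule ℝ (V →L[ℝ] V →L[ℝ] V) where
  carrier := {ξ | (∀ X, ξ X ∈ uPerp J) ∧ ∀ X Y, ξ X Y = - ξ Y X}
  zero_mem' := ⟨fun _ => zero_mem _, by simp⟩
  add_mem' {ξ ζ} h h' := ⟨fun X => add_mem (h.1 X) (h'.1 X), fun X Y => by
    simp only [add_apply, h.2 X Y, h'.2 X Y]; abel⟩
  smul_mem' c ξ h := ⟨fun X => Submodule.smul_mem _ c (h.1 X), fun X Y => by
    simp only [smul_apply, h.2 X Y, smul_neg]⟩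

/-- The class `W₅`: tensors of the form `η_X Y = η(J X) J Y` for a covector `η`. -/
def W5 (J : V →L[ℝ] V) : Submodule ℝ (V →L[ℝ] V →L[ℝ] V) where
  carrier := {ξ | ∃ η : V →L[ℝ] ℝ, ∀ X Y, ξ X Y = η (J X) • J Y}
  zero_mem' := ⟨0, by simp⟩
  add_mem' := by
    rintro ξ ζ ⟨η, h⟩ ⟨η', h'⟩
    exact ⟨η + η', fun X Y => by simp [h, h', add_smul]⟩
  smul_mem' := by
    rintro c ξ ⟨η, h⟩
    exact ⟨c • η, fun X Y => by simp [h, mul_smul]⟩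

end LinearAlgebra

/-! ## The Levi-Civita connection and curvature -/

noncomputable section LeviCivita

variable {E : Type*} [NormedAddCommGroup E] [NormedSpace ℝ E] [FiniteDimensional ℝ E]
  {H : Type*} [TopologicalSpace H] {I : ModelWithCorners ℝ E H}
  {M : Type*} [TopologicalSpace M] [ChartedSpace H M] [IsManifold I ∞ M]
  [RiemannianBundle (fun x : M => TangentSpace I x)]
  [IsContMDiffRiemannianBundle I ∞ E (fun x : M => TangentSpace I x)]

theorem mdiff_inner {x : M} {Y Z : Π x : M, TangentSpace I x}
    (hY : MDiffAt (T% Y) x) (hZ : MDiffAt (T% Z) x) : MDiffAt (fun q => inner ℝ (Y q) (Z q)) x :=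
  MDifferentiableAt.inner_bundle (E := fun x : M => TangentSpace I x) hY hZ

variable (I) in
/-- The vector field `Y` is differentiable at `x`. -/
abbrev DiffFieldAt (Y : Π x : M, TangentSpace I x) (x : M) : Prop := MDiffAt (T% Y) x

variable (I) in
/-- The vector field `Y` is smooth at `x`. -/
abbrev SmoothFieldAt (Y : Π x : M, TangentSpace I x) (x : M) : Prop := CMDiffAt ∞ (T% Y) x

variable (I) in
/-- The right-hand side of the Koszul formula for `2 ⟨∇_X Y, Z⟩`. -/
def koszul (X Y Z : Π x : M, TangentSpace I x) (x : M) : ℝ :=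
  mvfderiv I (fun q => inner ℝ (Y q) (Z q)) x (X x)
    + mvfderiv I (fun q => inner ℝ (X q) (Z q)) x (Y x)
    - mvfderiv I (fun q => inner ℝ (X q) (Y q)) x (Z x)
    + inner ℝ (mlieBracket I X Y x) (Z x)
    - inner ℝ (mlieBracket I X Z x) (Y x)
    - inner ℝ (mlieBracket I Y Z x) (X x)

theorem koszul_tensorial_left {x : M} {Y Z : Π x : M, TangentSpace I x}
    (hY : MDiffAt (T% Y) x) (hZ : MDiffAt (T% Z) x) :
    TensorialAt I E (fun X => koszul I X Y Z x) x where
  smul {f X} hf hX := by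
    simp [koszul, inner_smul_left]
    rw [mvfderiv_fun_mul hf (mdiff_inner hX hZ), mvfderiv_fun_mul hf (mdiff_inner hX hY),
      mlieBracket_smul_left hf hX, mlieBracket_smul_left hf hX]
    simp [inner_add_left, inner_smul_left, inner_smul_right]
    rw [real_inner_comm (Y x)]
    ring_nf
  add {X X'} hX hX' := by
    simp [koszul, inner_add_left]
    rw [mvfderiv_fun_add (mdiff_inner hX hZ) (mdiff_inner hX' hZ),
      mvfderiv_fun_add (mdiff_inner hX hY) (mdiff_inner hX' hY),
      mlieBracket_add_left hX hX', mlieBracket_add_left hX hX']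
    simp [inner_add_left, inner_add_right]
    ring

theorem koszul_tensorial_right {x : M} {X Y : Π x : M, TangentSpace I x}
    (hX : MDiffAt (T% X) x) (hY : MDiffAt (T% Y) x) :
    TensorialAt I E (fun Z => koszul I X Y Z x) x where
  smul {f Z} hf hZ := by
    simp [koszul, inner_smul_right]
    rw [mvfderiv_fun_mul hf (mdiff_inner hX hZ), mvfderiv_fun_mul hf (mdiff_inner hY hZ),
      mlieBracket_smul_right hf hZ, mlieBracket_smul_right hf hZ]
    simp [inner_add_left, inner_smul_left]
    rw [real_inner_comm (Z x) (Y x), real_inner_comm (Z x) (X x)]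
    ring_nf
  add {Z Z'} hZ hZ' := by
    simp [koszul, inner_add_right]
    rw [mvfderiv_fun_add (mdiff_inner hX hZ) (mdiff_inner hX hZ'),
      mvfderiv_fun_add (mdiff_inner hY hZ) (mdiff_inner hY hZ'),
      mlieBracket_add_right hZ hZ', mlieBracket_add_right hZ hZ']
    simp [inner_add_left]
    ring

theorem koszul_add {x : M} {X Y Y' Z : Π x : M, TangentSpace I x}
    (hX : MDiffAt (T% X) x) (hY : MDiffAt (T% Y) x) (hY' : MDiffAt (T% Y') x)
    (hZ : MDiffAt (T% Z) x) :
    koszul I X (Y + Y') Z x = koszul I X Y Z x + koszul I X Y' Z x := by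
  simp [koszul, inner_add_right, inner_add_left]
  rw [mvfderiv_fun_add (mdiff_inner hY hZ) (mdiff_inner hY' hZ),
      mvfderiv_fun_add (mdiff_inner hX hY) (mdiff_inner hX hY'),
      mlieBracket_add_left hY hY', mlieBracket_add_right hY hY']
  simp [inner_add_left]
  ring

theorem koszul_smul {x : M} {X Y Z : Π x : M, TangentSpace I x} {f : M → ℝ}
    (hf : MDiffAt f x)
    (hX : MDiffAt (T% X) x) (hY : MDiffAt (T% Y) x) (hZ : MDiffAt (T% Z) x) :
    koszul I X (f • Y) Z x = f x * koszul I X Y Z x +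
      2 * (mvfderiv I f x (X x) * inner ℝ (Y x) (Z x)) := by
  simp [koszul, inner_smul_right, inner_smul_left]
  rw [mvfderiv_fun_mul hf (mdiff_inner hY hZ), mvfderiv_fun_mul hf (mdiff_inner hX hY),
      mlieBracket_smul_left hf hY, mlieBracket_smul_right hf hY]
  simp [inner_add_left, inner_smul_left]
  rw [real_inner_comm (X x) (Y x)]
  ring

/-- For fixed `Y`, the Koszul expression as a bilinear form in `(X x, Z x)`. -/
def koszulForm {x : M} {Y : Π x : M, TangentSpace I x} (hY : MDiffAt (T% Y) x) :
    TangentSpace I x →L[ℝ] TangentSpace I x →L[ℝ] ℝ :=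
  TensorialAt.mkHom₂ (fun X Z => koszul I X Y Z x) x
    (fun _ hZ => koszul_tensorial_left hY hZ) (fun _ hX => koszul_tensorial_right hX hY)


instance tangentSpace_finiteDimensional (x : M) : FiniteDimensional ℝ (TangentSpace I x) :=
  inferInstanceAs (FiniteDimensional ℝ E)

instance tangentSpace_completeSpace (x : M) : CompleteSpace (TangentSpace I x) :=
  FiniteDimensional.complete ℝ _

open Classical in
/-- `∇_v Y` is the vector with `2 ⟨∇_v Y, w⟩ = koszulForm v w` (and `0` where the vector field `Y`
is not differentiable). -/
def leviCivitaFun (Y : Π x : M, TangentSpace I x) (x : M) :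
    TangentSpace I x →L[ℝ] TangentSpace I x :=
  if hY : MDiffAt (T% Y) x then
    LinearMap.toContinuousLinearMap
      { toFun := fun v =>
          (InnerProductSpace.toDual ℝ (TangentSpace I x)).symm ((1 / 2 : ℝ) • koszulForm hY v)
        map_add' := fun v w => by simp
        map_smul' := fun c v => by simp [smul_comm c] }
  else 0

theorem inner_leviCivitaFun {x : M} {X Y Z : Π x : M, TangentSpace I x}
    (hX : MDiffAt (T% X) x) (hY : MDiffAt (T% Y) x) (hZ : MDiffAt (T% Z) x) :
    2 * inner ℝ (leviCivitaFun Y x (X x)) (Z x) = koszul I X Y Z x := by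
  rw [leviCivitaFun, dif_pos hY]
  have h : koszulForm hY (X x) (Z x) = koszul I X Y Z x := TensorialAt.mkHom₂_apply (Φ := fun X Z => koszul I X Y Z x)
    (fun _ hZ => koszul_tensorial_left hY hZ) (fun _ hX => koszul_tensorial_right hX hY) hX hZ
  simp [inner_smul_left, InnerProductSpace.toDual_symm_apply, h]

theorem leviCivitaFun_ext {x : M} {A B : TangentSpace I x →L[ℝ] TangentSpace I x}
    (h : ∀ v w : TangentSpace I x, 2 * inner ℝ (A v) w = 2 * inner ℝ (B v) w) : A = B := by
  ext v
  exact ext_inner_right ℝ fun w => by linarith [h v w]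

theorem inner_leviCivitaFun_extend {x : M} {Y : Π x : M, TangentSpace I x}
    (hY : MDiffAt (T% Y) x) (v w : TangentSpace I x) :
    2 * inner ℝ (leviCivitaFun Y x v) w =
      koszul I (extend E v) Y (extend E w) x := by
  have := inner_leviCivitaFun (mdifferentiableAt_extend I E v) hY (mdifferentiableAt_extend I E w)
  simpa using this

variable (I M) in
/-- The Levi-Civita connection of a Riemannian manifold; `leviCivita I M Y x v` is `∇_v Y` at `x`.
It is torsion free (`leviCivita_torsion`) and metric (`leviCivita_inner`). -/
def leviCivita : CovariantDerivative I E (fun x : M => TangentSpace I x) where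
  toFun := leviCivitaFun
  isCovariantDerivativeOnUniv :=
    { add := fun {Y Y' x} hY hY' _ => leviCivitaFun_ext fun v w => by
        rw [inner_leviCivitaFun_extend (mdifferentiableAt_add_section hY hY')]
        rw [koszul_add (mdifferentiableAt_extend I E v) hY hY' (mdifferentiableAt_extend I E w)]
        rw [← inner_leviCivitaFun_extend hY, ← inner_leviCivitaFun_extend hY']
        simp [inner_add_left]
        ring
      leibniz := fun {Y f x} hY hf _ => leviCivitaFun_ext fun v w => by
        rw [inner_leviCivitaFun_extend (hf.smul_section hY)]
        rw [koszul_smul hf (mdifferentiableAt_extend I E v) hY (mdifferentiableAt_extend I E w)]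
        rw [← inner_leviCivitaFun_extend hY]
        simp [inner_add_left, inner_smul_left]
        ring }

theorem leviCivita_torsion : (leviCivita I M).torsion = 0 := by
  rw [CovariantDerivative.torsion_eq_zero_iff]
  intro X Y x hX hY
  refine ext_inner_right ℝ fun w => ?_
  have h1 := inner_leviCivitaFun hX hY (mdifferentiableAt_extend I E w)
  have h2 := inner_leviCivitaFun hY hX (mdifferentiableAt_extend I E w)
  simp only [extend_apply_self] at h1 h2
  change inner ℝ (leviCivitaFun Y x (X x) - leviCivitaFun X x (Y x)) w = _
  rw [inner_sub_left]
  have h3 : mlieBracket I Y X x = - mlieBracket I X Y x := mlieBracket_swap_apply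
  have h4 : (fun q => inner ℝ (X q) (Y q)) = (fun q => inner ℝ (Y q) (X q)) := by
    ext q; exact real_inner_comm _ _
  simp only [koszul, h3, h4, extend_apply_self, inner_neg_left] at h1 h2
  linarith

theorem leviCivita_inner {x : M} {X Y Z : Π x : M, TangentSpace I x}
    (hX : MDiffAt (T% X) x) (hY : MDiffAt (T% Y) x) (hZ : MDiffAt (T% Z) x) :
    mvfderiv I (fun q => inner ℝ (Y q) (Z q)) x (X x) =
      inner ℝ (leviCivita I M Y x (X x)) (Z x) + inner ℝ (Y x) (leviCivita I M Z x (X x)) := by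
  have h1 := inner_leviCivitaFun hX hY hZ
  have h2 := inner_leviCivitaFun hX hZ hY
  change _ = inner ℝ (leviCivitaFun Y x (X x)) (Z x) + inner ℝ (Y x) (leviCivitaFun Z x (X x))
  rw [real_inner_comm _ (Y x)]
  have h3 : mlieBracket I Z Y x = - mlieBracket I Y Z x := mlieBracket_swap_apply
  have h4 : (fun q => inner ℝ (Z q) (Y q)) = (fun q => inner ℝ (Y q) (Z q)) := by
    ext q; exact real_inner_comm _ _
  simp only [koszul, h3, h4, inner_neg_left] at h1 h2
  linarith



/-! Curvature, with the convention `R(X, Y) = [∇_X, ∇_Y] - ∇_[X, Y]`. -/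

/-- `R(X, Y) Z` for vector fields `X`, `Y`, `Z`. -/
def curvatureField (X Y Z : Π x : M, TangentSpace I x) (x : M) : TangentSpace I x :=
  leviCivita I M (fun q => leviCivita I M Z q (Y q)) x (X x)
    - leviCivita I M (fun q => leviCivita I M Z q (X q)) x (Y x)
    - leviCivita I M Z x (mlieBracket I X Y x)

variable (I) in
/-- The curvature `R(u, v) w` of tangent vectors at `x`, computed by extending them to vector fields
which are smooth near `x` (the result does not depend on the extensions). -/
def curvature (x : M) (u v w : TangentSpace I x) : TangentSpace I x :=
  curvatureField (extend E u) (extend E v) (extend E w) x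

variable (I) in
/-- The Ricci tensor `Ric(u, v) = ∑ᵢ g(R(u, eᵢ) eᵢ, v)`, for an orthonormal basis `(eᵢ)`. -/
def ricci (x : M) (u v : TangentSpace I x) : ℝ :=
  ∑ i, inner ℝ (curvature I x u (stdOrthonormalBasis ℝ (TangentSpace I x) i)
    (stdOrthonormalBasis ℝ (TangentSpace I x) i)) v

variable (I) in
/-- The scalar curvature `s = ∑ᵢ Ric(eᵢ, eᵢ)`. -/
def scalarCurvature (x : M) : ℝ :=
  ∑ i, ricci I x (stdOrthonormalBasis ℝ (TangentSpace I x) i)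
    (stdOrthonormalBasis ℝ (TangentSpace I x) i)

/-- The `*`-Ricci tensor `Ric*(u, v) = ∑ᵢ g(R(u, eᵢ) J eᵢ, J v)`. -/
def starRicci (J : Π x : M, TangentSpace I x →L[ℝ] TangentSpace I x)
    (x : M) (u v : TangentSpace I x) : ℝ :=
  ∑ i, inner ℝ (curvature I x u (stdOrthonormalBasis ℝ (TangentSpace I x) i)
    (J x (stdOrthonormalBasis ℝ (TangentSpace I x) i))) (J x v)

/-- The `*`-scalar curvature `s* = ∑ᵢ Ric*(eᵢ, eᵢ)`. -/
def starScalarCurvature (J : Π x : M, TangentSpace I x →L[ℝ] TangentSpace I x) (x : M) : ℝ :=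
  ∑ i, starRicci J x (stdOrthonormalBasis ℝ (TangentSpace I x) i)
    (stdOrthonormalBasis ℝ (TangentSpace I x) i)

end LeviCivita

/-! ## The Riemannian volume measure -/

noncomputable section Volume

variable {m : ℕ} {M : Type*} [TopologicalSpace M] [ChartedSpace (EuclideanSpace ℝ (Fin m)) M]
  [RiemannianBundle (fun x : M => TangentSpace (𝓡 m) x)]

/-- The coordinate vector `∂ᵢ` of the chart at `c`, at the point with coordinates `u`. -/
def coordVec (c : M) (u : EuclideanSpace ℝ (Fin m)) (i : Fin m) :
    TangentSpace (𝓡 m) ((extChartAt (𝓡 m) c).symm u) :=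
  mfderiv 𝓘(ℝ, EuclideanSpace ℝ (Fin m)) (𝓡 m) (extChartAt (𝓡 m) c).symm u
    (EuclideanSpace.single i (1 : ℝ) : EuclideanSpace ℝ (Fin m))

/-- The volume density `√(det (g(∂ᵢ, ∂ⱼ)))` in the chart at `c`. -/
def volDensity (c : M) (u : EuclideanSpace ℝ (Fin m)) : ℝ :=
  √ (Matrix.of fun i j => (inner ℝ (coordVec c u i) (coordVec c u j) : ℝ)).det

/-- The measure `√(det g) du` of the domain of the chart at `c`, as a measure on `M`. -/
def chartVolume [MeasurableSpace M] (c : M) : Measure M :=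
  (((volume : Measure (EuclideanSpace ℝ (Fin m))).restrict (extChartAt (𝓡 m) c).target).withDensity
    (fun u => ENNReal.ofReal (volDensity c u))).map (extChartAt (𝓡 m) c).symm

/-- The Riemannian volume measure `vol_M`. The measures `√(det g) du` of two charts agree on the
intersection of the chart domains, and `vol_M`, the measure which restricts to each of them on the
domain of the corresponding chart, is their supremum in the lattice of measures. -/
def riemannianVolume (m : ℕ) (M : Type*) [TopologicalSpace M]
    [ChartedSpace (EuclideanSpace ℝ (Fin m)) M]
    [RiemannianBundle (fun x : M => TangentSpace (𝓡 m) x)] [MeasurableSpace M] : Measure M :=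
  ⨆ c : M, chartVolume (m := m) c

end Volume

/-! ## `SU(n)`-structures -/

noncomputable section Structures

/-- The pointwise squared norm of a complex-valued alternating form, for the Hermitian extension of
the inner product on real forms: `∑ |Ψ(e_{i₁}, …, e_{iₙ})|²` over `i₁ < ⋯ < iₙ`, written as `1 / n!`
times the sum over all index tuples. -/
def formNormSq {V : Type*} [NormedAddCommGroup V] [InnerProductSpace ℝ V] [FiniteDimensional ℝ V]
    {n : ℕ} (Ψ : V [⋀^Fin n]→L[ℝ] ℂ) : ℝ :=
  (n.factorial : ℝ)⁻¹ *
    ∑ f : Fin n → Fin (Module.finrank ℝ V), ‖Ψ (fun k => stdOrthonormalBasis ℝ V (f k))‖ ^ 2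

/-- An `SU(n)`-structure on a `2n`-dimensional Riemannian manifold: a smooth orthogonal almost
complex structure `J` and a smooth complex volume form `Ψ` (a form of type `(n, 0)`) of norm one. -/
structure SUStructure (n : ℕ) (M : Type*) [TopologicalSpace M]
    [ChartedSpace (EuclideanSpace ℝ (Fin (2 * n))) M] [IsManifold (𝓡 (2 * n)) ∞ M]
    [RiemannianBundle (fun x : M => TangentSpace (𝓡 (2 * n)) x)] where
  J : Π x : M, TangentSpace (𝓡 (2 * n)) x →L[ℝ] TangentSpace (𝓡 (2 * n)) x
  contMDiff_J : ContMDiff (𝓡 (2 * n)) ((𝓡 (2 * n)).prod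
      𝓘(ℝ, EuclideanSpace ℝ (Fin (2 * n)) →L[ℝ] EuclideanSpace ℝ (Fin (2 * n)))) ∞
    (fun x => TotalSpace.mk' (E := fun x : M =>
        TangentSpace (𝓡 (2 * n)) x →L[ℝ] TangentSpace (𝓡 (2 * n)) x)
      (EuclideanSpace ℝ (Fin (2 * n)) →L[ℝ] EuclideanSpace ℝ (Fin (2 * n))) x (J x))
  J_sq : ∀ x v, J x (J x v) = - v
  inner_J : ∀ x v w, inner ℝ (J x v) (J x w) = inner ℝ v w
  Ψ : Π x : M, TangentSpace (𝓡 (2 * n)) x [⋀^Fin n]→L[ℝ] ℂ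
  /-- `Ψ` is smooth: its value on smooth vector fields is smooth. -/
  contMDiff_Ψ : ∀ (x : M) (X : Fin n → Π y : M, TangentSpace (𝓡 (2 * n)) y),
    (∀ i, SmoothFieldAt (𝓡 (2 * n)) (X i) x) →
      ContMDiffAt (𝓡 (2 * n)) 𝓘(ℝ, ℂ) ∞ (fun y => Ψ y (fun i => X i y)) x
  /-- `Ψ` is of type `(n, 0)`. -/
  Ψ_J : ∀ x (v : Fin n → TangentSpace (𝓡 (2 * n)) x) (i : Fin n),
    Ψ x (Function.update v i (J x (v i))) = Complex.I * Ψ x v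
  normSq_Ψ : ∀ x, formNormSq (Ψ x) = 1

variable {n : ℕ} {M : Type*} [TopologicalSpace M]
  [ChartedSpace (EuclideanSpace ℝ (Fin (2 * n))) M] [IsManifold (𝓡 (2 * n)) ∞ M]
  [RiemannianBundle (fun x : M => TangentSpace (𝓡 (2 * n)) x)]
  [IsContMDiffRiemannianBundle (𝓡 (2 * n)) ∞ (EuclideanSpace ℝ (Fin (2 * n)))
    (fun x : M => TangentSpace (𝓡 (2 * n)) x)]

/-- A connection `D` on `TM` is an `SU(n)`-connection if it preserves `g`, `J` and `Ψ`. -/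
structure SUStructure.IsConnection (S : SUStructure n M)
    (D : CovariantDerivative (𝓡 (2 * n)) (EuclideanSpace ℝ (Fin (2 * n)))
      (fun x : M => TangentSpace (𝓡 (2 * n)) x)) : Prop where
  metric : ∀ (x : M) (v : TangentSpace (𝓡 (2 * n)) x) (Y Z : Π y : M, TangentSpace (𝓡 (2 * n)) y),
    DiffFieldAt (𝓡 (2 * n)) Y x → DiffFieldAt (𝓡 (2 * n)) Z x →
    mvfderiv (𝓡 (2 * n)) (fun y => (inner ℝ (Y y) (Z y) : ℝ)) x v =
      inner ℝ (D Y x v) (Z x) + inner ℝ (Y x) (D Z x v)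
  parallel_J : ∀ (x : M) (v : TangentSpace (𝓡 (2 * n)) x) (Y : Π y : M, TangentSpace (𝓡 (2 * n)) y),
    DiffFieldAt (𝓡 (2 * n)) Y x → D (fun y => S.J y (Y y)) x v = S.J x (D Y x v)
  parallel_Ψ : ∀ (x : M) (v : TangentSpace (𝓡 (2 * n)) x)
    (Y : Fin n → Π y : M, TangentSpace (𝓡 (2 * n)) y), (∀ i, DiffFieldAt (𝓡 (2 * n)) (Y i) x) →
    mvfderiv (𝓡 (2 * n)) (fun y => S.Ψ y (fun i => Y i y)) x v =
      ∑ i, S.Ψ x (Function.update (fun j => Y j x) i (D (Y i) x v))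

/-- `ξ` is the intrinsic torsion of the `SU(n)`-structure: `ξ_X Y = D_X Y - ∇_X Y`, where `D` is the
`SU(n)`-connection for which `ξ_X` takes values in `su(n)^⊥`. -/
def SUStructure.IsIntrinsicTorsion (S : SUStructure n M)
    (ξ : Π x : M, TangentSpace (𝓡 (2 * n)) x →L[ℝ]
      TangentSpace (𝓡 (2 * n)) x →L[ℝ] TangentSpace (𝓡 (2 * n)) x) : Prop :=
  (∀ x v, ξ x v ∈ suPerp (S.J x)) ∧
  ∃ D : CovariantDerivative (𝓡 (2 * n)) (EuclideanSpace ℝ (Fin (2 * n)))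
      (fun x : M => TangentSpace (𝓡 (2 * n)) x), S.IsConnection D ∧
    ∀ (x : M) (v : TangentSpace (𝓡 (2 * n)) x) (Y : Π y : M, TangentSpace (𝓡 (2 * n)) y),
      DiffFieldAt (𝓡 (2 * n)) Y x → ξ x v (Y x) = D Y x v - leviCivita (𝓡 (2 * n)) M Y x v

/-- The `SU(n)`-structure is of type `W₁ ⊕ W₅`: its intrinsic torsion lies in `W₁ ⊕ W₅` at every
point. -/
def SUStructure.IsTypeW1W5 (S : SUStructure n M) : Prop :=
  ∃ ξ : Π x : M, TangentSpace (𝓡 (2 * n)) x →L[ℝ]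
      TangentSpace (𝓡 (2 * n)) x →L[ℝ] TangentSpace (𝓡 (2 * n)) x,
    S.IsIntrinsicTorsion ξ ∧ ∀ x, ξ x ∈ W1 (S.J x) ⊔ W5 (S.J x)

end Structures

end SUStr

/-! Write the connection preserving `g`, `J`, `Ψ` as `D = ∇ + a + θ ⊗ J`, where `a` is the `W₁` part
of the torsion and `θ = ⟨ζ, J ·⟩` comes from the `W₅` part. The theorem is the integral of a
pointwise identity, `s = 5 s* + 8n div ζ`, combined with the divergence theorem.

The pointwise identity eliminates `|a|² = ∑ |a_{eᵢ} eⱼ|²` from two relations. First, `D J = 0` and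
the anticommutation of `a_X` with `J` give `∇_X J = 2 J a_X`, so `(∇_X J) X = 0`: the structure is
nearly Kähler. Gray's identity `⟨R(X,Y)JX, JY⟩ - ⟨R(X,Y)X, Y⟩ = |(∇_X J)Y|²`
(`IsNearlyKahler.inner_curvature_sub`) then sums to `s - s* = 4|a|²`. Second, the curvature of `D`
commutes with `J` and annihilates `Ψ`, so its complex trace is zero (`trace_J_comp_curvature`).
Comparing it with the Riemannian curvature on the pairs `(eᵢ, J eᵢ)` and `(eⱼ, J eⱼ)`, where Bianchi
produces `-2 s*` (`IsAlmostHermitian.sum_curvature_J`), gives `0 = -2 s* - 4n div ζ + 2|a|²`.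

Neither the torsion nor `D` is assumed smooth, and the divergence theorem needs a smooth `ζ`.
Smoothness of `a` is recovered from that of `J`, and smoothness of `θ` from that of `Ψ`
(`contMDiffAt_theta`).

The divergence theorem for `riemannianVolume` is proved by the coordinate formula `√(det g) div Y =
∑ ∂ₖ(√(det g) Yᵏ)` and a partition of unity. -/

namespace SUStr

/-! ## Vector fields which are smooth at a point -/

section SmoothFields

variable {E : Type*} [NormedAddCommGroup E] [NormedSpace ℝ E] [FiniteDimensional ℝ E]
  {H : Type*} [TopologicalSpace H] {I : ModelWithCorners ℝ E H}
  {M : Type*} [TopologicalSpace M] [ChartedSpace H M] [IsManifold I ∞ M]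

theorem SmoothFieldAt.diff {X : Π x : M, TangentSpace I x} {x : M} (hX : SmoothFieldAt I X x) :
    DiffFieldAt I X x :=
  ContMDiffAt.mdifferentiableAt hX (by simp)

theorem eventually_mdifferentiableAt_of_contMDiffAt {F : Type*} [NormedAddCommGroup F]
    [NormedSpace ℝ F] {f : M → F} {x : M} (hf : CMDiffAt ∞ f x) : ∀ᶠ y in nhds x, MDiffAt f y := by
  have : CMDiffAt 1 f x := hf.of_le (by exact_mod_cast le_top)
  filter_upwards [(contMDiffAt_iff_contMDiffAt_nhds (by simp)).1 this] with y hy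
  exact hy.mdifferentiableAt (by simp)

theorem SmoothFieldAt.eventually_diff {X : Π x : M, TangentSpace I x} {x : M}
    (hX : SmoothFieldAt I X x) : ∀ᶠ y in nhds x, DiffFieldAt I X y := by
  have : CMDiffAt 1 (T% X) x := ContMDiffAt.of_le hX (by exact_mod_cast le_top)
  filter_upwards [(contMDiffAt_iff_contMDiffAt_nhds (by simp)).1 this] with y hy
  exact hy.mdifferentiableAt (by simp)

theorem smoothFieldAt_extend {x : M} (v : TangentSpace I x) :
    SmoothFieldAt I (extend E v) x :=
  contMDiffAt_extend I E v

theorem SmoothFieldAt.add {X Y : Π x : M, TangentSpace I x} {x : M} (hX : SmoothFieldAt I X x)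
    (hY : SmoothFieldAt I Y x) : SmoothFieldAt I (fun y => X y + Y y) x :=
  ContMDiffAt.add_section hX hY

theorem SmoothFieldAt.sub {X Y : Π x : M, TangentSpace I x} {x : M} (hX : SmoothFieldAt I X x)
    (hY : SmoothFieldAt I Y x) : SmoothFieldAt I (fun y => X y - Y y) x :=
  ContMDiffAt.sub_section hX hY

theorem SmoothFieldAt.smul {X : Π x : M, TangentSpace I x} {f : M → ℝ} {x : M}
    (hf : CMDiffAt ∞ f x) (hX : SmoothFieldAt I X x) : SmoothFieldAt I (fun y => f y • X y) x :=
  ContMDiffAt.smul_section hf hX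

theorem SmoothFieldAt.const_smul {X : Π x : M, TangentSpace I x} (c : ℝ) {x : M}
    (hX : SmoothFieldAt I X x) : SmoothFieldAt I (fun y => c • X y) x :=
  SmoothFieldAt.smul contMDiffAt_const hX

theorem SmoothFieldAt.sum {ι : Type*} {s : Finset ι} {X : ι → Π x : M, TangentSpace I x} {x : M}
    (hX : ∀ i ∈ s, SmoothFieldAt I (X i) x) : SmoothFieldAt I (fun y => ∑ i ∈ s, X i y) x :=
  ContMDiffAt.sum_section hX

theorem SmoothFieldAt.congr {X Y : Π x : M, TangentSpace I x} {x : M} (hX : SmoothFieldAt I X x)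
    (h : ∀ᶠ y in nhds x, Y y = X y) : SmoothFieldAt I Y x :=
  ContMDiffAt.congr_of_eventuallyEq hX (h.mono fun y hy => by simp [hy])

theorem smoothFieldAt_zero (x : M) : SmoothFieldAt I (fun _ => 0) x :=
  contMDiff_zeroSection ℝ (TangentSpace I : M → Type _) x

theorem SmoothFieldAt.lieBracket {X Y : Π x : M, TangentSpace I x} {x : M}
    (hX : SmoothFieldAt I X x) (hY : SmoothFieldAt I Y x) :
    SmoothFieldAt I (mlieBracket I X Y) x := by
  have : IsManifold I (minSmoothness ℝ 2) M := by
    rw [minSmoothness_of_isRCLikeNormedField]; infer_instance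
  have : IsManifold I (((⊤ : ℕ∞) : ℕ∞ω) + 1) M := by
    have : (((⊤ : ℕ∞) : ℕ∞ω) + 1) = ∞ := rfl
    rw [this]; infer_instance
  have : CompleteSpace E := FiniteDimensional.complete ℝ E
  exact ContMDiffAt.mlieBracket_vectorField (m := ⊤) (n := ⊤) hX hY (by simp)

/-- In tangent coordinates the differential of `f` is a smooth family of linear maps; applied to `X`
it gives a smooth curve of points of the tangent bundle of `F`, whose fibre component is the
derivative. -/
theorem contMDiffAt_mvfderiv_apply {F : Type*} [NormedAddCommGroup F] [NormedSpace ℝ F]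
    {f : M → F} {X : Π x : M, TangentSpace I x} {x : M}
    (hf : CMDiffAt ∞ f x) (hX : SmoothFieldAt I X x) :
    CMDiffAt ∞ (fun y => mvfderiv I f y (X y)) x := by
  have h1 : ContMDiffAt I 𝓘(ℝ, E →L[ℝ] F) ∞
      (inTangentCoordinates I 𝓘(ℝ, F) id f (fun y => mfderiv I 𝓘(ℝ, F) f y) x) x :=
    hf.mfderiv_const (m := ∞) le_rfl
  have h2 : ContMDiffAt I 𝓘(ℝ, F).tangent ∞
      (fun y => (⟨f y, mfderiv I 𝓘(ℝ, F) f y (X y)⟩ : TangentBundle 𝓘(ℝ, F) F)) x :=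
    ContMDiffAt.clm_apply_of_inCoordinates (b₁ := id) (b₂ := f) h1 hX hf
  exact (contMDiff_snd_tangentBundle_modelSpace F 𝓘(ℝ, F)).contMDiffAt.comp x h2

end SmoothFields

/-! ### Orthonormal frames, smoothness of the Levi-Civita connection, the bracket as a commutator -/

section RiemannianFields

variable {E : Type*} [NormedAddCommGroup E] [NormedSpace ℝ E] [FiniteDimensional ℝ E]
  {H : Type*} [TopologicalSpace H] {I : ModelWithCorners ℝ E H}
  {M : Type*} [TopologicalSpace M] [ChartedSpace H M] [IsManifold I ∞ M]
  [RiemannianBundle (fun x : M => TangentSpace I x)]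
  [IsContMDiffRiemannianBundle I ∞ E (fun x : M => TangentSpace I x)]

theorem SmoothFieldAt.contMDiffAt_inner {X Y : Π x : M, TangentSpace I x} {x : M} (hX : SmoothFieldAt I X x)
    (hY : SmoothFieldAt I Y x) : CMDiffAt ∞ (fun y => (inner ℝ (X y) (Y y) : ℝ)) x :=
  ContMDiffAt.inner_bundle (E := fun x : M => TangentSpace I x) hX hY

-- Gram–Schmidt applied to the local frame of a trivialization. Smoothness goes by recursion on the
-- index: each projection coefficient is a quotient with nonvanishing denominator, and the norm is
-- the square root of a positive smooth function.
open InnerProductSpace in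
theorem exists_orthonormal_frame (I : ModelWithCorners ℝ E H)
  [IsManifold I ∞ M]
  [RiemannianBundle (fun x : M => TangentSpace I x)]
  [IsContMDiffRiemannianBundle I ∞ E (fun x : M => TangentSpace I x)] (x : M) :
    ∃ (s : Fin (Module.finrank ℝ E) → Π y : M, TangentSpace I y) (u : Set M), IsOpen u ∧ x ∈ u ∧
      (∀ i, ∀ y ∈ u, SmoothFieldAt I (s i) y) ∧
      ∀ y ∈ u, Orthonormal ℝ (fun i => s i y) := by
  let e := trivializationAt E (TangentSpace I : M → Type _) x
  let b := Module.finBasis ℝ E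
  let f := e.localFrame b
  have hf : IsLocalFrameOn I E ∞ f e.baseSet := e.isLocalFrameOn_localFrame_baseSet I ∞ b
  have hsm : ∀ i, ∀ y ∈ e.baseSet, SmoothFieldAt I (f i) y := fun i y hy =>
    hf.contMDiffAt e.open_baseSet hy i
  have hli : ∀ y ∈ e.baseSet, LinearIndependent ℝ (fun i => f i y) := fun y hy =>
    hf.linearIndependent hy
  have hgs : ∀ i, ∀ y ∈ e.baseSet,
      SmoothFieldAt I (fun q => gramSchmidt ℝ (fun i => f i q) i) y := by
    intro i
    induction i using WellFoundedLT.induction with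
    | ind i ih =>
      intro y hy
      have h : (fun q => gramSchmidt ℝ (fun i => f i q) i) = fun q => f i q -
          ∑ j ∈ Finset.Iio i, ((inner ℝ (gramSchmidt ℝ (fun i => f i q) j) (f i q) : ℝ) /
            (inner ℝ (gramSchmidt ℝ (fun i => f i q) j) (gramSchmidt ℝ (fun i => f i q) j) : ℝ)) •
              gramSchmidt ℝ (fun i => f i q) j := by
        ext1 q
        rw [gramSchmidt_def]
        simp only [Submodule.starProjection_singleton, real_inner_self_eq_norm_sq]
        rfl
      rw [h]
      refine (hsm i y hy).sub (SmoothFieldAt.sum fun j hj => SmoothFieldAt.smul ?_ ?_)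
      · have hj' := ih j (Finset.mem_Iio.1 hj) y hy
        refine ContMDiffAt.div₀ (hj'.contMDiffAt_inner (hsm i y hy)) (hj'.contMDiffAt_inner hj') ?_
        exact inner_self_ne_zero.2 (gramSchmidt_ne_zero j (hli y hy))
      · exact ih j (Finset.mem_Iio.1 hj) y hy
  refine ⟨fun i y => gramSchmidtNormed ℝ (fun i => f i y) i, e.baseSet, e.open_baseSet,
    FiberBundle.mem_baseSet_trivializationAt' x, fun i y hy => ?_, fun y hy =>
      gramSchmidtNormed_orthonormal (hli y hy)⟩
  have h : (fun q => gramSchmidtNormed ℝ (fun i => f i q) i) = fun q =>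
      (√ (inner ℝ (gramSchmidt ℝ (fun i => f i q) i) (gramSchmidt ℝ (fun i => f i q) i) : ℝ))⁻¹ •
        gramSchmidt ℝ (fun i => f i q) i := by
    ext1 q
    rw [gramSchmidtNormed, ← norm_eq_sqrt_real_inner]
    rfl
  change SmoothFieldAt I (fun q => gramSchmidtNormed ℝ (fun i => f i q) i) y
  rw [h]
  have hpos : (0 : ℝ) < inner ℝ (gramSchmidt ℝ (fun i => f i y) i)
      (gramSchmidt ℝ (fun i => f i y) i) :=
    real_inner_self_pos.2 (gramSchmidt_ne_zero i (hli y hy))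
  refine SmoothFieldAt.smul (ContMDiffAt.inv₀ ?_ (Real.sqrt_ne_zero'.2 hpos)) (hgs i y hy)
  exact (Real.contDiffAt_sqrt hpos.ne').contMDiffAt.comp y ((hgs i y hy).contMDiffAt_inner (hgs i y hy))

/-- The orthonormal basis of a tangent space given by an orthonormal family of full cardinality. -/
noncomputable def orthonormalBasisOfFamily {x : M}
    {s : Fin (Module.finrank ℝ E) → TangentSpace I x} (hs : Orthonormal ℝ s) :
    OrthonormalBasis (Fin (Module.finrank ℝ E)) ℝ (TangentSpace I x) :=
  OrthonormalBasis.mk hs (by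
    exact (hs.linearIndependent.span_eq_top_of_card_eq_finrank' (Fintype.card_fin _)).ge)

@[simp]
theorem orthonormalBasisOfFamily_apply {x : M}
    {s : Fin (Module.finrank ℝ E) → TangentSpace I x} (hs : Orthonormal ℝ s)
    (i : Fin (Module.finrank ℝ E)) : orthonormalBasisOfFamily hs i = s i := by
  simp [orthonormalBasisOfFamily]

theorem sum_inner_smul_of_orthonormal {x : M}
    {s : Fin (Module.finrank ℝ E) → TangentSpace I x} (hs : Orthonormal ℝ s)
    (v : TangentSpace I x) : ∑ i, (inner ℝ (s i) v : ℝ) • s i = v := by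
  simpa using (orthonormalBasisOfFamily hs).sum_repr' v

/-- A vector field is smooth if its inner products with smooth vector fields are. -/
theorem smoothFieldAt_of_inner {X : Π x : M, TangentSpace I x} {x : M}
    (h : ∀ Y : Π x : M, TangentSpace I x, SmoothFieldAt I Y x →
      CMDiffAt ∞ (fun y => (inner ℝ (Y y) (X y) : ℝ)) x) : SmoothFieldAt I X x := by
  obtain ⟨s, u, hu, hxu, hs, ho⟩ := exists_orthonormal_frame I x
  have h1 : SmoothFieldAt I (fun y => ∑ i, (inner ℝ (s i y) (X y) : ℝ) • s i y) x :=
    SmoothFieldAt.sum fun i _ => SmoothFieldAt.smul (h _ (hs i x hxu)) (hs i x hxu)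
  refine h1.congr ?_
  filter_upwards [hu.mem_nhds hxu] with y hy
  exact (sum_inner_smul_of_orthonormal (ho y hy) (X y)).symm

theorem contMDiffAt_koszul {X Y Z : Π x : M, TangentSpace I x} {x : M} (hX : SmoothFieldAt I X x)
    (hY : SmoothFieldAt I Y x) (hZ : SmoothFieldAt I Z x) : CMDiffAt ∞ (koszul I X Y Z) x := by
  unfold koszul
  exact (((((contMDiffAt_mvfderiv_apply (hY.contMDiffAt_inner hZ) hX).add
    (contMDiffAt_mvfderiv_apply (hX.contMDiffAt_inner hZ) hY)).sub
    (contMDiffAt_mvfderiv_apply (hX.contMDiffAt_inner hY) hZ)).add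
    ((hX.lieBracket hY).contMDiffAt_inner hZ)).sub ((hX.lieBracket hZ).contMDiffAt_inner hY)).sub
    ((hY.lieBracket hZ).contMDiffAt_inner hX)

/-- It is enough to pair with a smooth `Z`, and there the Koszul formula expresses the pairing
through derivatives and brackets of smooth data. -/
theorem SmoothFieldAt.covDeriv {X Y : Π x : M, TangentSpace I x} {x : M}
    (hY : SmoothFieldAt I Y x) (hX : SmoothFieldAt I X x) :
    SmoothFieldAt I (fun y => leviCivita I M Y y (X y)) x := by
  refine smoothFieldAt_of_inner fun Z hZ => ?_
  have h1 : CMDiffAt ∞ (fun y => 2⁻¹ * koszul I X Y Z y) x :=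
    contMDiffAt_const.mul (contMDiffAt_koszul hX hY hZ)
  refine h1.congr_of_eventuallyEq ?_
  filter_upwards [hX.eventually_diff, hY.eventually_diff, hZ.eventually_diff] with y h2 h3 h4
  rw [← inner_leviCivitaFun h2 h3 h4, real_inner_comm]
  change _ = 2⁻¹ * (2 * inner ℝ (leviCivita I M Y y (X y)) (Z y))
  ring

theorem leviCivita_sub_swap {X Y : Π x : M, TangentSpace I x} {x : M} (hX : DiffFieldAt I X x)
    (hY : DiffFieldAt I Y x) :
    leviCivita I M Y x (X x) - leviCivita I M X x (Y x) = mlieBracket I X Y x :=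
  (CovariantDerivative.torsion_eq_zero_iff _).1 leviCivita_torsion hX hY

theorem mvfderiv_congr {F : Type*} [NormedAddCommGroup F] [NormedSpace ℝ F] {f g : M → F} {x : M}
    (h : ∀ᶠ y in nhds x, f y = g y) : mvfderiv I f x = mvfderiv I g x := by
  have h0 : f x = g x := h.self_of_nhds
  have h1 : mfderiv I 𝓘(ℝ, F) f x = mfderiv I 𝓘(ℝ, F) g x := Filter.EventuallyEq.mfderiv_eq h
  ext v
  exact congrArg (fun L : E →L[ℝ] F => L v) h1

theorem mdifferentiableAt_fun_sum {ι F : Type*} [NormedAddCommGroup F] [NormedSpace ℝ F]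
    {s : Finset ι} {f : ι → M → F} {x : M} (h : ∀ i ∈ s, MDiffAt (f i) x) :
    MDiffAt (fun y => ∑ i ∈ s, f i y) x := by
  classical
  induction s using Finset.induction_on with
  | empty => simpa using mdifferentiableAt_const
  | insert a s ha ih =>
    simp only [Finset.mem_insert, forall_eq_or_imp] at h
    simp only [Finset.sum_insert ha]
    exact MDifferentiableAt.add h.1 (ih h.2)

theorem mvfderiv_fun_sum {ι F : Type*} [NormedAddCommGroup F] [NormedSpace ℝ F] {s : Finset ι}
    {f : ι → M → F} {x : M} (h : ∀ i ∈ s, MDiffAt (f i) x) :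
    mvfderiv I (fun y => ∑ i ∈ s, f i y) x = ∑ i ∈ s, mvfderiv I (f i) x := by
  classical
  induction s using Finset.induction_on with
  | empty => simpa using! mvfderiv_const (I := I) (0 : F) (x := x)
  | insert a s ha ih =>
    simp only [Finset.mem_insert, forall_eq_or_imp] at h
    simp only [Finset.sum_insert ha]
    rw [mvfderiv_fun_add h.1, ih h.2]
    exact mdifferentiableAt_fun_sum h.2

/-- `[X, Y] f = X (Y f) - Y (X f)`. -/
theorem mvfderiv_mlieBracket {X Y : Π x : M, TangentSpace I x} {f : M → ℝ} {x : M}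
    (hX : SmoothFieldAt I X x) (hY : SmoothFieldAt I Y x) (hf : CMDiffAt ∞ f x) :
    mvfderiv I f x (mlieBracket I X Y x) =
      mvfderiv I (fun y => mvfderiv I f y (Y y)) x (X x) -
        mvfderiv I (fun y => mvfderiv I f y (X y)) x (Y x) := by
  -- The argument needs a nonzero tangent vector to compare coefficients; in a zero tangent space
  -- both sides vanish.
  by_cases hn : Subsingleton (TangentSpace I x)
  · rw [Subsingleton.elim (X x) 0, Subsingleton.elim (Y x) 0,
      Subsingleton.elim (mlieBracket I X Y x) 0]
    simp
  rw [not_subsingleton_iff_nontrivial] at hn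
  obtain ⟨w, hw⟩ := exists_ne (0 : TangentSpace I x)
  have : CompleteSpace E := FiniteDimensional.complete ℝ E
  have : IsManifold I (minSmoothness ℝ 3) M := by
    rw [minSmoothness_of_isRCLikeNormedField]; infer_instance
  set W : Π x : M, TangentSpace I x := extend E w
  have hW : SmoothFieldAt I W x := smoothFieldAt_extend w
  have hmf : MDiffAt f x := hf.mdifferentiableAt (by simp)
  have h2top : minSmoothness ℝ 2 ≤ ∞ := by
    rw [minSmoothness_of_isRCLikeNormedField]; exact ENat.LEInfty.out
  -- The identity is extracted from the Jacobi identity for `X`, `Y` and `f W`. After expansion by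
  -- the Leibniz rule the cross terms cancel, the Jacobi identity for `W` removes the
  -- undifferentiated terms, and what remains is a multiple of the nonzero vector `W x`.
  have key : ∀ {U V W : Π x : M, TangentSpace I x}, SmoothFieldAt I U x → SmoothFieldAt I V x →
      SmoothFieldAt I W x → mlieBracket I U (mlieBracket I V W) x =
          mlieBracket I (mlieBracket I U V) W x + mlieBracket I V (mlieBracket I U W) x :=
    fun hU hV hW => leibniz_identity_mlieBracket_apply
      (ContMDiffAt.of_le hU h2top) (ContMDiffAt.of_le hV h2top)
      (ContMDiffAt.of_le hW h2top)
  have hE : ∀ Z : Π x : M, TangentSpace I x, ∀ᶠ y in nhds x, mlieBracket I Z (f • W) y =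
      ((fun y => mvfderiv I f y (Z y)) • W + f • mlieBracket I Z W) y := by
    intro Z
    filter_upwards [hW.eventually_diff, eventually_mdifferentiableAt_of_contMDiffAt hf] with y h1 h2
    rw [mlieBracket_smul_right h2 h1]
    rfl
  have hZ : ∀ {Z Z' : Π x : M, TangentSpace I x}, SmoothFieldAt I Z x → SmoothFieldAt I Z' x →
      mlieBracket I Z' (mlieBracket I Z (f • W)) x =
      mvfderiv I (fun y => mvfderiv I f y (Z y)) x (Z' x) • W x +
        mvfderiv I f x (Z x) • mlieBracket I Z' W x +
        (mvfderiv I f x (Z' x) • mlieBracket I Z W x +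
          f x • mlieBracket I Z' (mlieBracket I Z W) x) := by
    intro Z Z' h h'
    have hd : CMDiffAt ∞ (fun y => mvfderiv I f y (Z y)) x := contMDiffAt_mvfderiv_apply hf h
    rw [Filter.EventuallyEq.mlieBracket_vectorField_eq (V := Z') (W := (fun y => mvfderiv I f y (Z y)) • W + f • mlieBracket I Z W)
        (Filter.EventuallyEq.refl _ _) (hE Z),
      mlieBracket_add_right (W := (fun y => mvfderiv I f y (Z y)) • W)
        (W₁ := f • mlieBracket I Z W) (SmoothFieldAt.diff (SmoothFieldAt.smul hd hW))
        (SmoothFieldAt.diff (SmoothFieldAt.smul hf (h.lieBracket hW))),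
      mlieBracket_smul_right (hd.mdifferentiableAt (by simp)) hW.diff,
      mlieBracket_smul_right hmf (h.lieBracket hW).diff]
  have h1 := key hX hY (SmoothFieldAt.smul hf hW)
  change mlieBracket I X (mlieBracket I Y (f • W)) x =
          mlieBracket I (mlieBracket I X Y) (f • W) x + mlieBracket I Y (mlieBracket I X (f • W)) x at h1
  have h2 := key hX hY hW
  rw [hZ hY hX, hZ hX hY, mlieBracket_smul_right hmf hW.diff, h2] at h1
  have h3 : (mvfderiv I f x (mlieBracket I X Y x)) • W x =
      (mvfderiv I (fun y => mvfderiv I f y (Y y)) x (X x) -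
        mvfderiv I (fun y => mvfderiv I f y (X y)) x (Y x)) • W x := by
    rw [sub_smul, eq_sub_iff_add_eq]
    rw [smul_add] at h1
    have h4 := sub_eq_zero.2 h1
    rw [← sub_eq_zero, ← neg_eq_zero, ← h4]
    abel
  exact smul_left_injective ℝ (show W x ≠ 0 by simpa [W] using hw) h3

end RiemannianFields

/-! ### Tensoriality of curvature and the first Bianchi identity -/

section Curvature

variable {E : Type*} [NormedAddCommGroup E] [NormedSpace ℝ E] [FiniteDimensional ℝ E]
  {H : Type*} [TopologicalSpace H] {I : ModelWithCorners ℝ E H}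
  {M : Type*} [TopologicalSpace M] [ChartedSpace H M] [IsManifold I ∞ M]
  [RiemannianBundle (fun x : M => TangentSpace I x)]
  [IsContMDiffRiemannianBundle I ∞ E (fun x : M => TangentSpace I x)]

/-- An operation on smooth vector fields which is linear over smooth functions depends only on the
value of the vector field at the point. -/
theorem eq_of_tensorial {A : Type*} [AddCommGroup A] [Module ℝ A]
    {Φ : (Π x : M, TangentSpace I x) → A} {x : M}
    (hadd : ∀ X Y, SmoothFieldAt I X x → SmoothFieldAt I Y x → Φ (fun y => X y + Y y) = Φ X + Φ Y)
    (hsmul : ∀ (f : M → ℝ) X, CMDiffAt ∞ f x → SmoothFieldAt I X x →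
      Φ (fun y => f y • X y) = f x • Φ X)
    {X Y : Π x : M, TangentSpace I x} (hX : SmoothFieldAt I X x) (hY : SmoothFieldAt I Y x)
    (h : X x = Y x) : Φ X = Φ Y := by
  classical
  have hzero : Φ 0 = 0 := by
    have := hsmul (fun _ => 0) 0 contMDiffAt_const (smoothFieldAt_zero x)
    simp only [Pi.zero_apply, smul_zero, zero_smul] at this
    exact this
  have hloc : ∀ {X Y : Π x : M, TangentSpace I x}, SmoothFieldAt I X x → SmoothFieldAt I Y x →
      (∀ᶠ y in nhds x, X y = Y y) → Φ X = Φ Y := by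
    intro X Y hX hY h
    -- The indicator of the coincidence set serves as cutoff: smoothness is required only at `x`,
    -- near which it is constantly `1`, so no bump function is needed.
    let ψ : M → ℝ := fun y => if X y = Y y then 1 else 0
    have hψ : CMDiffAt ∞ ψ x :=
      (contMDiffAt_const (c := (1 : ℝ))).congr_of_eventuallyEq (h.mono fun y hy => by simp [ψ, hy])
    have hx : ψ x = 1 := by simp [ψ, h.self_of_nhds]
    have he : (fun y => ψ y • X y) = fun y => ψ y • Y y := by
      ext1 y
      simp only [ψ]
      split_ifs with hy <;> simp [hy]
    have h1 := hsmul ψ X hψ hX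
    have h2 := hsmul ψ Y hψ hY
    rw [hx, one_smul] at h1 h2
    rw [← h1, ← h2, he]
  obtain ⟨s, u, hu, hxu, hs, ho⟩ := exists_orthonormal_frame I x
  have hsum : ∀ (t : Finset (Fin (Module.finrank ℝ E))) {X : Π x : M, TangentSpace I x},
      SmoothFieldAt I X x → Φ (fun y => ∑ i ∈ t, (inner ℝ (s i y) (X y) : ℝ) • s i y) =
        ∑ i ∈ t, (inner ℝ (s i x) (X x) : ℝ) • Φ (s i) := by
    intro t X hX
    have hc : ∀ i, CMDiffAt ∞ (fun y => (inner ℝ (s i y) (X y) : ℝ)) x := fun i =>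
      (hs i x hxu).contMDiffAt_inner hX
    induction t using Finset.induction_on with
    | empty => simpa using! hzero
    | insert a t ha ih =>
      simp only [Finset.sum_insert ha]
      rw [← ih]
      exact (hadd _ _ ((hs a x hxu).smul (hc a))
        (SmoothFieldAt.sum fun i _ => (hs i x hxu).smul (hc i))).trans
        (congrArg (· + _) (hsmul _ _ (hc a) (hs a x hxu)))
  have hfull : ∀ {X : Π x : M, TangentSpace I x}, SmoothFieldAt I X x →
      Φ X = ∑ i, (inner ℝ (s i x) (X x) : ℝ) • Φ (s i) := by
    intro X hX
    rw [← hsum Finset.univ hX]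
    refine hloc hX (SmoothFieldAt.sum fun i _ =>
      (hs i x hxu).smul ((hs i x hxu).contMDiffAt_inner hX)) ?_
    filter_upwards [hu.mem_nhds hxu] with y hy
    exact (sum_inner_smul_of_orthonormal (ho y hy) (X y)).symm
  rw [hfull hX, hfull hY, h]

variable (D : CovariantDerivative I E (fun x : M => TangentSpace I x))

/-- The connection `D` maps smooth vector fields to smooth vector fields. -/
def IsSmoothConnection : Prop :=
  ∀ (x : M) (X Y : Π x : M, TangentSpace I x), SmoothFieldAt I X x → SmoothFieldAt I Y x →
    SmoothFieldAt I (fun y => D Y y (X y)) x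

theorem isSmoothConnection_leviCivita : IsSmoothConnection (leviCivita I M) :=
  fun _ _ _ hX hY => hY.covDeriv hX

variable {D}

theorem conn_add {X Y : Π x : M, TangentSpace I x} {x : M} (hX : DiffFieldAt I X x)
    (hY : DiffFieldAt I Y x) (v : TangentSpace I x) : D (fun y => X y + Y y) x v = D X x v + D Y x v := by
  change D (X + Y) x v = _
  rw [D.isCovariantDerivativeOnUniv.add hX hY]; rfl

theorem conn_smul {X : Π x : M, TangentSpace I x} {f : M → ℝ} {x : M} (hf : MDiffAt f x)
    (hX : DiffFieldAt I X x) (v : TangentSpace I x) :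
    D (fun y => f y • X y) x v = f x • D X x v + mvfderiv I f x v • X x := by
  change D (f • X) x v = _
  rw [D.isCovariantDerivativeOnUniv.leibniz hX hf]; rfl

theorem conn_congr {X Y : Π x : M, TangentSpace I x} {x : M} (hX : DiffFieldAt I X x)
    (hY : DiffFieldAt I Y x) (h : ∀ᶠ y in nhds x, X y = Y y) : D X x = D Y x :=
  D.isCovariantDerivativeOnUniv.congr_of_eventuallyEq hX hY Filter.univ_mem h

theorem conn_sub {X Y : Π x : M, TangentSpace I x} {x : M} (hX : DiffFieldAt I X x)
    (hY : DiffFieldAt I Y x) (v : TangentSpace I x) : D (fun y => X y - Y y) x v = D X x v - D Y x v := by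
  have h := conn_add (D := D) (X := fun y => X y - Y y) (mdifferentiableAt_sub_section hX hY) hY v
  rw [eq_sub_iff_add_eq, ← h]
  simp only [sub_add_cancel]

variable (D) in
/-- The curvature `R(X, Y) Z = D_X D_Y Z - D_Y D_X Z - D_[X, Y] Z` of a connection. -/
noncomputable def connCurvature (X Y Z : Π x : M, TangentSpace I x) (x : M) : TangentSpace I x :=
  D (fun q => D Z q (Y q)) x (X x) - D (fun q => D Z q (X q)) x (Y x)
    - D Z x (mlieBracket I X Y x)

theorem connCurvature_swap (X Y Z : Π x : M, TangentSpace I x) (x : M) :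
    connCurvature D Y X Z x = - connCurvature D X Y Z x := by
  have h : mlieBracket I Y X x = - mlieBracket I X Y x := mlieBracket_swap_apply
  simp only [connCurvature, h, map_neg]
  abel

variable {x : M} {X X' Y Z Z' : Π x : M, TangentSpace I x}

theorem connCurvature_add_left (hD : IsSmoothConnection D) (hX : SmoothFieldAt I X x)
    (hX' : SmoothFieldAt I X' x) (hZ : SmoothFieldAt I Z x) :
    connCurvature D (fun y => X y + X' y) Y Z x = connCurvature D X Y Z x + connCurvature D X' Y Z x := by
  have h1 : mlieBracket I (fun y => X y + X' y) Y x = mlieBracket I X Y x + mlieBracket I X' Y x :=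
    mlieBracket_add_left hX.diff hX'.diff
  simp only [connCurvature, h1, map_add]
  rw [conn_add (hD _ _ _ hX hZ).diff (hD _ _ _ hX' hZ).diff]
  abel

theorem connCurvature_smul_left (hD : IsSmoothConnection D) {f : M → ℝ} (hf : CMDiffAt ∞ f x)
    (hX : SmoothFieldAt I X x) (hZ : SmoothFieldAt I Z x) :
    connCurvature D (fun y => f y • X y) Y Z x = f x • connCurvature D X Y Z x := by
  have hf' : MDiffAt f x := hf.mdifferentiableAt (by simp)
  have h1 : mlieBracket I (fun y => f y • X y) Y x = _ := mlieBracket_smul_left hf' hX.diff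
  simp only [connCurvature, h1, map_add, map_smul]
  rw [conn_smul hf' (hD _ _ _ hX hZ).diff]
  simp only [smul_sub, neg_smul]
  abel

theorem connCurvature_add_right (hD : IsSmoothConnection D) (hX : SmoothFieldAt I X x)
    (hY : SmoothFieldAt I Y x) (hZ : SmoothFieldAt I Z x) (hZ' : SmoothFieldAt I Z' x) :
    connCurvature D X Y (fun y => Z y + Z' y) x = connCurvature D X Y Z x + connCurvature D X Y Z' x := by
  have h1 : ∀ {W : Π x : M, TangentSpace I x}, SmoothFieldAt I W x →
      D (fun q => D (fun y => Z y + Z' y) q (W q)) x =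
        D (fun q => D Z q (W q) + D Z' q (W q)) x := by
    intro W hW
    refine conn_congr (hD _ _ _ hW (hZ.add hZ')).diff
      ((hD _ _ _ hW hZ).add (hD _ _ _ hW hZ')).diff ?_
    filter_upwards [hZ.eventually_diff, hZ'.eventually_diff] with y h1 h2
    exact conn_add h1 h2 _
  simp only [connCurvature]
  rw [h1 hX, h1 hY, conn_add (hD _ _ _ hX hZ).diff (hD _ _ _ hX hZ').diff,
    conn_add (hD _ _ _ hY hZ).diff (hD _ _ _ hY hZ').diff, conn_add hZ.diff hZ'.diff]
  abel

/-- The first-derivative terms are symmetric in `X` and `Y` and drop out; the second derivatives of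
`f` combine to `[X, Y] f`, which the bracket term of the curvature cancels. -/
theorem connCurvature_smul_right (hD : IsSmoothConnection D) {f : M → ℝ} (hf : CMDiffAt ∞ f x)
    (hX : SmoothFieldAt I X x) (hY : SmoothFieldAt I Y x) (hZ : SmoothFieldAt I Z x) :
    connCurvature D X Y (fun y => f y • Z y) x = f x • connCurvature D X Y Z x := by
  have hf' : MDiffAt f x := hf.mdifferentiableAt (by simp)
  have h1 : ∀ {W W' : Π x : M, TangentSpace I x}, SmoothFieldAt I W x → SmoothFieldAt I W' x →
      D (fun q => D (fun y => f y • Z y) q (W q)) x (W' x) =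
        f x • D (fun q => D Z q (W q)) x (W' x) + mvfderiv I f x (W' x) • D Z x (W x) +
        (mvfderiv I f x (W x) • D Z x (W' x) +
          mvfderiv I (fun q => mvfderiv I f q (W q)) x (W' x) • Z x) := by
    intro W W' hW hW'
    have hd := contMDiffAt_mvfderiv_apply hf hW
    have h2 : D (fun q => D (fun y => f y • Z y) q (W q)) x =
        D (fun q => f q • D Z q (W q) + mvfderiv I f q (W q) • Z q) x := by
      refine conn_congr (hD _ _ _ hW (hZ.smul hf)).diff
        (((hD _ _ _ hW hZ).smul hf).add (hZ.smul hd)).diff ?_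
      filter_upwards [hZ.eventually_diff, eventually_mdifferentiableAt_of_contMDiffAt hf]
        with y h1 h2
      exact conn_smul h2 h1 _
    rw [h2, conn_add ((hD _ _ _ hW hZ).smul hf).diff
      (hZ.smul hd).diff, conn_smul hf' (hD _ _ _ hW hZ).diff,
      conn_smul (hd.mdifferentiableAt (by simp)) hZ.diff]
  simp only [connCurvature]
  rw [h1 hX hY, h1 hY hX, conn_smul hf' hZ.diff, mvfderiv_mlieBracket hX hY hf]
  module

/-- The curvature of a connection depends only on the values of the vector fields at the point. -/
theorem connCurvature_congr (hD : IsSmoothConnection D) {Y' : Π x : M, TangentSpace I x}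
    (hX : SmoothFieldAt I X x) (hX' : SmoothFieldAt I X' x)
    (hY : SmoothFieldAt I Y x) (hY' : SmoothFieldAt I Y' x) (hZ : SmoothFieldAt I Z x)
    (hZ' : SmoothFieldAt I Z' x) (h1 : X x = X' x) (h2 : Y x = Y' x) (h3 : Z x = Z' x) :
    connCurvature D X Y Z x = connCurvature D X' Y' Z' x := by
  have hl : ∀ {X X' Y : Π x : M, TangentSpace I x}, SmoothFieldAt I X x → SmoothFieldAt I X' x →
      X x = X' x → connCurvature D X Y Z x = connCurvature D X' Y Z x := by
    intro X X' Y hX hX' h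
    exact eq_of_tensorial (Φ := fun X => connCurvature D X Y Z x)
      (fun X X' hX hX' => connCurvature_add_left hD hX hX' hZ)
      (fun f X hf hX => connCurvature_smul_left hD hf hX hZ) hX hX' h
  rw [hl hX hX' h1, ← neg_inj, ← connCurvature_swap, hl hY hY' h2, connCurvature_swap,
    neg_inj]
  exact eq_of_tensorial (Φ := fun Z => connCurvature D X' Y' Z x)
      (fun Z Z' hZ hZ' => connCurvature_add_right hD hX' hY' hZ hZ')
      (fun f Z hf hZ => connCurvature_smul_right hD hf hX' hY' hZ) hZ hZ' h3

variable (D) in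
/-- The curvature of a connection as a function of tangent vectors. -/
noncomputable def connCurvatureAt (x : M) (u v w : TangentSpace I x) : TangentSpace I x :=
  connCurvature D (extend E u) (extend E v) (extend E w) x

theorem connCurvatureAt_apply (hD : IsSmoothConnection D) (hX : SmoothFieldAt I X x)
    (hY : SmoothFieldAt I Y x) (hZ : SmoothFieldAt I Z x) :
    connCurvatureAt D x (X x) (Y x) (Z x) = connCurvature D X Y Z x :=
  connCurvature_congr hD (smoothFieldAt_extend _) hX (smoothFieldAt_extend _) hY
    (smoothFieldAt_extend _) hZ (by simp) (by simp) (by simp)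

theorem curvature_apply (hX : SmoothFieldAt I X x)
    (hY : SmoothFieldAt I Y x) (hZ : SmoothFieldAt I Z x) :
    curvature I x (X x) (Y x) (Z x) = curvatureField X Y Z x :=
  connCurvatureAt_apply isSmoothConnection_leviCivita hX hY hZ

theorem connCurvatureAt_swap (u v w : TangentSpace I x) :
    connCurvatureAt D x v u w = - connCurvatureAt D x u v w := connCurvature_swap _ _ _ _

theorem connCurvatureAt_add_left (hD : IsSmoothConnection D) (u u' v w : TangentSpace I x) :
    connCurvatureAt D x (u + u') v w = connCurvatureAt D x u v w + connCurvatureAt D x u' v w := by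
  have h := connCurvature_add_left hD (smoothFieldAt_extend u) (smoothFieldAt_extend u')
    (Y := extend E v) (smoothFieldAt_extend w)
  rw [← connCurvatureAt_apply hD ((smoothFieldAt_extend u).add (smoothFieldAt_extend u'))
    (smoothFieldAt_extend v) (smoothFieldAt_extend w)] at h
  simpa [connCurvatureAt] using h

theorem connCurvatureAt_smul_left (hD : IsSmoothConnection D) (c : ℝ) (u v w : TangentSpace I x) :
    connCurvatureAt D x (c • u) v w = c • connCurvatureAt D x u v w := by
  have h := connCurvature_smul_left hD (contMDiffAt_const (c := c)) (smoothFieldAt_extend u)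
    (Y := extend E v) (smoothFieldAt_extend w)
  rw [← connCurvatureAt_apply hD ((smoothFieldAt_extend u).const_smul c)
    (smoothFieldAt_extend v) (smoothFieldAt_extend w)] at h
  simpa [connCurvatureAt] using h

theorem connCurvatureAt_add_right (hD : IsSmoothConnection D) (u v w w' : TangentSpace I x) :
    connCurvatureAt D x u v (w + w') = connCurvatureAt D x u v w + connCurvatureAt D x u v w' := by
  have h := connCurvature_add_right hD (smoothFieldAt_extend u) (smoothFieldAt_extend v)
    (smoothFieldAt_extend w) (smoothFieldAt_extend w')
  rw [← connCurvatureAt_apply hD (smoothFieldAt_extend u) (smoothFieldAt_extend v)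
    ((smoothFieldAt_extend w).add (smoothFieldAt_extend w'))] at h
  simpa [connCurvatureAt] using h

theorem connCurvatureAt_smul_right (hD : IsSmoothConnection D) (c : ℝ) (u v w : TangentSpace I x) :
    connCurvatureAt D x u v (c • w) = c • connCurvatureAt D x u v w := by
  have h := connCurvature_smul_right hD (contMDiffAt_const (c := c)) (smoothFieldAt_extend u)
    (smoothFieldAt_extend v) (smoothFieldAt_extend w)
  rw [← connCurvatureAt_apply hD (smoothFieldAt_extend u) (smoothFieldAt_extend v)
    ((smoothFieldAt_extend w).const_smul c)] at h
  simpa [connCurvatureAt] using h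

/-- The curvature endomorphism `R(u, v)` of a connection. -/
noncomputable def curvatureEnd (hD : IsSmoothConnection D) (u v : TangentSpace I x) :
    TangentSpace I x →ₗ[ℝ] TangentSpace I x where
  toFun w := connCurvatureAt D x u v w
  map_add' := connCurvatureAt_add_right hD u v
  map_smul' c w := connCurvatureAt_smul_right hD c u v w

variable (I) in
/-- The curvature as a trilinear map. -/
noncomputable def curvatureLin (x : M) : TangentSpace I x →ₗ[ℝ] TangentSpace I x →ₗ[ℝ]
    TangentSpace I x →ₗ[ℝ] TangentSpace I x :=
  LinearMap.mk₂ ℝ (fun u v => curvatureEnd (isSmoothConnection_leviCivita (I := I) (M := M)) u v)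
    (fun u u' v => by ext w; exact connCurvatureAt_add_left isSmoothConnection_leviCivita _ _ _ _)
    (fun c u v => by ext w; exact connCurvatureAt_smul_left isSmoothConnection_leviCivita _ _ _ _)
    (fun u v v' => by
      ext w
      change connCurvatureAt _ x _ _ _ = connCurvatureAt _ x _ _ _ + connCurvatureAt _ x _ _ _
      rw [connCurvatureAt_swap, connCurvatureAt_add_left isSmoothConnection_leviCivita,
        connCurvatureAt_swap u v, connCurvatureAt_swap u v', neg_add, neg_neg, neg_neg])
    (fun c u v => by
      ext w
      change connCurvatureAt _ x _ _ _ = c • connCurvatureAt _ x _ _ _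
      rw [connCurvatureAt_swap, connCurvatureAt_smul_left isSmoothConnection_leviCivita,
        connCurvatureAt_swap u v, smul_neg, neg_neg])

theorem curvature_swap (u v w : TangentSpace I x) :
    curvature I x v u w = - curvature I x u v w := connCurvature_swap _ _ _ _

/-- The first Bianchi identity. -/
theorem curvature_bianchi (u v w : TangentSpace I x) :
    curvature I x u v w + curvature I x v w u + curvature I x w u v = 0 := by
  set U : Π x : M, TangentSpace I x := extend E u with hU'
  set V : Π x : M, TangentSpace I x := extend E v with hV'
  set W : Π x : M, TangentSpace I x := extend E w with hW'
  have hU : SmoothFieldAt I U x := smoothFieldAt_extend u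
  have hV : SmoothFieldAt I V x := smoothFieldAt_extend v
  have hW : SmoothFieldAt I W x := smoothFieldAt_extend w
  change curvatureField U V W x + curvatureField V W U x + curvatureField W U V x = 0
  have : IsManifold I (minSmoothness ℝ 3) M := by
    rw [minSmoothness_of_isRCLikeNormedField]; infer_instance
  have : CompleteSpace E := FiniteDimensional.complete ℝ E
  have h2top : minSmoothness ℝ 2 ≤ ∞ := by
    rw [minSmoothness_of_isRCLikeNormedField]; exact ENat.LEInfty.out
  have jac := leibniz_identity_mlieBracket_apply (ContMDiffAt.of_le hU h2top)
    (ContMDiffAt.of_le hV h2top) (ContMDiffAt.of_le hW h2top)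
  -- Vanishing torsion turns a difference of second derivatives into `∇_X [Y, Z]`, and then into
  -- `∇_{[Y,Z]} X + [X, [Y, Z]]`. The first summand cancels the bracket term of the curvature; the
  -- cyclic sum of the second is the Jacobi identity.
  have key : ∀ {X Y Z : Π x : M, TangentSpace I x}, SmoothFieldAt I X x → SmoothFieldAt I Y x →
      SmoothFieldAt I Z x →
      leviCivita I M (fun q => leviCivita I M Z q (Y q)) x (X x) -
        leviCivita I M (fun q => leviCivita I M Y q (Z q)) x (X x) =
      leviCivita I M X x (mlieBracket I Y Z x) + mlieBracket I X (mlieBracket I Y Z) x := by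
    intro X Y Z hX hY hZ
    have h1 := conn_sub (D := leviCivita I M) (hZ.covDeriv hY).diff (hY.covDeriv hZ).diff (X x)
    rw [← h1, ← leviCivita_sub_swap hX.diff (hY.lieBracket hZ).diff, add_sub_cancel]
    have h2 : leviCivita I M (fun q => leviCivita I M Z q (Y q) -
        leviCivita I M Y q (Z q)) x = leviCivita I M (mlieBracket I Y Z) x := by
      refine conn_congr ((hZ.covDeriv hY).sub (hY.covDeriv hZ)).diff (hY.lieBracket hZ).diff ?_
      filter_upwards [hY.eventually_diff, hZ.eventually_diff] with y h3 h4
      exact leviCivita_sub_swap h3 h4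
    rw [h2]
  have k1 := key hU hV hW
  have k2 := key hV hW hU
  have k3 := key hW hU hV
  have b1 : mlieBracket I V (mlieBracket I W U) x = - mlieBracket I V (mlieBracket I U W) x := by
    rw [mlieBracket_swap (V := W) (W := U), mlieBracket_swap_apply]
    have h : - mlieBracket I U W = (-1 : ℝ) • mlieBracket I U W := by simp
    rw [h, mlieBracket_const_smul_left (hU.lieBracket hW).diff, mlieBracket_swap_apply]
    simp
  have b2 : mlieBracket I W (mlieBracket I U V) x = - mlieBracket I (mlieBracket I U V) W x :=
    mlieBracket_swap_apply
  have e : curvatureField U V W x + curvatureField V W U x + curvatureField W U V x =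
      mlieBracket I U (mlieBracket I V W) x + mlieBracket I V (mlieBracket I W U) x +
        mlieBracket I W (mlieBracket I U V) x := by
    simp only [curvatureField]
    rw [← sub_eq_zero] at k1 k2 k3 ⊢
    -- The right-hand side is split into three zeros so that one copy of each of the three
    -- identities can be substituted.
    rw [← add_zero (0 : TangentSpace I x), ← add_zero (0 + 0 : TangentSpace I x)]
    nth_rw 2 [← k1]
    nth_rw 2 [← k2]
    rw [← k3]
    abel
  rw [e, jac, b1, b2]
  abel

end Curvature

/-! ### Linear algebra: traces, orthogonal complex structures, complex volume forms -/

section LinearAlgebraLemmas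

variable {V : Type*} [NormedAddCommGroup V] [InnerProductSpace ℝ V] [FiniteDimensional ℝ V]

/-- Expanding one argument in the other basis turns both sides into the same double sum `∑ ⟨cₖ, bᵢ⟩
B(cₖ, bᵢ)`. It serves both to replace the standard basis by a smooth frame and to replace `eᵢ` by `J
eᵢ`. -/
theorem sum_bilin_orthonormalBasis {ι κ : Type*} [Fintype ι] [Fintype κ]
    (B : V →ₗ[ℝ] V →ₗ[ℝ] ℝ) (b : OrthonormalBasis ι ℝ V) (c : OrthonormalBasis κ ℝ V) :
    ∑ i, B (b i) (b i) = ∑ k, B (c k) (c k) := by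
  have h1 : ∀ i, B (b i) (b i) = ∑ k, inner ℝ (c k) (b i) * B (c k) (b i) := by
    intro i
    nth_rw 1 [← c.sum_repr' (b i)]
    simp
  have h2 : ∀ k, B (c k) (c k) = ∑ i, inner ℝ (b i) (c k) * B (c k) (b i) := by
    intro k
    nth_rw 2 [← b.sum_repr' (c k)]
    simp
  simp only [h1, h2]
  rw [Finset.sum_comm]
  simp only [real_inner_comm]

/-- The image of an orthonormal basis under an orthogonal complex structure. -/
noncomputable def rotatedBasis {ι : Type*} [Fintype ι] {J : V →L[ℝ] V}
    (hsq : ∀ v, J (J v) = - v) (hin : ∀ v w, inner ℝ (J v) (J w) = (inner ℝ v w : ℝ))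
    (b : OrthonormalBasis ι ℝ V) : OrthonormalBasis ι ℝ V :=
  b.map
    { toFun := J
      map_add' := map_add J
      map_smul' := map_smul J
      invFun := fun v => - J v
      left_inv := fun v => by simp [hsq]
      right_inv := fun v => by simp [hsq]
      norm_map' := fun v => by
        change ‖J v‖ = ‖v‖
        rw [norm_eq_sqrt_real_inner, norm_eq_sqrt_real_inner, hin] }

@[simp]
theorem rotatedBasis_apply {ι : Type*} [Fintype ι] {J : V →L[ℝ] V}
    (hsq : ∀ v, J (J v) = - v) (hin : ∀ v w, inner ℝ (J v) (J w) = (inner ℝ v w : ℝ))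
    (b : OrthonormalBasis ι ℝ V) (i : ι) : rotatedBasis hsq hin b i = J (b i) := by
  simp [rotatedBasis]

theorem inner_J_left {J : V →L[ℝ] V} (hsq : ∀ v, J (J v) = - v)
    (hin : ∀ v w, inner ℝ (J v) (J w) = (inner ℝ v w : ℝ)) (v w : V) :
    inner ℝ (J v) w = - (inner ℝ v (J w) : ℝ) := by
  have h := hin v (J w)
  rw [hsq, inner_neg_right] at h
  linarith

/-- The normalization of `Ψ` enters the argument only through this nonvanishing. -/
theorem formNormSq_ne_zero_exists {n : ℕ} {Ψ : V [⋀^Fin n]→L[ℝ] ℂ} (h : formNormSq Ψ ≠ 0) :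
    ∃ Y : Fin n → V, Ψ Y ≠ 0 := by
  by_contra! hc
  exact h (by simp [formNormSq, hc])

section ComplexVolume

variable {n : ℕ} {J : V →L[ℝ] V} {Ψ : V [⋀^Fin n]→L[ℝ] ℂ}

theorem apply_update_J
    (hΨ : ∀ (v : Fin n → V) (i : Fin n), Ψ (Function.update v i (J (v i))) = Complex.I * Ψ v)
    (Y : Fin n → V) (k : Fin n) (w : V) :
    Ψ (Function.update Y k (J w)) = Complex.I * Ψ (Function.update Y k w) := by
  simpa using hΨ (Function.update Y k w) k

theorem apply_update_eq_ite
    (Y : Fin n → V) (k l : Fin n) :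
    Ψ (Function.update Y k (Y l)) = if l = k then Ψ Y else 0 := by
  split_ifs with h
  · subst h; simp
  · exact Ψ.map_update_self Y (Ne.symm h)

/-- The vectors `Yₖ, J Yₖ` form a basis if `Ψ(Y) ≠ 0`. -/
theorem linearIndependent_sumElim
    (hΨ : ∀ (v : Fin n → V) (i : Fin n), Ψ (Function.update v i (J (v i))) = Complex.I * Ψ v)
    {Y : Fin n → V} (hY : Ψ Y ≠ 0) :
    LinearIndependent ℝ (Sum.elim Y (fun k => J (Y k))) := by
  rw [Fintype.linearIndependent_iff]
  intro g hg
  have key : ∀ k, (g (Sum.inl k) : ℂ) + g (Sum.inr k) * Complex.I = 0 := by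
    intro k
    -- Inserting the linear relation into slot `k` of `Ψ` kills every vector except `Yₖ` and `J Yₖ`,
    -- by alternation, and leaves a complex multiple of `Ψ(Y)`.
    have h1 := congrArg (Ψ.toMultilinearMap.toLinearMap Y k) hg
    rw [Fintype.sum_sum_type] at h1
    simp only [Sum.elim_inl, Sum.elim_inr, map_add, map_sum, map_smul, map_zero] at h1
    have h2 : ∀ w, Ψ.toMultilinearMap.toLinearMap Y k w = Ψ (Function.update Y k w) := fun _ => rfl
    simp only [h2, apply_update_J hΨ, apply_update_eq_ite] at h1
    simp only [Complex.real_smul, mul_ite, mul_zero, Finset.sum_ite_eq', Finset.mem_univ,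
      if_true] at h1
    have h3 : ((g (Sum.inl k) : ℂ) + g (Sum.inr k) * Complex.I) * Ψ Y = 0 := by
      linear_combination h1
    exact (mul_eq_zero.1 h3).resolve_right hY
  intro i
  rcases i with k | k
  · simpa using congrArg Complex.re (key k)
  · simpa using congrArg Complex.im (key k)

/-- A complex linear endomorphism which annihilates the complex volume form as a derivation has
`tr (J B) = 0`. -/
theorem trace_J_comp_eq_zero (hdim : Module.finrank ℝ V = 2 * n)
    (hΨ : ∀ (v : Fin n → V) (i : Fin n), Ψ (Function.update v i (J (v i))) = Complex.I * Ψ v)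
    (hsq : ∀ v, J (J v) = - v)
    {Y : Fin n → V} (hY : Ψ Y ≠ 0) {B : V →ₗ[ℝ] V} (hB : ∀ v, B (J v) = J (B v))
    (h0 : ∑ k, Ψ (Function.update Y k (B (Y k))) = 0) :
    LinearMap.trace ℝ V (J.toLinearMap ∘ₗ B) = 0 := by
  let b : Module.Basis (Fin n ⊕ Fin n) ℝ V :=
    basisOfLinearIndependentOfCardEqFinrank' _ (linearIndependent_sumElim hΨ hY)
      (by simp [hdim, two_mul])
  have hbl : ∀ k, b (Sum.inl k) = Y k := fun k => by simp [b]
  have hbr : ∀ k, b (Sum.inr k) = J (Y k) := fun k => by simp [b]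
  -- Slot `k` of `Ψ` reads off the `k`-th complex coordinate in the complex basis `Y`, up to the
  -- factor `Ψ(Y)`.
  have hrepr : ∀ k v, Ψ (Function.update Y k v) =
      ((b.repr v (Sum.inl k) : ℂ) + b.repr v (Sum.inr k) * Complex.I) * Ψ Y := by
    intro k v
    have h2 : ∀ w, Ψ.toMultilinearMap.toLinearMap Y k w = Ψ (Function.update Y k w) := fun _ => rfl
    nth_rw 1 [← b.sum_repr v]
    rw [← h2, Fintype.sum_sum_type]
    simp only [map_add, map_sum, map_smul, hbl, hbr]
    simp only [h2, apply_update_J hΨ, apply_update_eq_ite]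
    simp only [Complex.real_smul, mul_ite, mul_zero, Finset.sum_ite_eq', Finset.mem_univ,
      if_true]
    ring
  have hJ : ∀ k v, b.repr (J v) (Sum.inl k) = - b.repr v (Sum.inr k) ∧
      b.repr (J v) (Sum.inr k) = b.repr v (Sum.inl k) := by
    intro k v
    have h1 := apply_update_J hΨ Y k v
    rw [hrepr, hrepr, ← mul_assoc] at h1
    have h2 := mul_right_cancel₀ hY h1
    have h3 := congrArg Complex.re h2
    have h4 := congrArg Complex.im h2
    simp at h3 h4
    exact ⟨h3, h4⟩
  -- The hypothesis says that the complex trace of `B` is zero. Only its imaginary part is needed,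
  -- since the real trace of `J B` is `-2` times it.
  have h1 : ∑ k, b.repr (B (Y k)) (Sum.inr k) = 0 := by
    simp only [hrepr] at h0
    rw [← Finset.sum_mul] at h0
    have h2 := congrArg Complex.im ((mul_eq_zero.1 h0).resolve_right hY)
    simpa using h2
  rw [LinearMap.trace_eq_matrix_trace ℝ b, Matrix.trace, Fintype.sum_sum_type]
  simp only [Matrix.diag_apply, LinearMap.toMatrix_apply, hbl, hbr, LinearMap.comp_apply,
    ContinuousLinearMap.coe_coe, hB, hsq, map_neg, Finsupp.neg_apply, (hJ _ _).1]
  rw [Finset.sum_neg_distrib, h1]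
  simp

end ComplexVolume

end LinearAlgebraLemmas

/-! ### Nearly Kähler identities -/

section AlmostHermitian

variable {E : Type*} [NormedAddCommGroup E] [NormedSpace ℝ E] [FiniteDimensional ℝ E]
  {H : Type*} [TopologicalSpace H] {I : ModelWithCorners ℝ E H}
  {M : Type*} [TopologicalSpace M] [ChartedSpace H M] [IsManifold I ∞ M]
  [RiemannianBundle (fun x : M => TangentSpace I x)]
  [IsContMDiffRiemannianBundle I ∞ E (fun x : M => TangentSpace I x)]

/-- `J` is a smooth orthogonal almost complex structure. -/
structure IsAlmostHermitian (J : Π x : M, TangentSpace I x →L[ℝ] TangentSpace I x) : Prop where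
  smooth : ∀ {x : M} {X : Π x : M, TangentSpace I x}, SmoothFieldAt I X x →
    SmoothFieldAt I (fun y => J y (X y)) x
  sq : ∀ x v, J x (J x v) = - v
  inner : ∀ x v w, inner ℝ (J x v) (J x w) = (inner ℝ v w : ℝ)

/-- `a` is a section of `W₁` with `∇_X J = 2 J a_X`. -/
structure IsNearlyKahler (J : Π x : M, TangentSpace I x →L[ℝ] TangentSpace I x)
    (a : Π x : M, TangentSpace I x →L[ℝ] TangentSpace I x →L[ℝ] TangentSpace I x) : Prop
    extends IsAlmostHermitian J where
  anti : ∀ x v w, a x v (J x w) = - J x (a x v w)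
  skew : ∀ x v w z, Inner.inner ℝ (a x v w) z = - (Inner.inner ℝ w (a x v z) : ℝ)
  alt : ∀ x v w, a x v w = - a x w v
  nabla : ∀ {x : M} {Y : Π x : M, TangentSpace I x}, SmoothFieldAt I Y x →
    ∀ᶠ y in nhds x, ∀ v, leviCivita I M (fun q => J q (Y q)) y v =
      J y (leviCivita I M Y y v) + (2 : ℝ) • J y (a y v (Y y))

variable {J : Π x : M, TangentSpace I x →L[ℝ] TangentSpace I x}
  {a : Π x : M, TangentSpace I x →L[ℝ] TangentSpace I x →L[ℝ] TangentSpace I x}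
  {x : M} {X Y Z W : Π x : M, TangentSpace I x}

theorem IsAlmostHermitian.inner_left (h : IsAlmostHermitian J) (v w : TangentSpace I x) :
    Inner.inner ℝ (J x v) w = - (Inner.inner ℝ v (J x w) : ℝ) :=
  inner_J_left (h.sq x) (h.inner x) v w

theorem IsAlmostHermitian.inner_self (h : IsAlmostHermitian J) (v : TangentSpace I x) :
    Inner.inner ℝ v (J x v) = (0 : ℝ) := by
  have h1 := h.inner_left v v
  rw [real_inner_comm] at h1
  linarith

theorem inner_covDeriv (hX : SmoothFieldAt I X x) (hY : SmoothFieldAt I Y x)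
    (hZ : SmoothFieldAt I Z x) :
    inner ℝ (leviCivita I M Y x (X x)) (Z x) = mvfderiv I (fun q => (inner ℝ (Y q) (Z q) : ℝ)) x (X x)
      - inner ℝ (Y x) (leviCivita I M Z x (X x)) := by
  rw [leviCivita_inner hX.diff hY.diff hZ.diff]
  ring

theorem mvfderiv_eq_zero_of_eventually_const {f : M → ℝ} {c : ℝ} (h : ∀ᶠ y in nhds x, f y = c) :
    mvfderiv I f x = 0 := by
  rw [mvfderiv_congr h]
  exact mvfderiv_const c

namespace IsNearlyKahler

variable (h : IsNearlyKahler J a)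
include h

theorem self (v : TangentSpace I x) : a x v v = 0 := by
  have h1 := h.alt x v v
  rwa [eq_neg_iff_add_eq_zero, ← two_smul ℝ, smul_eq_zero_iff_right (by norm_num)] at h1

theorem J_left (v w : TangentSpace I x) : a x (J x v) w = - J x (a x v w) := by
  rw [h.alt, h.anti, h.alt x w v, map_neg, neg_neg]

theorem inner_a_self (v w : TangentSpace I x) : inner ℝ (a x v w) w = (0 : ℝ) := by
  have h1 := h.skew x v w w
  rw [real_inner_comm (a x v w) w] at h1
  linarith

theorem inner_a_J_self (v w : TangentSpace I x) : inner ℝ (a x v w) (J x w) = (0 : ℝ) := by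
  have h1 := h.skew x v w (J x w)
  rw [h.anti, inner_neg_right, ← neg_eq_iff_eq_neg.2 (h.inner_left w _), real_inner_comm (a x v w)] at h1
  linarith

/-- The tensor is determined by `J`: `a_X Y = -½ J(∇_X(JY) - J ∇_X Y)`. Hence it is smooth although
only its pointwise algebra is prescribed. -/
theorem smoothField (hX : SmoothFieldAt I X x) (hY : SmoothFieldAt I Y x) :
    SmoothFieldAt I (fun y => a y (X y) (Y y)) x := by
  have h1 : SmoothFieldAt I (fun y => (-(2 : ℝ)⁻¹) • J y (leviCivita I M (fun q => J q (Y q)) y (X y) -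
      J y (leviCivita I M Y y (X y)))) x :=
    SmoothFieldAt.const_smul _ (h.smooth (((h.smooth hY).covDeriv hX).sub
      (h.smooth (hY.covDeriv hX))))
  refine h1.congr ?_
  filter_upwards [h.nabla hY] with y hy
  rw [hy, add_sub_cancel_left, map_smul, h.sq, smul_neg, smul_neg, neg_smul, neg_neg, smul_smul]
  norm_num

/-- `⟨R(X, Y) J X, J Y⟩ - ⟨R(X, Y) X, Y⟩ = |(∇_X J) Y|²`. -/
theorem inner_curvature_sub (hX : SmoothFieldAt I X x) (hY : SmoothFieldAt I Y x) :
    inner ℝ (curvatureField X Y (fun y => J y (X y)) x) (J x (Y x)) -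
      inner ℝ (curvatureField X Y X x) (Y x) = 4 * (inner ℝ (a x (X x) (Y x)) (a x (X x) (Y x)) : ℝ) := by
  have hJY := h.smooth hY
  -- This is `(∇_Y J) X`, the only place where `a` itself gets differentiated: in the other order of
  -- differentiation the corresponding field is `(∇_X J) X = 0`.
  have hG : SmoothFieldAt I (fun q => (2 : ℝ) • J q (a q (Y q) (X q))) x :=
    (h.smooth (h.smoothField hY hX)).const_smul 2
  have t1 : leviCivita I M (fun q => leviCivita I M (fun q => J q (X q)) q (Y q)) x (X x) =
      J x (leviCivita I M (fun q => leviCivita I M X q (Y q)) x (X x)) +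
        (2 : ℝ) • J x (a x (X x) (leviCivita I M X x (Y x))) +
        leviCivita I M (fun q => (2 : ℝ) • J q (a q (Y q) (X q))) x (X x) := by
    rw [← (h.nabla (hX.covDeriv hY)).self_of_nhds,
      ← conn_add (h.smooth (hX.covDeriv hY)).diff hG.diff]
    rw [conn_congr ((h.smooth hX).covDeriv hY).diff ((h.smooth (hX.covDeriv hY)).add hG).diff]
    filter_upwards [h.nabla hX] with y hy
    exact hy _
  have t2 : leviCivita I M (fun q => leviCivita I M (fun q => J q (X q)) q (X q)) x (Y x) =
      J x (leviCivita I M (fun q => leviCivita I M X q (X q)) x (Y x)) +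
        (2 : ℝ) • J x (a x (Y x) (leviCivita I M X x (X x))) := by
    rw [← (h.nabla (hX.covDeriv hX)).self_of_nhds]
    rw [conn_congr ((h.smooth hX).covDeriv hX).diff (h.smooth (hX.covDeriv hX)).diff]
    filter_upwards [h.nabla hX] with y hy
    rw [hy, h.self]
    simp
  have t3 := (h.nabla hX).self_of_nhds (mlieBracket I X Y x)
  have t4 := inner_covDeriv hX hG hJY
  -- Since `⟨a_Y X, Y⟩` vanishes identically, the derivative can be moved from `(∇_Y J) X` onto `J
  -- Y`, which avoids any knowledge of `∇ a` and produces the square of `a_X Y`.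
  have t5 : mvfderiv I (fun q => (inner ℝ ((2 : ℝ) • J q (a q (Y q) (X q))) (J q (Y q)) : ℝ)) x = 0 := by
    refine mvfderiv_eq_zero_of_eventually_const (c := 0) (Filter.Eventually.of_forall fun q => ?_)
    rw [inner_smul_left, h.inner, h.alt, inner_neg_left, h.inner_a_self]
    simp
  rw [t5, (h.nabla hY).self_of_nhds] at t4
  simp only [curvatureField, t1, t2, t3]
  simp only [inner_sub_left, inner_add_left, t4, ← leviCivita_sub_swap hX.diff hY.diff, map_sub]
  simp only [sub_apply, inner_add_right, inner_smul_left, inner_smul_right, h.inner,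
    smul_sub, map_sub, inner_sub_left]
  -- The remaining first derivatives of `X` and `Y` are arbitrary vectors; they drop out by the skew
  -- symmetries of `a` alone.
  generalize leviCivita I M X x (Y x) = A
  generalize leviCivita I M Y x (X x) = B
  generalize leviCivita I M X x (X x) = C
  have f1 : inner ℝ (a x (X x) A) (Y x) = - (inner ℝ (a x A (X x)) (Y x) : ℝ) := by
    rw [h.alt x (X x) A, inner_neg_left]
  have f2 : inner ℝ (a x (Y x) C) (Y x) = (0 : ℝ) := by
    rw [h.skew, h.self, inner_zero_right, neg_zero]
  have f3 : inner ℝ (a x B (X x)) (Y x) = - (inner ℝ (a x (Y x) (X x)) B : ℝ) := by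
    rw [h.skew, h.alt x B (Y x), inner_neg_right, neg_neg, h.skew, neg_neg]
  have f4 : inner ℝ (a x (Y x) (X x)) (a x (X x) (Y x)) =
      - (inner ℝ (a x (X x) (Y x)) (a x (X x) (Y x)) : ℝ) := by
    rw [h.alt x (Y x) (X x), inner_neg_left]
  simp only [f1, f2, f3, f4, RCLike.conj_to_real, zero_apply]
  ring

end IsNearlyKahler

end AlmostHermitian

/-! ### Comparison of the curvatures of `D` and `∇` -/

section Comparison

variable {E : Type*} [NormedAddCommGroup E] [NormedSpace ℝ E] [FiniteDimensional ℝ E]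
  {H : Type*} [TopologicalSpace H] {I : ModelWithCorners ℝ E H}
  {M : Type*} [TopologicalSpace M] [ChartedSpace H M] [IsManifold I ∞ M]
  [RiemannianBundle (fun x : M => TangentSpace I x)]
  [IsContMDiffRiemannianBundle I ∞ E (fun x : M => TangentSpace I x)]

/-- The connection `D` has the form `D_X Y = ∇_X Y + a_X Y + ⟨ζ, J X⟩ J Y`. -/
structure IsW1W5Connection (J : Π x : M, TangentSpace I x →L[ℝ] TangentSpace I x)
    (a : Π x : M, TangentSpace I x →L[ℝ] TangentSpace I x →L[ℝ] TangentSpace I x)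
    (ζ : Π x : M, TangentSpace I x)
    (D : CovariantDerivative I E (fun x : M => TangentSpace I x)) : Prop
    extends IsNearlyKahler J a where
  smooth_vec : ∀ x, SmoothFieldAt I ζ x
  conn : ∀ {x : M} {Y : Π x : M, TangentSpace I x}, DiffFieldAt I Y x → ∀ v,
    D Y x v = leviCivita I M Y x v + a x v (Y x) +
      (Inner.inner ℝ (ζ x) (J x v) : ℝ) • J x (Y x)

variable {J : Π x : M, TangentSpace I x →L[ℝ] TangentSpace I x}
  {a : Π x : M, TangentSpace I x →L[ℝ] TangentSpace I x →L[ℝ] TangentSpace I x}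
  {ζ : Π x : M, TangentSpace I x}
  {D : CovariantDerivative I E (fun x : M => TangentSpace I x)}
  {x : M} {X Y Z W : Π x : M, TangentSpace I x}

namespace IsW1W5Connection

variable (h : IsW1W5Connection J a ζ D)
include h

theorem contMDiffAt_theta (hX : SmoothFieldAt I X x) :
    CMDiffAt ∞ (fun y => (Inner.inner ℝ (ζ y) (J y (X y)) : ℝ)) x :=
  (h.smooth_vec x).contMDiffAt_inner (h.smooth hX)

theorem isSmoothConnection : IsSmoothConnection D := by
  intro x X Y hX hY
  refine (((hY.covDeriv hX).add (h.smoothField hX hY)).add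
    ((h.smooth hY).smul (h.contMDiffAt_theta hX))).congr ?_
  filter_upwards [hY.eventually_diff] with y hy
  exact h.conn hy _

/-- The `W₅` term commutes with `J`, and the term `2 J a` in `∇ J` compensates the anticommutation
of `a` with `J`. -/
theorem conn_J (hY : SmoothFieldAt I Y x) (v : TangentSpace I x) :
    D (fun y => J y (Y y)) x v = J x (D Y x v) := by
  rw [h.conn (h.smooth hY).diff, h.conn hY.diff, (h.nabla hY).self_of_nhds, h.anti]
  simp only [map_add, map_smul]
  rw [two_smul]
  abel

theorem connCurvature_J (hX : SmoothFieldAt I X x) (hZ : SmoothFieldAt I Z x)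
    (hW : SmoothFieldAt I W x) :
    connCurvature D X Z (fun y => J y (W y)) x = J x (connCurvature D X Z W x) := by
  have hD := h.isSmoothConnection
  have key : ∀ {X Z : Π x : M, TangentSpace I x}, SmoothFieldAt I X x → SmoothFieldAt I Z x →
      D (fun q => D (fun y => J y (W y)) q (Z q)) x (X x) =
        J x (D (fun q => D W q (Z q)) x (X x)) := by
    intro X Z hX hZ
    rw [← h.conn_J (hD _ _ _ hZ hW)]
    rw [conn_congr (hD _ _ _ hZ (h.smooth hW)).diff (h.smooth (hD _ _ _ hZ hW)).diff]
    filter_upwards [hW.eventually_diff, (h.smooth hW).eventually_diff, h.nabla hW] with y h1 h2 h3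
    rw [h.conn h2, h.conn h1, h3, h.anti]
    simp only [map_add, map_smul]
    rw [two_smul]
    abel
  simp only [connCurvature, key hX hZ, key hZ hX, h.conn_J hW, map_sub]

/-- Two ingredients keep the expansion short. Because `W` is a unit field, `⟨∇W, W⟩ = 0` and the
products of `θ` with first derivatives disappear; because `⟨a_Z W, J W⟩` vanishes identically, no
derivative of `a` survives. The two terms mixing `a` and `∇W` are together symmetric in `X` and `Z`,
hence invisible to the curvature. -/
theorem inner_conn_conn (hX : SmoothFieldAt I X x) (hZ : SmoothFieldAt I Z x)
    (hW : SmoothFieldAt I W x) (hW1 : ∀ᶠ y in nhds x, (Inner.inner ℝ (W y) (W y) : ℝ) = 1) :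
    (Inner.inner ℝ (D (fun q => D W q (Z q)) x (X x)) (J x (W x)) : ℝ) =
      Inner.inner ℝ (leviCivita I M (fun q => leviCivita I M W q (Z q)) x (X x)) (J x (W x)) +
      mvfderiv I (fun y => (Inner.inner ℝ (ζ y) (J y (Z y)) : ℝ)) x (X x) -
      Inner.inner ℝ (a x (Z x) (W x)) (J x (leviCivita I M W x (X x))) -
      Inner.inner ℝ (a x (X x) (W x)) (J x (leviCivita I M W x (Z x))) -
      Inner.inner ℝ (a x (Z x) (W x)) (J x (a x (X x) (W x))) := by
  have hD := h.isSmoothConnection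
  have hJW := h.smooth hW
  have s1 := hW.covDeriv hZ
  have s2 := h.smoothField hZ hW
  have s3 := hJW.smul (h.contMDiffAt_theta hZ)
  have e1 : D (fun q => D W q (Z q)) x = D (fun q => leviCivita I M W q (Z q) + a q (Z q) (W q) +
      (Inner.inner ℝ (ζ q) (J q (Z q)) : ℝ) • J q (W q)) x := by
    refine conn_congr (hD _ _ _ hZ hW).diff ((s1.add s2).add s3).diff ?_
    filter_upwards [hW.eventually_diff] with y h1
    exact h.conn h1 _
  have e2 := inner_covDeriv hX s2 hJW
  have e3 : mvfderiv I (fun q => (Inner.inner ℝ (a q (Z q) (W q)) (J q (W q)) : ℝ)) x = 0 :=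
    mvfderiv_eq_zero_of_eventually_const (c := 0) (Filter.Eventually.of_forall fun q =>
      h.inner_a_J_self _ _)
  have e4 : ∀ {U : Π x : M, TangentSpace I x}, SmoothFieldAt I U x →
      Inner.inner ℝ (leviCivita I M W x (U x)) (W x) = (0 : ℝ) := by
    intro U hU
    have h1 := inner_covDeriv hU hW hW
    rw [mvfderiv_eq_zero_of_eventually_const hW1, real_inner_comm] at h1
    rw [zero_apply] at h1
    rw [real_inner_comm]
    linarith
  rw [e3, (h.nabla hW).self_of_nhds, zero_apply, zero_sub] at e2
  rw [e1, h.conn ((s1.add s2).add s3).diff, conn_add (s1.add s2).diff s3.diff,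
    conn_add s1.diff s2.diff,
    conn_smul ((h.contMDiffAt_theta hZ).mdifferentiableAt (by simp)) hJW.diff,
    (h.nabla hW).self_of_nhds]
  simp only [inner_add_left, e2, inner_smul_left, map_add, map_smul, inner_add_right,
    inner_smul_right, h.inner, h.sq, inner_neg_left, RCLike.conj_to_real, e4 hX, e4 hZ,
    h.inner_a_self, h.anti, smul_add, hW1.self_of_nhds, neg_add, smul_neg]
  have f1 : Inner.inner ℝ (a x (X x) (leviCivita I M W x (Z x))) (J x (W x)) =
      - (Inner.inner ℝ (a x (X x) (W x)) (J x (leviCivita I M W x (Z x))) : ℝ) := by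
    rw [h.skew, h.anti, inner_neg_right, neg_neg, ← neg_inj, ← h.inner_left, neg_neg,
      real_inner_comm]
  have f2 : Inner.inner ℝ (a x (X x) (a x (Z x) (W x))) (J x (W x)) =
      (Inner.inner ℝ (a x (Z x) (W x)) (J x (a x (X x) (W x))) : ℝ) := by
    rw [h.skew, h.anti, inner_neg_right, neg_neg]
  rw [f1, f2, h.inner_self]
  ring

/-- Comparison of the curvatures of `D` and of the Levi-Civita connection, evaluated on a unit
vector field `W` and `J W`. -/
theorem inner_connCurvature (hX : SmoothFieldAt I X x) (hZ : SmoothFieldAt I Z x)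
    (hW : SmoothFieldAt I W x) (hW1 : ∀ᶠ y in nhds x, (Inner.inner ℝ (W y) (W y) : ℝ) = 1) :
    (Inner.inner ℝ (connCurvature D X Z W x) (J x (W x)) : ℝ) =
      Inner.inner ℝ (curvatureField X Z W x) (J x (W x)) +
      (mvfderiv I (fun y => (Inner.inner ℝ (ζ y) (J y (Z y)) : ℝ)) x (X x) -
        mvfderiv I (fun y => (Inner.inner ℝ (ζ y) (J y (X y)) : ℝ)) x (Z x) -
        Inner.inner ℝ (ζ x) (J x (mlieBracket I X Z x))) -
      2 * Inner.inner ℝ (a x (Z x) (W x)) (J x (a x (X x) (W x))) := by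
  -- The quadratic term is skew in `X` and `Z` because `J` is skew, so it doubles under
  -- antisymmetrization.
  have f1 : Inner.inner ℝ (a x (X x) (W x)) (J x (a x (Z x) (W x))) =
      - (Inner.inner ℝ (a x (Z x) (W x)) (J x (a x (X x) (W x))) : ℝ) := by
    rw [← h.inner_left, real_inner_comm]
  simp only [connCurvature, curvatureField, inner_sub_left, h.inner_conn_conn hX hZ hW hW1,
    h.inner_conn_conn hZ hX hW hW1, h.conn hW.diff, inner_add_left, inner_smul_left,
    h.inner_a_J_self, h.inner, hW1.self_of_nhds, RCLike.conj_to_real, f1]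
  ring

/-- `dθ(X, J X) = - ⟨∇_X ζ, X⟩ - ⟨∇_{JX} ζ, J X⟩` for `θ = ⟨ζ, J ·⟩`. -/
theorem dtheta_apply_J (hX : SmoothFieldAt I X x) :
    mvfderiv I (fun y => (Inner.inner ℝ (ζ y) (J y (J y (X y))) : ℝ)) x (X x) -
        mvfderiv I (fun y => (Inner.inner ℝ (ζ y) (J y (X y)) : ℝ)) x (J x (X x)) -
        Inner.inner ℝ (ζ x) (J x (mlieBracket I X (fun y => J y (X y)) x)) =
      - Inner.inner ℝ (leviCivita I M ζ x (X x)) (X x) -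
        (Inner.inner ℝ (leviCivita I M ζ x (J x (X x))) (J x (X x)) : ℝ) := by
  have hJX := h.smooth hX
  have e1 := leviCivita_inner hX.diff (h.smooth_vec x).diff hX.diff
  have e2 := leviCivita_inner hJX.diff (h.smooth_vec x).diff hJX.diff
  have e3 : mvfderiv I (fun y => (Inner.inner ℝ (ζ y) (J y (J y (X y))) : ℝ)) x (X x) =
      - mvfderiv I (fun y => (Inner.inner ℝ (ζ y) (X y) : ℝ)) x (X x) := by
    simp only [h.sq, inner_neg_right]
    have := mvfderiv_neg (I := I) (g := fun y => (Inner.inner ℝ (ζ y) (X y) : ℝ)) (x := x)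
    exact congrArg (fun L => L (X x)) this
  rw [e3, e1, e2, ← leviCivita_sub_swap hX.diff hJX.diff]
  -- Here `[X, JX] = ∇_X(JX) - ∇_{JX} X`, and `J` passes through the derivatives because both `a_X
  -- X` and `a_{JX} X` vanish. The bracket therefore cancels exactly the terms containing `∇X`.
  have e4 := (h.nabla hX).self_of_nhds
  simp only [e4, h.self, h.J_left, map_sub, map_add, h.sq, map_zero,
    inner_sub_right, inner_neg_right, inner_add_right, smul_zero, inner_zero_right, neg_zero]
  ring

end IsW1W5Connection

end Comparison

/-! ### The pointwise identity between `s`, `s*` and the divergence -/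

section ScalarCurvature

variable {E : Type*} [NormedAddCommGroup E] [NormedSpace ℝ E] [FiniteDimensional ℝ E]
  {H : Type*} [TopologicalSpace H] {I : ModelWithCorners ℝ E H}
  {M : Type*} [TopologicalSpace M] [ChartedSpace H M] [IsManifold I ∞ M]
  [RiemannianBundle (fun x : M => TangentSpace I x)]
  [IsContMDiffRiemannianBundle I ∞ E (fun x : M => TangentSpace I x)]

/-- The divergence of a vector field. -/
noncomputable def divergence (ζ : Π x : M, TangentSpace I x) (x : M) : ℝ :=
  LinearMap.trace ℝ (TangentSpace I x) (leviCivita I M ζ x).toLinearMap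

theorem divergence_eq_sum {ι : Type*} [Fintype ι] (ζ : Π x : M, TangentSpace I x) {x : M}
    (b : OrthonormalBasis ι ℝ (TangentSpace I x)) :
    divergence ζ x = ∑ i, inner ℝ (leviCivita I M ζ x (b i)) (b i) := by
  rw [divergence, LinearMap.trace_eq_sum_inner _ b]
  exact Finset.sum_congr rfl fun i _ => real_inner_comm _ _

/-- The bilinear form `(v, w) ↦ ⟨R(u, v) (A w), z⟩`. -/
noncomputable def curvatureForm (x : M) (A : TangentSpace I x →L[ℝ] TangentSpace I x)
    (u z : TangentSpace I x) : TangentSpace I x →ₗ[ℝ] TangentSpace I x →ₗ[ℝ] ℝ :=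
  LinearMap.mk₂ ℝ (fun v w => inner ℝ (curvatureLin I x u v (A w)) z)
    (fun v v' w => by simp only [map_add, LinearMap.add_apply, inner_add_left])
    (fun c v w => by simp only [map_smul, LinearMap.smul_apply, inner_smul_left]; rfl)
    (fun v w w' => by simp only [map_add, inner_add_left])
    (fun c v w => by simp only [map_smul, inner_smul_left]; rfl)

/-- The bilinear form `(u, v) ↦ ∑ⱼ ⟨R(u, eⱼ) (A eⱼ), A v⟩`. -/
noncomputable def ricciForm {ι : Type*} [Fintype ι] {x : M}
    (A : TangentSpace I x →L[ℝ] TangentSpace I x)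
    (b : OrthonormalBasis ι ℝ (TangentSpace I x)) :
    TangentSpace I x →ₗ[ℝ] TangentSpace I x →ₗ[ℝ] ℝ :=
  LinearMap.mk₂ ℝ (fun u v => ∑ j, inner ℝ (curvatureLin I x u (b j) (A (b j))) (A v))
    (fun v v' w => by
      simp only [map_add, LinearMap.add_apply, inner_add_left, Finset.sum_add_distrib])
    (fun c v w => by
      simp only [map_smul, LinearMap.smul_apply, inner_smul_left, Finset.smul_sum]; rfl)
    (fun v w w' => by simp only [map_add, inner_add_right, Finset.sum_add_distrib])
    (fun c v w => by simp only [map_smul, inner_smul_right, Finset.smul_sum]; rfl)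

/-- Treats both scalar curvatures at once: `A = id` gives `s` and `A = J` gives `s*`. The bases are
exchanged one summation index at a time. -/
theorem sum_sum_curvature {ι κ : Type*} [Fintype ι] [Fintype κ] {x : M}
    (A : TangentSpace I x →L[ℝ] TangentSpace I x)
    (b : OrthonormalBasis ι ℝ (TangentSpace I x)) (c : OrthonormalBasis κ ℝ (TangentSpace I x)) :
    ∑ i, ∑ j, (inner ℝ (curvature I x (b i) (b j) (A (b j))) (A (b i)) : ℝ) =
      ∑ i, ∑ j, inner ℝ (curvature I x (c i) (c j) (A (c j))) (A (c i)) := by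
  refine (sum_bilin_orthonormalBasis (ricciForm A b) b c).trans ?_
  refine Finset.sum_congr rfl fun i _ => ?_
  exact sum_bilin_orthonormalBasis (curvatureForm x A (c i) (A (c i))) b c

theorem scalarCurvature_eq_sum {ι : Type*} [Fintype ι] {x : M}
    (b : OrthonormalBasis ι ℝ (TangentSpace I x)) :
    scalarCurvature I x = ∑ i, ∑ j, inner ℝ (curvature I x (b i) (b j) (b j)) (b i) :=
  sum_sum_curvature (ContinuousLinearMap.id ℝ _) (stdOrthonormalBasis ℝ (TangentSpace I x)) b

theorem starScalarCurvature_eq_sum {ι : Type*} [Fintype ι]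
    (J : Π x : M, TangentSpace I x →L[ℝ] TangentSpace I x) {x : M}
    (b : OrthonormalBasis ι ℝ (TangentSpace I x)) :
    starScalarCurvature J x =
      ∑ i, ∑ j, inner ℝ (curvature I x (b i) (b j) (J x (b j))) (J x (b i)) :=
  sum_sum_curvature (J x) (stdOrthonormalBasis ℝ (TangentSpace I x)) b

variable {J : Π x : M, TangentSpace I x →L[ℝ] TangentSpace I x}
  {a : Π x : M, TangentSpace I x →L[ℝ] TangentSpace I x →L[ℝ] TangentSpace I x}
  {ζ : Π x : M, TangentSpace I x}
  {D : CovariantDerivative I E (fun x : M => TangentSpace I x)}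
  {x : M}

/-- By Bianchi, each term is `⟨R(eⱼ, Jeᵢ)eᵢ, Jeⱼ⟩ - ⟨R(eⱼ, eᵢ)Jeᵢ, Jeⱼ⟩`. The rotated basis `J eᵢ`
turns the sum of the first kind into minus the sum defining `s*`, so each kind contributes `-s*`. -/
theorem IsAlmostHermitian.sum_curvature_J (h : IsAlmostHermitian J) {ι : Type*} [Fintype ι]
    (b : OrthonormalBasis ι ℝ (TangentSpace I x)) :
    ∑ i, ∑ j, (Inner.inner ℝ (curvature I x (b i) (J x (b i)) (b j)) (J x (b j)) : ℝ) =
      -2 * starScalarCurvature J x := by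
  have h1 : ∀ i j, (Inner.inner ℝ (curvature I x (b i) (J x (b i)) (b j)) (J x (b j)) : ℝ) =
      Inner.inner ℝ (curvature I x (b j) (J x (b i)) (b i)) (J x (b j)) -
      Inner.inner ℝ (curvature I x (b j) (b i) (J x (b i))) (J x (b j)) := by
    intro i j
    have h2 := curvature_bianchi (I := I) (b i) (J x (b i)) (b j)
    rw [curvature_swap (b j) (J x (b i))] at h2
    rw [← inner_sub_left]
    congr 1
    rw [← sub_eq_zero, ← h2]
    abel
  have h3 : ∀ j, ∑ i, (Inner.inner ℝ (curvature I x (b j) (J x (b i)) (b i)) (J x (b j)) : ℝ) =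
      - ∑ i, Inner.inner ℝ (curvature I x (b j) (b i) (J x (b i))) (J x (b j)) := by
    intro j
    have h4 := sum_bilin_orthonormalBasis (curvatureForm x (J x) (b j) (J x (b j))) b
      (rotatedBasis (h.sq x) (h.inner x) b)
    refine Eq.trans ?_ (congrArg Neg.neg h4.symm)
    rw [← Finset.sum_neg_distrib]
    refine Finset.sum_congr rfl fun i _ => ?_
    simp only [rotatedBasis_apply, curvatureForm, LinearMap.mk₂_apply, h.sq, map_neg,
      inner_neg_left, neg_neg]
    rfl
  simp only [h1, Finset.sum_sub_distrib]
  rw [Finset.sum_comm]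
  simp only [h3]
  rw [Finset.sum_neg_distrib, starScalarCurvature_eq_sum J b,
    Finset.sum_comm (f := fun i j => (Inner.inner ℝ (curvature I x (b j) (b i) (J x (b i))) (J x (b j)) : ℝ))]
  ring

theorem IsNearlyKahler.scalarCurvature_sub (h : IsNearlyKahler J a) {ι : Type*} [Fintype ι]
    (b : OrthonormalBasis ι ℝ (TangentSpace I x)) :
    scalarCurvature I x - starScalarCurvature J x =
      4 * ∑ i, ∑ j, inner ℝ (a x (b i) (b j)) (a x (b i) (b j)) := by
  rw [scalarCurvature_eq_sum b, starScalarCurvature_eq_sum J b, Finset.sum_comm,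
    Finset.sum_comm (f := fun i j => (inner ℝ (curvature I x (b i) (b j) (J x (b j)))
      (J x (b i)) : ℝ)), ← Finset.sum_sub_distrib, Finset.mul_sum]
  refine Finset.sum_congr rfl fun i _ => ?_
  rw [← Finset.sum_sub_distrib, Finset.mul_sum]
  refine Finset.sum_congr rfl fun j _ => ?_
  have h1 := h.inner_curvature_sub (smoothFieldAt_extend (b i)) (smoothFieldAt_extend (b j))
  rw [← curvature_apply (smoothFieldAt_extend _) (smoothFieldAt_extend _)
    (h.smooth (smoothFieldAt_extend _)), ← curvature_apply (smoothFieldAt_extend _)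
    (smoothFieldAt_extend _) (smoothFieldAt_extend _)] at h1
  simp only [extend_apply_self] at h1
  rw [curvature_swap (b i) (b j), curvature_swap (b i) (b j), inner_neg_left, inner_neg_left, ← h1]
  ring

/-- With `m` the dimension, tracing the curvature comparison gives `0 = -2 s* - 2m div ζ + 2|a|²`;
substituting `4|a|² = s - s*` gives the claim. The factor `m` arises because the `dθ` term does not
depend on the second summation index. -/
theorem IsW1W5Connection.scalarCurvature_eq (h : IsW1W5Connection J a ζ D)
    (htr : ∀ u v : TangentSpace I x, LinearMap.trace ℝ (TangentSpace I x)
      ((J x).toLinearMap ∘ₗ curvatureEnd h.isSmoothConnection u v) = 0) :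
    scalarCurvature I x = 5 * starScalarCurvature J x +
      4 * Module.finrank ℝ E * divergence ζ x := by
  -- A smooth frame is used because the comparison formula needs fields of unit length near `x`, not
  -- merely at `x`.
  obtain ⟨s, u, hu, hxu, hs, ho⟩ := exists_orthonormal_frame I x
  set b := orthonormalBasisOfFamily (ho x hxu) with hb
  have hbs : ∀ i, s i x = b i := fun i => by simp [hb]
  have hsi : ∀ i, SmoothFieldAt I (s i) x := fun i => hs i x hxu
  have hunit : ∀ i, ∀ᶠ y in nhds x, (inner ℝ (s i y) (s i y) : ℝ) = 1 := by
    intro i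
    filter_upwards [hu.mem_nhds hxu] with y hy
    rw [real_inner_self_eq_norm_sq, (ho y hy).1 i, one_pow]
  have h1 := h.scalarCurvature_sub b
  have h2 := h.sum_curvature_J b
  -- The second argument is `J eᵢ`, and `a_{JX} = -J a_X` turns the quadratic correction into `+2
  -- |a_{eᵢ} eⱼ|²`.
  have h3 : ∀ i j, (inner ℝ (connCurvatureAt D x (b i) (J x (b i)) (b j)) (J x (b j)) : ℝ) =
      inner ℝ (curvature I x (b i) (J x (b i)) (b j)) (J x (b j)) +
      (- inner ℝ (leviCivita I M ζ x (b i)) (b i) -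
        inner ℝ (leviCivita I M ζ x (J x (b i))) (J x (b i))) +
        2 * inner ℝ (a x (b i) (b j)) (a x (b i) (b j)) := by
    intro i j
    have e1 := h.inner_connCurvature (hsi i) (h.smooth (hsi i)) (hsi j) (hunit j)
    rw [h.dtheta_apply_J (hsi i), ← connCurvatureAt_apply h.isSmoothConnection (hsi i)
      (h.smooth (hsi i)) (hsi j), ← curvature_apply (hsi i) (h.smooth (hsi i)) (hsi j)] at e1
    simp only [hbs, h.J_left, inner_neg_left, h.inner] at e1
    rw [e1]
    ring
  have h4 : ∀ i, ∑ j, (inner ℝ (connCurvatureAt D x (b i) (J x (b i)) (b j)) (J x (b j)) : ℝ) = 0 := by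
    intro i
    have e1 := htr (b i) (J x (b i))
    rw [LinearMap.trace_eq_sum_inner _ b] at e1
    rw [← neg_eq_zero, ← e1, ← Finset.sum_neg_distrib]
    refine Finset.sum_congr rfl fun j _ => ?_
    rw [← h.inner_left, real_inner_comm]
    rfl
  have h5 : ∑ i, ∑ j, (inner ℝ (connCurvatureAt D x (b i) (J x (b i)) (b j)) (J x (b j)) : ℝ) = 0 := by
    simp [h4]
  simp only [h3, Finset.sum_add_distrib, h2, ← Finset.mul_sum] at h5
  simp only [Finset.sum_const, Finset.card_univ, Fintype.card_fin, nsmul_eq_mul] at h5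
  rw [← Finset.mul_sum, Finset.sum_sub_distrib, Finset.sum_neg_distrib, ← divergence_eq_sum] at h5
  -- The vectors `J eᵢ` are again an orthonormal basis, so the second half of the `dθ` sum is
  -- another copy of the divergence.
  have h6 := divergence_eq_sum ζ (rotatedBasis (h.sq x) (h.inner x) b)
  simp only [rotatedBasis_apply] at h6
  rw [← h6] at h5
  linarith

end ScalarCurvature

/-! ### Derivatives of complex-valued functions -/

section ComplexValued

variable {E : Type*} [NormedAddCommGroup E] [NormedSpace ℝ E] [FiniteDimensional ℝ E]
  {H : Type*} [TopologicalSpace H] {I : ModelWithCorners ℝ E H}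
  {M : Type*} [TopologicalSpace M] [ChartedSpace H M] [IsManifold I ∞ M]
  [RiemannianBundle (fun x : M => TangentSpace I x)]
  [IsContMDiffRiemannianBundle I ∞ E (fun x : M => TangentSpace I x)]

theorem mvfderiv_clm_comp {F G : Type*} [NormedAddCommGroup F] [NormedSpace ℝ F]
    [NormedAddCommGroup G] [NormedSpace ℝ G] (L : F →L[ℝ] G) {f : M → F} {x : M}
    (hf : MDiffAt f x) (v : TangentSpace I x) :
    mvfderiv I (fun y => L (f y)) x v = L (mvfderiv I f x v) := by
  have h1 : mfderiv I 𝓘(ℝ, G) (L ∘ f) x =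
      (mfderiv 𝓘(ℝ, F) 𝓘(ℝ, G) L (f x)).comp (mfderiv I 𝓘(ℝ, F) f x) :=
    mfderiv_comp x L.differentiableAt.mdifferentiableAt hf
  rw [mfderiv_eq_fderiv, L.fderiv] at h1
  exact congrArg (fun T : E →L[ℝ] G => T v) h1

/-- `[X, Y] f = X (Y f) - Y (X f)` for complex-valued functions. -/
theorem mvfderiv_mlieBracket_complex {X Y : Π x : M, TangentSpace I x} {f : M → ℂ} {x : M}
    (hX : SmoothFieldAt I X x) (hY : SmoothFieldAt I Y x) (hf : ContMDiffAt I 𝓘(ℝ, ℂ) ∞ f x) :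
    mvfderiv I f x (mlieBracket I X Y x) =
      mvfderiv I (fun y => mvfderiv I f y (Y y)) x (X x) -
        mvfderiv I (fun y => mvfderiv I f y (X y)) x (Y x) := by
  have key : ∀ L : ℂ →L[ℝ] ℝ, L (mvfderiv I f x (mlieBracket I X Y x)) =
      L (mvfderiv I (fun y => mvfderiv I f y (Y y)) x (X x) -
        mvfderiv I (fun y => mvfderiv I f y (X y)) x (Y x)) := by
    intro L
    have hLf : CMDiffAt ∞ (fun y => L (f y)) x := L.contDiff.contDiffAt.comp_contMDiffAt hf
    have h2 : ∀ {Z W : Π x : M, TangentSpace I x}, SmoothFieldAt I Z x →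
        mvfderiv I (fun y => mvfderiv I (fun y => L (f y)) y (Z y)) x (W x) =
        L (mvfderiv I (fun y => mvfderiv I f y (Z y)) x (W x)) := by
      intro Z W hZ
      rw [← mvfderiv_clm_comp L
        ((contMDiffAt_mvfderiv_apply hf hZ).mdifferentiableAt (by simp))]
      congr 1
      refine mvfderiv_congr ?_
      filter_upwards [eventually_mdifferentiableAt_of_contMDiffAt hf] with y hy
      exact mvfderiv_clm_comp L hy _
    rw [← mvfderiv_clm_comp L (hf.mdifferentiableAt (by simp)), mvfderiv_mlieBracket hX hY hLf,
      h2 hX, h2 hY, map_sub]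
  exact Complex.ext (key Complex.reCLM) (key Complex.imCLM)

end ComplexValued

/-! ### From the `SU(n)`-structure to a smooth torsion and trace-free curvature -/

section SpecialUnitary

variable {n : ℕ} {M : Type*} [TopologicalSpace M]
  [ChartedSpace (EuclideanSpace ℝ (Fin (2 * n))) M] [IsManifold (𝓡 (2 * n)) ∞ M]
  [RiemannianBundle (fun x : M => TangentSpace (𝓡 (2 * n)) x)]
  [IsContMDiffRiemannianBundle (𝓡 (2 * n)) ∞ (EuclideanSpace ℝ (Fin (2 * n)))
    (fun x : M => TangentSpace (𝓡 (2 * n)) x)]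
  (S : SUStructure n M)

theorem SUStructure.isAlmostHermitian : IsAlmostHermitian S.J where
  smooth {x _} hX := ContMDiffAt.clm_bundle_apply (S.contMDiff_J x) hX
  sq := S.J_sq
  inner := S.inner_J

/-- A section of `W₁` and a covector field whose sum is the torsion `D - ∇` of a connection
`D` preserving the `SU(n)`-structure. -/
structure SUStructure.IsW1W5Torsion (S : SUStructure n M)
    (a : Π x : M, TangentSpace (𝓡 (2 * n)) x →L[ℝ] TangentSpace (𝓡 (2 * n)) x →L[ℝ]
      TangentSpace (𝓡 (2 * n)) x)
    (ζ : Π x : M, TangentSpace (𝓡 (2 * n)) x)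
    (D : CovariantDerivative (𝓡 (2 * n)) (EuclideanSpace ℝ (Fin (2 * n)))
      (fun x : M => TangentSpace (𝓡 (2 * n)) x)) : Prop where
  isConnection : S.IsConnection D
  mem : ∀ x, a x ∈ W1 (S.J x)
  conn : ∀ {x : M} {Y : Π x : M, TangentSpace (𝓡 (2 * n)) x}, DiffFieldAt (𝓡 (2 * n)) Y x →
    ∀ v, D Y x v = leviCivita (𝓡 (2 * n)) M Y x v + a x v (Y x) +
      (inner ℝ (ζ x) (S.J x v) : ℝ) • S.J x (Y x)

/-- The decomposition and the vector dual to the covector are chosen point by point, so this carries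
no regularity; that is recovered separately for each part. -/
theorem SUStructure.IsTypeW1W5.exists_torsion {S : SUStructure n M} (hS : S.IsTypeW1W5) :
    ∃ a ζ D, S.IsW1W5Torsion a ζ D := by
  obtain ⟨ξ, ⟨-, D, hD, hξ⟩, hmem⟩ := hS
  have h1 : ∀ x, ∃ a ∈ W1 (S.J x), ∃ η : TangentSpace (𝓡 (2 * n)) x →L[ℝ] ℝ,
      ∀ X Y, ξ x X Y = a X Y + η (S.J x X) • S.J x Y := by
    intro x
    obtain ⟨a, ha, b, ⟨η, hη⟩, hab⟩ := Submodule.mem_sup.1 (hmem x)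
    exact ⟨a, ha, η, fun X Y => by rw [← hab, ← hη]; rfl⟩
  choose a ha η hη using h1
  refine ⟨a, fun x => (InnerProductSpace.toDual ℝ _).symm (η x), D, hD, ha, ?_⟩
  intro x Y hY v
  rw [InnerProductSpace.toDual_symm_apply, add_assoc, ← hη, hξ x v Y hY, add_sub_cancel]

variable {S}
  {a : Π x : M, TangentSpace (𝓡 (2 * n)) x →L[ℝ] TangentSpace (𝓡 (2 * n)) x →L[ℝ]
    TangentSpace (𝓡 (2 * n)) x}
  {ζ : Π x : M, TangentSpace (𝓡 (2 * n)) x}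
  {D : CovariantDerivative (𝓡 (2 * n)) (EuclideanSpace ℝ (Fin (2 * n)))
    (fun x : M => TangentSpace (𝓡 (2 * n)) x)} {x : M}

/-- The value of a complex volume form on smooth vector fields is smooth. -/
theorem SUStructure.contMDiffAt_update (S : SUStructure n M)
    {Y : Fin n → Π y : M, TangentSpace (𝓡 (2 * n)) y}
    (hY : ∀ k, SmoothFieldAt (𝓡 (2 * n)) (Y k) x) {W : Π y : M, TangentSpace (𝓡 (2 * n)) y}
    (hW : SmoothFieldAt (𝓡 (2 * n)) W x) (k : Fin n) :
    ContMDiffAt (𝓡 (2 * n)) 𝓘(ℝ, ℂ) ∞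
      (fun y => S.Ψ y (Function.update (fun j => Y j y) k (W y))) x := by
  have h1 := S.contMDiff_Ψ x (Function.update Y k W) (fun i => by
    by_cases hi : i = k
    · subst hi; simpa using hW
    · simpa [hi] using hY i)
  convert h1 using 3 with y
  ext1 i
  by_cases hi : i = k
  · subst hi; simp
  · simp [hi]

namespace SUStructure.IsW1W5Torsion

/-- In `D(JY) = J DY` the `W₅` terms cancel, while the two `a` terms have opposite signs and add up
to `2 J a`. -/
theorem isNearlyKahler (h : S.IsW1W5Torsion a ζ D) : IsNearlyKahler S.J a where
  toIsAlmostHermitian := S.isAlmostHermitian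
  anti x v w := ((h.mem x).1 v).2 w
  skew x v w z := ((h.mem x).1 v).1 w z
  alt x v w := (h.mem x).2 v w
  nabla {x Y} hY := by
    filter_upwards [hY.eventually_diff, (S.isAlmostHermitian.smooth hY).eventually_diff]
      with y h1 h2 v
    have h3 := h.isConnection.parallel_J y v Y h1
    rw [h.conn h1, h.conn h2, ((h.mem y).1 v).2] at h3
    simp only [map_add, map_smul] at h3
    have h4 := add_right_cancel h3
    rw [← sub_eq_add_neg, sub_eq_iff_eq_add] at h4
    rw [h4, two_smul]
    abel

/-- Differentiate `f = Ψ(Y₁, …, Yₙ)` along `X`, with `f ≠ 0` near the point. Since `Ψ` is parallel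
and of type `(n, 0)`, the `W₅` term contributes `n i θ(X) f`, while everything else in the formula
is already known to be smooth and is collected in `g`. So `θ(X) = n⁻¹ Im(g / f)`, which requires `n
≠ 0`. -/
theorem contMDiffAt_theta (h : S.IsW1W5Torsion a ζ D) (hn : n ≠ 0)
    {X : Π y : M, TangentSpace (𝓡 (2 * n)) y} (hX : SmoothFieldAt (𝓡 (2 * n)) X x) :
    ContMDiffAt (𝓡 (2 * n)) 𝓘(ℝ, ℝ) ∞ (fun y => (inner ℝ (ζ y) (S.J y (X y)) : ℝ)) x := by
  obtain ⟨v, hv⟩ := formNormSq_ne_zero_exists (Ψ := S.Ψ x) (by simp [S.normSq_Ψ])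
  set Y : Fin n → Π y : M, TangentSpace (𝓡 (2 * n)) y := fun k =>
    extend (EuclideanSpace ℝ (Fin (2 * n))) (v k) with hYdef
  have hY : ∀ k, SmoothFieldAt (𝓡 (2 * n)) (Y k) x := fun k => smoothFieldAt_extend _
  set f : M → ℂ := fun y => S.Ψ y (fun k => Y k y) with hfdef
  have hf : ContMDiffAt (𝓡 (2 * n)) 𝓘(ℝ, ℂ) ∞ f x := S.contMDiff_Ψ x Y hY
  have hfx : f x ≠ 0 := by simpa [hfdef, hYdef] using hv
  set g : M → ℂ := fun y => mvfderiv (𝓡 (2 * n)) f y (X y) -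
    ∑ k, S.Ψ y (Function.update (fun j => Y j y) k
      (leviCivita (𝓡 (2 * n)) M (Y k) y (X y) + a y (X y) (Y k y))) with hgdef
  have hsum : ContMDiffAt (𝓡 (2 * n)) 𝓘(ℝ, ℂ) ∞ (fun y => ∑ k, S.Ψ y
      (Function.update (fun j => Y j y) k
      (leviCivita (𝓡 (2 * n)) M (Y k) y (X y) + a y (X y) (Y k y)))) x :=
    ContMDiffAt.sum fun k _ => S.contMDiffAt_update hY
      (((hY k).covDeriv hX).add (h.isNearlyKahler.smoothField hX (hY k))) k
  have hg : ContMDiffAt (𝓡 (2 * n)) 𝓘(ℝ, ℂ) ∞ g x :=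
    (contMDiffAt_mvfderiv_apply hf hX).sub hsum
  have hinv : ContMDiffAt (𝓡 (2 * n)) 𝓘(ℝ, ℂ) ∞ (fun y => (f y)⁻¹) x :=
    (contDiffAt_inv ℝ hfx).comp_contMDiffAt hf
  have hgf : ContMDiffAt (𝓡 (2 * n)) 𝓘(ℝ, ℂ) ∞ (fun y => g y * (f y)⁻¹) x :=
    (contDiff_mul (𝕜 := ℝ) (𝔸 := ℂ)).contDiffAt.comp_contMDiffAt (hg.prodMk_space hinv)
  have him : ContMDiffAt (𝓡 (2 * n)) 𝓘(ℝ, ℝ) ∞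
      (fun y => (n : ℝ)⁻¹ * Complex.imCLM (g y * (f y)⁻¹)) x :=
    contMDiffAt_const.mul (Complex.imCLM.contDiff.contDiffAt.comp_contMDiffAt hgf)
  refine him.congr_of_eventuallyEq ?_
  have hdiff : ∀ᶠ y in nhds x, ∀ k, DiffFieldAt (𝓡 (2 * n)) (Y k) y :=
    Filter.eventually_all.2 fun k => (hY k).eventually_diff
  filter_upwards [hdiff, hf.continuousAt.eventually_ne hfx] with y hy hfy
  have h1 := h.isConnection.parallel_Ψ y (X y) Y hy
  have h2 : ∀ k, S.Ψ y (Function.update (fun j => Y j y) k (D (Y k) y (X y))) =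
      S.Ψ y (Function.update (fun j => Y j y) k
        (leviCivita (𝓡 (2 * n)) M (Y k) y (X y) + a y (X y) (Y k y))) +
      (inner ℝ (ζ y) (S.J y (X y)) : ℝ) • (Complex.I * f y) := by
    intro k
    have h3 := S.Ψ_J y (fun j => Y j y) k
    rw [h.conn (hy k), ContinuousAlternatingMap.map_update_add,
      ContinuousAlternatingMap.map_update_smul]
    rw [h3]
  simp only [h2, Finset.sum_add_distrib] at h1
  have h4 : g y = (n * (inner ℝ (ζ y) (S.J y (X y)) : ℝ) : ℝ) * Complex.I * f y := by
    simp only [hgdef]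
    rw [hfdef, h1]
    simp
    ring
  rw [h4, mul_inv_cancel_right₀ hfy]
  have : (n : ℝ) ≠ 0 := by exact_mod_cast hn
  simp
  field_simp

theorem isW1W5Connection (h : S.IsW1W5Torsion a ζ D) (hn : n ≠ 0) :
    IsW1W5Connection S.J a ζ D where
  toIsNearlyKahler := h.isNearlyKahler
  smooth_vec x := smoothFieldAt_of_inner fun X hX => by
    -- Inner products with `ζ` itself are values of `θ`, since `θ(JX) = -⟨ζ, X⟩`.
    have h1 := (h.contMDiffAt_theta hn (S.isAlmostHermitian.smooth hX)).neg
    convert h1 using 2 with y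
    simp [S.J_sq, real_inner_comm]
  conn := h.conn

end SUStructure.IsW1W5Torsion

variable {Y : Fin n → Π y : M, TangentSpace (𝓡 (2 * n)) y}
  {X Z : Π y : M, TangentSpace (𝓡 (2 * n)) y}

theorem SUStructure.IsConnection.mvfderiv_update (hc : S.IsConnection D)
    (hY : ∀ k, SmoothFieldAt (𝓡 (2 * n)) (Y k) x) {W : Π y : M, TangentSpace (𝓡 (2 * n)) y}
    (hW : SmoothFieldAt (𝓡 (2 * n)) W x) (k : Fin n) (v : TangentSpace (𝓡 (2 * n)) x) :
    mvfderiv (𝓡 (2 * n)) (fun y => S.Ψ y (Function.update (fun j => Y j y) k (W y))) x v =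
      S.Ψ x (Function.update (fun j => Y j x) k (D W x v)) +
      ∑ l ∈ Finset.univ.erase k, S.Ψ x (Function.update
        (Function.update (fun j => Y j x) k (W x)) l (D (Y l) x v)) := by
  have hU : ∀ y, (fun i => Function.update Y k W i y) =
      Function.update (fun j => Y j y) k (W y) := by
    intro y
    ext1 i
    by_cases hi : i = k
    · subst hi; simp
    · simp [hi]
  have h1 := hc.parallel_Ψ x v (Function.update Y k W) (fun i => by
    by_cases hi : i = k
    · subst hi; simpa using hW.diff
    · simpa [hi] using (hY i).diff)
  simp only [hU] at h1
  rw [h1, ← Finset.add_sum_erase _ _ (Finset.mem_univ k)]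
  congr 1
  · simp
  · refine Finset.sum_congr rfl fun l hl => ?_
    rw [Function.update_of_ne (Finset.ne_of_mem_erase hl)]

/-- Differentiate the function `Ψ(Y₁, …, Yₙ)` along `Z`, then `X`, and antisymmetrize. Terms with
derivatives in two different slots are symmetric and cancel; comparison with the derivative along
`[X, Z]` leaves the curvature acting on `Ψ` as a derivation. -/
theorem SUStructure.IsConnection.sum_connCurvature (hc : S.IsConnection D)
    (hD : IsSmoothConnection D) (hX : SmoothFieldAt (𝓡 (2 * n)) X x)
    (hZ : SmoothFieldAt (𝓡 (2 * n)) Z x) (hY : ∀ k, SmoothFieldAt (𝓡 (2 * n)) (Y k) x) :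
    ∑ k, S.Ψ x (Function.update (fun j => Y j x) k (connCurvature D X Z (Y k) x)) = 0 := by
  set f : M → ℂ := fun y => S.Ψ y (fun k => Y k y) with hfdef
  have hf : ContMDiffAt (𝓡 (2 * n)) 𝓘(ℝ, ℂ) ∞ f x := S.contMDiff_Ψ x Y hY
  have hdiff : ∀ᶠ y in nhds x, ∀ k, DiffFieldAt (𝓡 (2 * n)) (Y k) y :=
    Filter.eventually_all.2 fun k => (hY k).eventually_diff
  have key : ∀ {X Z : Π y : M, TangentSpace (𝓡 (2 * n)) y}, SmoothFieldAt (𝓡 (2 * n)) X x →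
      SmoothFieldAt (𝓡 (2 * n)) Z x →
      mvfderiv (𝓡 (2 * n)) (fun y => mvfderiv (𝓡 (2 * n)) f y (Z y)) x (X x) =
      ∑ k, (S.Ψ x (Function.update (fun j => Y j x) k (D (fun q => D (Y k) q (Z q)) x (X x))) +
        ∑ l ∈ Finset.univ.erase k, S.Ψ x (Function.update
          (Function.update (fun j => Y j x) k (D (Y k) x (Z x))) l (D (Y l) x (X x)))) := by
    intro X Z hX hZ
    have h1 : ∀ᶠ y in nhds x, mvfderiv (𝓡 (2 * n)) f y (Z y) =
        ∑ k, S.Ψ y (Function.update (fun j => Y j y) k (D (Y k) y (Z y))) := by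
      filter_upwards [hdiff] with y hy
      exact hc.parallel_Ψ y (Z y) Y hy
    have hk : ∀ k, SmoothFieldAt (𝓡 (2 * n)) (fun y => D (Y k) y (Z y)) x := fun k =>
      hD x Z (Y k) hZ (hY k)
    rw [mvfderiv_congr h1, mvfderiv_fun_sum fun k _ =>
      (S.contMDiffAt_update hY (hk k) k).mdifferentiableAt (by simp), sum_apply]
    exact Finset.sum_congr rfl fun k _ => hc.mvfderiv_update hY (hk k) k (X x)
  have hcross : ∀ u v : TangentSpace (𝓡 (2 * n)) x,
      ∑ k, ∑ l ∈ Finset.univ.erase k, S.Ψ x (Function.update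
          (Function.update (fun j => Y j x) k (D (Y k) x u)) l (D (Y l) x v)) =
      ∑ k, ∑ l ∈ Finset.univ.erase k, S.Ψ x (Function.update
          (Function.update (fun j => Y j x) k (D (Y k) x v)) l (D (Y l) x u)) := by
    intro u v
    rw [Finset.sum_comm' (t' := Finset.univ) (s' := fun l => Finset.univ.erase l)
      (fun a b => by simp [ne_comm])]
    refine Finset.sum_congr rfl fun k _ => Finset.sum_congr rfl fun l hl => ?_
    rw [Function.update_comm (Finset.ne_of_mem_erase hl)]
  have h1 := mvfderiv_mlieBracket_complex hX hZ hf
  rw [key hX hZ, key hZ hX, Finset.sum_add_distrib, Finset.sum_add_distrib, hcross,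
    add_sub_add_right_eq_sub, hc.parallel_Ψ x _ Y fun k => (hY k).diff] at h1
  have h2 : ∀ k (u v : TangentSpace (𝓡 (2 * n)) x),
      S.Ψ x (Function.update (fun j => Y j x) k (u - v)) =
      S.Ψ x (Function.update (fun j => Y j x) k u) -
        S.Ψ x (Function.update (fun j => Y j x) k v) := fun k u v =>
    ContinuousAlternatingMap.map_update_sub _ _ _ _ _
  simp only [connCurvature, h2, Finset.sum_sub_distrib]
  rw [h1, sub_self]

namespace SUStructure.IsW1W5Torsion

theorem trace_J_comp_curvature (h : S.IsW1W5Torsion a ζ D) (hn : n ≠ 0)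
    (u v : TangentSpace (𝓡 (2 * n)) x) :
    LinearMap.trace ℝ (TangentSpace (𝓡 (2 * n)) x) ((S.J x).toLinearMap ∘ₗ
      curvatureEnd (h.isW1W5Connection hn).isSmoothConnection u v) = 0 := by
  have hc := h.isW1W5Connection hn
  obtain ⟨Y, hY⟩ := formNormSq_ne_zero_exists (Ψ := S.Ψ x) (by simp [S.normSq_Ψ])
  refine trace_J_comp_eq_zero (Ψ := S.Ψ x) ?_ (S.Ψ_J x) (S.J_sq x) hY ?_ ?_
  · exact finrank_euclideanSpace_fin
  · intro w
    have h1 := hc.connCurvature_J (smoothFieldAt_extend u) (smoothFieldAt_extend v)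
      (smoothFieldAt_extend w)
    rw [← connCurvatureAt_apply hc.isSmoothConnection (smoothFieldAt_extend u)
      (smoothFieldAt_extend v) (hc.smooth (smoothFieldAt_extend w))] at h1
    simpa using! h1
  · have h1 := h.isConnection.sum_connCurvature hc.isSmoothConnection (smoothFieldAt_extend u)
      (smoothFieldAt_extend v) (fun k => smoothFieldAt_extend (Y k))
    simpa using! h1

theorem scalarCurvature_eq (h : S.IsW1W5Torsion a ζ D) (hn : n ≠ 0) (x : M) :
    scalarCurvature (𝓡 (2 * n)) x =
      5 * starScalarCurvature S.J x + 8 * n * divergence ζ x := by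
  rw [(h.isW1W5Connection hn).scalarCurvature_eq (h.trace_J_comp_curvature hn),
    finrank_euclideanSpace_fin]
  push_cast
  ring

end SUStructure.IsW1W5Torsion

end SpecialUnitary

/-! ### Jacobi's formula and Gram determinants -/

section Determinant

/-- Grouping the differentiated permutation expansion by the differentiated column gives
determinants with one column replaced, which Cramer's rule expresses through the adjugate. -/
theorem hasFDerivAt_det {F ι : Type*} [NormedAddCommGroup F] [NormedSpace ℝ F] [Fintype ι]
    [DecidableEq ι] {A : F → Matrix ι ι ℝ} {A' : ι → ι → F →L[ℝ] ℝ} {u : F}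
    (h : ∀ i j, HasFDerivAt (fun v => A v i j) (A' i j) u) :
    HasFDerivAt (fun v => (A v).det) (∑ i, ∑ j, (A u).adjugate i j • A' j i) u := by
  have h1 : HasFDerivAt (fun v => ∑ σ : Equiv.Perm ι, ((σ.sign : ℤ) : ℝ) * ∏ i, A v (σ i) i)
      (∑ σ : Equiv.Perm ι, ((σ.sign : ℤ) : ℝ) •
        ∑ i, (∏ j ∈ Finset.univ.erase i, A u (σ j) j) • A' (σ i) i) u :=
    HasFDerivAt.fun_sum fun σ _ => (HasFDerivAt.finsetProd fun i _ => h (σ i) i).const_mul _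
  simp only [Matrix.det_apply']
  convert h1 using 1
  ext w
  simp only [sum_apply, smul_apply, smul_eq_mul, Finset.mul_sum]
  rw [Finset.sum_comm (s := (Finset.univ : Finset (Equiv.Perm ι)))]
  refine Finset.sum_congr rfl fun i _ => ?_
  have h2 : ∑ j, (A u).adjugate i j * A' j i w =
      ((A u).updateCol i (fun j => A' j i w)).det := by
    rw [← Matrix.cramer_apply, Matrix.cramer_eq_adjugate_mulVec]
    rfl
  rw [h2, Matrix.det_apply']
  refine Finset.sum_congr rfl fun σ _ => ?_
  rw [← Finset.mul_prod_erase _ _ (Finset.mem_univ i), Matrix.updateCol_self, mul_comm (A' _ _ _)]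
  congr 2
  refine Finset.prod_congr rfl fun j hj => ?_
  rw [Matrix.updateCol_ne (Finset.ne_of_mem_erase hj)]

theorem gram_sum_smul {V ι : Type*} [NormedAddCommGroup V] [InnerProductSpace ℝ V] [Fintype ι]
    (A : Matrix ι ι ℝ) (w : ι → V) :
    Matrix.gram ℝ (fun i => ∑ j, A j i • w j) = A.transpose * Matrix.gram ℝ w * A := by
  ext i j
  simp only [Matrix.gram_apply, Matrix.mul_apply, Matrix.transpose_apply, sum_inner, inner_sum,
    inner_smul_left, inner_smul_right, RCLike.conj_to_real, Finset.sum_mul]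
  refine Finset.sum_congr rfl fun k _ => ?_
  rw [Finset.mul_sum]
  refine Finset.sum_congr rfl fun l _ => ?_
  ring

/-- `det G · tr L = tr (adj G · N)` for the Gram matrix `G` of a basis and `N i j = ⟨L vᵢ, vⱼ⟩`. -/
theorem det_gram_mul_trace {V ι : Type*} [NormedAddCommGroup V] [InnerProductSpace ℝ V]
    [Fintype ι] [DecidableEq ι] (b : Module.Basis ι ℝ V) (L : V →ₗ[ℝ] V) :
    (Matrix.gram ℝ b).det * LinearMap.trace ℝ V L =
      ∑ i, ∑ j, (Matrix.gram ℝ b).adjugate i j * inner ℝ (L (b i)) (b j) := by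
  -- With `G` the Gram matrix and `[L]` the matrix of `L`, this is `N = [L]ᵀ G`, so `adj(G) Nᵀ =
  -- adj(G) G [L] = det(G) [L]`.
  have h1 : ∀ i j, (inner ℝ (L (b i)) (b j) : ℝ) =
      ((LinearMap.toMatrix b b L).transpose * Matrix.gram ℝ b) i j := by
    intro i j
    rw [Matrix.mul_apply]
    nth_rw 1 [← b.sum_repr (L (b i))]
    rw [sum_inner]
    simp [inner_smul_left, LinearMap.toMatrix_apply]
  have h2 : ∑ i, ∑ j, (Matrix.gram ℝ b).adjugate i j * (inner ℝ (L (b i)) (b j) : ℝ) =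
      ((Matrix.gram ℝ b).adjugate * ((LinearMap.toMatrix b b L).transpose *
        Matrix.gram ℝ b).transpose).trace := by
    simp only [h1, Matrix.trace, Matrix.diag_apply, Matrix.mul_apply, Matrix.transpose_apply]
  have h3 : (Matrix.gram ℝ b).transpose = Matrix.gram ℝ b := by
    ext i j
    exact real_inner_comm _ _
  rw [h2, Matrix.transpose_mul, Matrix.transpose_transpose, h3, ← mul_assoc, Matrix.adjugate_mul,
    Matrix.smul_mul, one_mul, Matrix.trace_smul, LinearMap.trace_eq_matrix_trace ℝ b, smul_eq_mul]

end Determinant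

/-! ### Coordinate vector fields and chart transitions -/

section Coordinates

variable {E : Type*} [NormedAddCommGroup E] [NormedSpace ℝ E] [FiniteDimensional ℝ E]
  {H : Type*} [TopologicalSpace H] {I : ModelWithCorners ℝ E H}
  {M : Type*} [TopologicalSpace M] [ChartedSpace H M] [IsManifold I ∞ M] {c p : M}

variable (I) in
/-- The vector field with constant coefficients `v` in the chart at `c`. -/
noncomputable def chartField (c : M) (v : E) (p : M) : TangentSpace I p :=
  mpullback I 𝓘(ℝ, E) (extChartAt I c) (fun _ => v) p

variable (I c) in
/-- The coefficients of a tangent vector in the chart at `c`. -/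
noncomputable def chartCoord (p : M) (w : TangentSpace I p) : E :=
  mfderiv I 𝓘(ℝ, E) (extChartAt I c) p w

theorem isInvertible_mfderiv_extChartAt' (hp : p ∈ (extChartAt I c).source) :
    (mfderiv I 𝓘(ℝ, E) (extChartAt I c) p).IsInvertible := by
  have : IsManifold I 1 M := IsManifold.of_le (n := ∞) (by simp)
  exact isInvertible_mfderiv_extChartAt hp

/-- The identification of a tangent space with the model space given by a chart. -/
noncomputable def chartEquiv (hp : p ∈ (extChartAt I c).source) : TangentSpace I p ≃L[ℝ] E :=
  (isInvertible_mfderiv_extChartAt' hp).choose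

theorem chartEquiv_apply (hp : p ∈ (extChartAt I c).source) (w : TangentSpace I p) :
    chartEquiv hp w = chartCoord I c p w :=
  congrArg (fun L : TangentSpace I p →L[ℝ] E => L w)
    (isInvertible_mfderiv_extChartAt' hp).choose_spec

theorem chartEquiv_symm_apply (hp : p ∈ (extChartAt I c).source) (v : E) :
    (chartEquiv hp).symm v = chartField I c v p := by
  have h1 := congrArg (fun L : TangentSpace I p →L[ℝ] E => L.inverse v)
    (isInvertible_mfderiv_extChartAt' hp).choose_spec
  refine Eq.trans ?_ h1
  change _ = ContinuousLinearMap.inverse (chartEquiv hp : TangentSpace I p →L[ℝ] E) v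
  rw [ContinuousLinearMap.inverse_equiv]
  rfl

theorem contMDiffAt_constField (v : E) (u : E) :
    ContMDiffAt 𝓘(ℝ, E) (𝓘(ℝ, E).prod 𝓘(ℝ, E)) ∞
      (fun x => (⟨x, v⟩ : TangentBundle 𝓘(ℝ, E) E)) u := by
  refine contMDiffAt_vectorSpace_iff_contDiffAt.2 ?_
  exact contDiffAt_const

theorem smoothFieldAt_chartField (hp : p ∈ (extChartAt I c).source) (v : E) :
    SmoothFieldAt I (chartField I c v) p := by
  have : CompleteSpace E := FiniteDimensional.complete ℝ E
  have : IsManifold I (((⊤ : ℕ∞) : ℕ∞ω) + 1) M := by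
    have : (((⊤ : ℕ∞) : ℕ∞ω) + 1) = ∞ := rfl
    rw [this]; infer_instance
  exact ContMDiffAt.mpullback_vectorField_preimage (n := ∞) (contMDiffAt_constField v _)
    (contMDiffAt_extChartAt' (by rwa [extChartAt_source] at hp))
    (isInvertible_mfderiv_extChartAt' hp) le_rfl

theorem mlieBracket_eq_lieBracket (V W : Π x : E, TangentSpace 𝓘(ℝ, E) x) :
    mlieBracket 𝓘(ℝ, E) V W = lieBracket ℝ V W := by
  rw [← mlieBracketWithin_univ, mlieBracketWithin_eq_lieBracketWithin]
  exact lieBracketWithin_univ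

/-- Brackets are natural under pullback by the chart, and constant fields on a vector space commute.
-/
theorem mlieBracket_chartField (hp : p ∈ (extChartAt I c).source) (v w : E) :
    mlieBracket I (chartField I c v) (chartField I c w) p = 0 := by
  have : CompleteSpace E := FiniteDimensional.complete ℝ E
  have : IsManifold I (minSmoothness ℝ 2) M := by
    rw [minSmoothness_of_isRCLikeNormedField]; infer_instance
  have h1 := mpullback_mlieBracket (I := I) (I' := 𝓘(ℝ, E))
    (f := extChartAt I c) (x₀ := p) ((contMDiffAt_constField v _).mdifferentiableAt (by simp))
    ((contMDiffAt_constField w _).mdifferentiableAt (by simp)) (n := ∞)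
    (contMDiffAt_extChartAt' (by rwa [extChartAt_source] at hp))
    (by rw [minSmoothness_of_isRCLikeNormedField]; exact ENat.LEInfty.out)
  refine h1.symm.trans ?_
  have h2 : mlieBracket 𝓘(ℝ, E) (fun _ => v : Π x : E, TangentSpace 𝓘(ℝ, E) x) (fun _ => w)
      (extChartAt I c p) = 0 := by
    have h3 := congrFun (mlieBracket_eq_lieBracket (E := E) (fun _ => v) (fun _ => w))
      (extChartAt I c p)
    refine h3.trans ?_
    simp only [lieBracket]
    rw [fderiv_fun_const, fderiv_fun_const]
    simp
    rfl
  exact (congrArg _ h2).trans (map_zero _)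

theorem contMDiffAt_chartCoord (hp : p ∈ (extChartAt I c).source)
    {X : Π x : M, TangentSpace I x} (hX : SmoothFieldAt I X p) :
    CMDiffAt ∞ (fun q => chartCoord I c q (X q)) p :=
  contMDiffAt_mvfderiv_apply
    (contMDiffAt_extChartAt' (by rwa [extChartAt_source] at hp)) hX

variable [I.Boundaryless]

/-- Reconciles the pullback along the chart, convenient for smoothness and brackets, with the
pushforward along its inverse, which is how `coordVec` and the density are defined. -/
theorem chartField_eq_mfderiv_symm {u : E} (hu : u ∈ (extChartAt I c).target) (v : E) :
    mfderiv 𝓘(ℝ, E) I (extChartAt I c).symm u v =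
      chartField I c v ((extChartAt I c).symm u) := by
  have : IsManifold I 1 M := IsManifold.of_le (n := ∞) (by simp)
  have hp := (extChartAt I c).map_target hu
  have h1 := mfderiv_extChartAt_comp_mfderivWithin_extChartAt_symm (I := I) hu
  simp only [ModelWithCorners.range_eq_univ, mfderivWithin_univ] at h1
  rw [← chartEquiv_symm_apply hp, ContinuousLinearEquiv.eq_symm_apply, chartEquiv_apply]
  exact congrArg (fun L : E →L[ℝ] E => L v) h1

theorem mdifferentiableAt_extChartAt_symm {u : E} (hu : u ∈ (extChartAt I c).target) :
    MDifferentiableAt 𝓘(ℝ, E) I (extChartAt I c).symm u := by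
  have : IsManifold I 1 M := IsManifold.of_le (n := ∞) (by simp)
  have h := mdifferentiableWithinAt_extChartAt_symm (I := I) hu
  rwa [ModelWithCorners.range_eq_univ, mdifferentiableWithinAt_univ] at h

theorem contMDiffAt_extChartAt_symm {u : E} (hu : u ∈ (extChartAt I c).target) :
    ContMDiffAt 𝓘(ℝ, E) I ∞ (extChartAt I c).symm u :=
  (contMDiffOn_extChartAt_symm c).contMDiffAt ((isOpen_extChartAt_target c).mem_nhds hu)

/-- The partial derivatives of the coordinate expression of a function. -/
theorem hasFDerivAt_comp_extChartAt_symm {F : Type*} [NormedAddCommGroup F] [NormedSpace ℝ F]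
    {f : M → F} {u : E} (hu : u ∈ (extChartAt I c).target)
    (hf : MDiffAt f ((extChartAt I c).symm u)) :
    ∃ L : E →L[ℝ] F, HasFDerivAt (fun w => f ((extChartAt I c).symm w)) L u ∧
      ∀ v, L v = mvfderiv I f ((extChartAt I c).symm u)
        (chartField I c v ((extChartAt I c).symm u)) := by
  have h1 := hf.hasMFDerivAt.comp u (mdifferentiableAt_extChartAt_symm hu).hasMFDerivAt
  refine ⟨_, hasMFDerivAt_iff_hasFDerivAt.1 h1, fun v => ?_⟩
  rw [← chartField_eq_mfderiv_symm hu]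
  rfl

theorem fderiv_comp_extChartAt_symm {F : Type*} [NormedAddCommGroup F] [NormedSpace ℝ F]
    {f : M → F} {u : E} (hu : u ∈ (extChartAt I c).target)
    (hf : MDiffAt f ((extChartAt I c).symm u)) (v : E) :
    fderiv ℝ (fun w => f ((extChartAt I c).symm w)) u v =
      mvfderiv I f ((extChartAt I c).symm u) (chartField I c v ((extChartAt I c).symm u)) := by
  obtain ⟨L, h1, h2⟩ := hasFDerivAt_comp_extChartAt_symm hu hf
  rw [h1.fderiv, h2]

/-- The transition map between two charts, with its derivative. -/
theorem exists_hasFDerivAt_transition {c' : M} {u : E} (hu : u ∈ (extChartAt I c).target)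
    (hu' : (extChartAt I c).symm u ∈ (extChartAt I c').source) :
    ∃ L : E →L[ℝ] E, HasFDerivAt (fun w => extChartAt I c' ((extChartAt I c).symm w)) L u ∧
      ∀ v, chartField I c v ((extChartAt I c).symm u) =
        chartField I c' (L v) ((extChartAt I c).symm u) := by
  have : IsManifold I 1 M := IsManifold.of_le (n := ∞) (by simp)
  obtain ⟨L, h1, h2⟩ := hasFDerivAt_comp_extChartAt_symm (f := extChartAt I c') hu
    (mdifferentiableAt_extChartAt (by rwa [extChartAt_source] at hu'))
  refine ⟨L, h1, fun v => ?_⟩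
  rw [← chartEquiv_symm_apply hu' (L v), ContinuousLinearEquiv.eq_symm_apply, chartEquiv_apply, h2]
  rfl

end Coordinates

/-! ### The volume density: transformation rule and logarithmic derivative -/

section ChartDensity

variable {m : ℕ} {M : Type*} [TopologicalSpace M] [ChartedSpace (EuclideanSpace ℝ (Fin m)) M]
  [IsManifold (𝓡 m) ∞ M]
  [RiemannianBundle (fun x : M => TangentSpace (𝓡 m) x)]
  {c p : M} {u : EuclideanSpace ℝ (Fin m)}

/-- The coordinate field `∂ᵢ` of the chart at `c`. -/
noncomputable def coordField (c : M) (i : Fin m) (p : M) : TangentSpace (𝓡 m) p :=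
  chartField (𝓡 m) c (EuclideanSpace.single i (1 : ℝ)) p

variable (m) in
/-- The matrix `g(∂ᵢ, ∂ⱼ)`. -/
noncomputable def coordGram (c p : M) : Matrix (Fin m) (Fin m) ℝ :=
  Matrix.gram ℝ (fun i => coordField c i p)

/-- The coordinate fields form a basis of the tangent space. -/
noncomputable def coordBasis (hp : p ∈ (extChartAt (𝓡 m) c).source) :
    Module.Basis (Fin m) ℝ (TangentSpace (𝓡 m) p) :=
  (EuclideanSpace.basisFun (Fin m) ℝ).toBasis.map (chartEquiv hp).symm.toLinearEquiv

@[simp]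
theorem coordBasis_apply (hp : p ∈ (extChartAt (𝓡 m) c).source) (i : Fin m) :
    coordBasis hp i = coordField c i p := by
  simp only [coordBasis, Module.Basis.map_apply]
  refine Eq.trans ?_ (chartEquiv_symm_apply hp _)
  simp

theorem coe_coordBasis (hp : p ∈ (extChartAt (𝓡 m) c).source) :
    ⇑(coordBasis hp) = fun i => coordField c i p :=
  funext (coordBasis_apply hp)

theorem sum_chartCoord_smul (hp : p ∈ (extChartAt (𝓡 m) c).source) (v : TangentSpace (𝓡 m) p) :
    ∑ i, chartCoord (𝓡 m) c p v i • coordField c i p = v := by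
  rw [← (coordBasis hp).sum_repr v]
  refine Finset.sum_congr rfl fun i _ => ?_
  rw [(coordBasis hp).sum_repr v, coordBasis_apply, ← chartEquiv_apply hp]
  congr 1

theorem coordGram_det_pos (hp : p ∈ (extChartAt (𝓡 m) c).source) : 0 < (coordGram m c p).det := by
  have h1 := (coordBasis hp).linearIndependent
  rw [coe_coordBasis hp] at h1
  exact (Matrix.posDef_gram_of_linearIndependent h1).det_pos

theorem volDensity_eq (hu : u ∈ (extChartAt (𝓡 m) c).target) :
    volDensity c u = √ (coordGram m c ((extChartAt (𝓡 m) c).symm u)).det := by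
  have h1 : ∀ i, coordVec c u i = coordField c i ((extChartAt (𝓡 m) c).symm u) :=
    fun i => chartField_eq_mfderiv_symm hu _
  simp only [volDensity, h1]
  rfl

theorem volDensity_pos (hu : u ∈ (extChartAt (𝓡 m) c).target) : 0 < volDensity c u := by
  rw [volDensity_eq hu]
  exact Real.sqrt_pos.2 (coordGram_det_pos ((extChartAt (𝓡 m) c).map_target hu))

/-- The transformation rule of the volume density. -/
theorem volDensity_transition {c' : M} (hu : u ∈ (extChartAt (𝓡 m) c).target)
    (hu' : (extChartAt (𝓡 m) c).symm u ∈ (extChartAt (𝓡 m) c').source) :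
    ∃ L : EuclideanSpace ℝ (Fin m) →L[ℝ] EuclideanSpace ℝ (Fin m),
      HasFDerivAt (fun w => extChartAt (𝓡 m) c' ((extChartAt (𝓡 m) c).symm w)) L u ∧
      volDensity c u = |L.det| *
        volDensity c' (extChartAt (𝓡 m) c' ((extChartAt (𝓡 m) c).symm u)) := by
  obtain ⟨L, h1, h2⟩ := exists_hasFDerivAt_transition hu hu'
  refine ⟨L, h1, ?_⟩
  have h3 := (extChartAt (𝓡 m) c').map_source hu'
  rw [volDensity_eq hu, volDensity_eq h3, (extChartAt (𝓡 m) c').left_inv hu']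
  set p := (extChartAt (𝓡 m) c).symm u
  set e := (EuclideanSpace.basisFun (Fin m) ℝ).toBasis
  set A := LinearMap.toMatrix e e L.toLinearMap with hA
  have h4 : ∀ i, coordField c i p = ∑ j, A j i • coordField c' j p := by
    intro i
    rw [coordField, h2, ← chartEquiv_symm_apply hu']
    have h5 : ∀ j, coordField c' j p = (chartEquiv hu').symm (EuclideanSpace.single j (1 : ℝ)) :=
      fun j => (chartEquiv_symm_apply hu' _).symm
    simp only [h5, ← map_smul, ← map_sum]
    congr 1
    rw [← e.sum_repr (L _)]
    refine Finset.sum_congr rfl fun j _ => ?_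
    rw [hA, LinearMap.toMatrix_apply]
    simp [e]
  have h6 : coordGram m c p = A.transpose * coordGram m c' p * A := by
    rw [coordGram, coordGram, ← gram_sum_smul]
    simp only [h4]
  have h7 : A.det = L.det := LinearMap.det_toMatrix _ _
  rw [h6, Matrix.det_mul, Matrix.det_mul, Matrix.det_transpose, h7,
    show L.det * (coordGram m c' p).det * L.det = L.det ^ 2 * (coordGram m c' p).det by ring,
    Real.sqrt_mul (sq_nonneg _), Real.sqrt_sq_eq_abs]

variable [IsContMDiffRiemannianBundle (𝓡 m) ∞ (EuclideanSpace ℝ (Fin m))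
    (fun x : M => TangentSpace (𝓡 m) x)]

theorem smoothFieldAt_coordField (hp : p ∈ (extChartAt (𝓡 m) c).source) (i : Fin m) :
    SmoothFieldAt (𝓡 m) (coordField c i) p :=
  smoothFieldAt_chartField hp _

theorem contMDiffAt_coordGram (hp : p ∈ (extChartAt (𝓡 m) c).source) (i j : Fin m) :
    ContMDiffAt (𝓡 m) 𝓘(ℝ, ℝ) ∞ (fun q => coordGram m c q i j) p :=
  (smoothFieldAt_coordField hp i).contMDiffAt_inner (smoothFieldAt_coordField hp j)

theorem contDiffAt_coordGram_symm (hu : u ∈ (extChartAt (𝓡 m) c).target) (i j : Fin m) :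
    ContDiffAt ℝ ∞ (fun w => coordGram m c ((extChartAt (𝓡 m) c).symm w) i j) u :=
  ((contMDiffAt_coordGram ((extChartAt (𝓡 m) c).map_target hu) i j).comp u
    (contMDiffAt_extChartAt_symm hu)).contDiffAt

theorem contDiffAt_volDensity (hu : u ∈ (extChartAt (𝓡 m) c).target) :
    ContDiffAt ℝ ∞ (volDensity c) u := by
  have h1 : ContDiffAt ℝ ∞ (fun w => √ (coordGram m c ((extChartAt (𝓡 m) c).symm w)).det) u := by
    refine ContDiffAt.sqrt ?_ (coordGram_det_pos ((extChartAt (𝓡 m) c).map_target hu)).ne'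
    simp only [Matrix.det_apply']
    exact ContDiffAt.sum fun σ _ => contDiffAt_const.mul
      (contDiffAt_prod fun i _ => contDiffAt_coordGram_symm hu _ _)
  refine h1.congr_of_eventuallyEq ?_
  filter_upwards [(isOpen_extChartAt_target (I := 𝓡 m) c).mem_nhds hu] with w hw
  exact volDensity_eq hw

/-- The divergence of a coordinate field is the logarithmic derivative of the density. -/
theorem fderiv_volDensity (hu : u ∈ (extChartAt (𝓡 m) c).target) (k : Fin m) :
    fderiv ℝ (volDensity c) u (EuclideanSpace.single k (1 : ℝ)) =
      volDensity c u * divergence (coordField c k) ((extChartAt (𝓡 m) c).symm u) := by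
  set p := (extChartAt (𝓡 m) c).symm u with hpdef
  have hp : p ∈ (extChartAt (𝓡 m) c).source := (extChartAt (𝓡 m) c).map_target hu
  have hs := fun i => smoothFieldAt_coordField (m := m) hp i
  choose G' hG' hGv using fun i j => hasFDerivAt_comp_extChartAt_symm hu
    ((contMDiffAt_coordGram hp i j).mdifferentiableAt (by simp))
  have hdet := hasFDerivAt_det (A := fun w => coordGram m c ((extChartAt (𝓡 m) c).symm w)) hG'
  have hpos := coordGram_det_pos hp
  have hsq := hdet.sqrt hpos.ne'
  have he : volDensity c =ᶠ[nhds u]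
      fun w => √ (coordGram m c ((extChartAt (𝓡 m) c).symm w)).det := by
    filter_upwards [(isOpen_extChartAt_target (I := 𝓡 m) c).mem_nhds hu] with w hw
    exact volDensity_eq hw
  rw [he.fderiv_eq, hsq.fderiv, volDensity_eq hu]
  set N : Fin m → Fin m → ℝ := fun i j =>
    inner ℝ (leviCivita (𝓡 m) M (coordField c k) p (coordField c i p)) (coordField c j p) with hN
  -- Coordinate fields commute, so `∇_{∂ₖ} ∂ᵢ = ∇_{∂ᵢ} ∂ₖ`; the derivative of the metric along `∂ₖ`
  -- thus involves only the endomorphism `∇ ∂ₖ`, whose trace is the divergence.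
  have h1 : ∀ i j, G' j i (EuclideanSpace.single k (1 : ℝ)) = N i j + N j i := by
    intro i j
    rw [hGv]
    have h2 := leviCivita_inner (hs k).diff (hs j).diff (hs i).diff
    have h3 : ∀ i, leviCivita (𝓡 m) M (coordField c i) p (coordField c k p) =
        leviCivita (𝓡 m) M (coordField c k) p (coordField c i p) := by
      intro i
      have h4 := leviCivita_sub_swap (hs k).diff (hs i).diff
      have h5 : mlieBracket (𝓡 m) (coordField c k) (coordField c i) p = 0 :=
        mlieBracket_chartField hp _ _
      rw [h5] at h4
      exact sub_eq_zero.1 h4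
    refine h2.trans ?_
    rw [h3, h3, hN, real_inner_comm _ (coordField c j p)]
    ring
  have hsymm : ∀ i j, (coordGram m c p).adjugate i j = (coordGram m c p).adjugate j i := by
    intro i j
    have h2 : (coordGram m c p).transpose = coordGram m c p := by
      ext i j
      exact real_inner_comm (coordField c i p) (coordField c j p)
    have h3 := congrFun (congrFun (Matrix.adjugate_transpose (coordGram m c p)) j) i
    rwa [h2] at h3
  have htr := det_gram_mul_trace (coordBasis hp)
    (leviCivita (𝓡 m) M (coordField c k) p).toLinearMap
  simp only [coe_coordBasis] at htr
  -- Symmetry of the adjugate makes the two halves equal; their factor `2` cancels the `½` from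
  -- differentiating the square root.
  have h6 : ∑ i, ∑ j, (coordGram m c p).adjugate i j * N j i =
      ∑ i, ∑ j, (coordGram m c p).adjugate i j * N i j := by
    rw [Finset.sum_comm]
    exact Finset.sum_congr rfl fun i _ => Finset.sum_congr rfl fun j _ => by rw [hsymm]
  have h7 : ∑ i, ∑ j, (coordGram m c p).adjugate i j * N i j =
      (coordGram m c p).det * divergence (coordField c k) p := htr.symm
  simp only [smul_apply, sum_apply, smul_eq_mul, h1, mul_add, Finset.sum_add_distrib, ← hpdef]
  rw [h6, h7]
  have h8 := Real.sq_sqrt hpos.le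
  have h9 := (Real.sqrt_pos.2 hpos).ne'
  field_simp
  rw [h8]
  ring

end ChartDensity

/-! ### The Riemannian volume measure in charts -/

section VolumeMeasure

variable {m : ℕ} {M : Type*} [TopologicalSpace M] [ChartedSpace (EuclideanSpace ℝ (Fin m)) M]
  [IsManifold (𝓡 m) ∞ M]
  [RiemannianBundle (fun x : M => TangentSpace (𝓡 m) x)]
  [IsContMDiffRiemannianBundle (𝓡 m) ∞ (EuclideanSpace ℝ (Fin m))
    (fun x : M => TangentSpace (𝓡 m) x)]
  [MeasurableSpace M] [BorelSpace M]
  {c p : M}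

theorem aemeasurable_volDensity (c : M) :
    AEMeasurable (fun u => ENNReal.ofReal (volDensity (m := m) c u))
      ((volume : Measure (EuclideanSpace ℝ (Fin m))).restrict (extChartAt (𝓡 m) c).target) := by
  refine AEMeasurable.ennreal_ofReal (ContinuousOn.aemeasurable ?_
    (isOpen_extChartAt_target c).measurableSet)
  exact fun u hu => (contDiffAt_volDensity hu).continuousAt.continuousWithinAt

theorem aemeasurable_extChartAt_symm (c : M) :
    AEMeasurable (extChartAt (𝓡 m) c).symm
      (((volume : Measure (EuclideanSpace ℝ (Fin m))).restrict
        (extChartAt (𝓡 m) c).target).withDensity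
          (fun u => ENNReal.ofReal (volDensity c u))) :=
  ((continuousOn_extChartAt_symm c).aemeasurable
    (isOpen_extChartAt_target c).measurableSet).mono_ac (withDensity_absolutelyContinuous _ _)

theorem measurableSet_extChartAt_target_inter (c : M) {A : Set M} (hA : MeasurableSet A) :
    MeasurableSet ((extChartAt (𝓡 m) c).target ∩ (extChartAt (𝓡 m) c).symm ⁻¹' A) := by
  have h1 := (continuousOn_iff_continuous_domRestrict.1
    (continuousOn_extChartAt_symm (I := 𝓡 m) c)).measurable hA
  have h2 := (MeasurableEmbedding.subtype_coe
    (isOpen_extChartAt_target (I := 𝓡 m) c).measurableSet).measurableSet_image.2 h1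
  convert h2 using 1
  ext u
  simp [and_comm]

theorem chartVolume_apply (c : M) {A : Set M} (hA : MeasurableSet A) :
    chartVolume (m := m) c A =
      ∫⁻ u in (extChartAt (𝓡 m) c).target ∩ (extChartAt (𝓡 m) c).symm ⁻¹' A,
        ENNReal.ofReal (volDensity c u) := by
  rw [chartVolume, Measure.map_apply_of_aemeasurable (aemeasurable_extChartAt_symm c) hA,
    withDensity_apply', Measure.restrict_restrict' (isOpen_extChartAt_target c).measurableSet,
    Set.inter_comm]

theorem chartVolume_inter_source (c : M) {A : Set M} (hA : MeasurableSet A) :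
    chartVolume (m := m) c (A ∩ (extChartAt (𝓡 m) c).source) = chartVolume (m := m) c A := by
  rw [chartVolume_apply c hA, chartVolume_apply c
    (hA.inter (isOpen_extChartAt_source c).measurableSet)]
  congr 2
  ext u
  simp only [Set.mem_inter_iff, Set.mem_preimage]
  exact ⟨fun h => ⟨h.1, h.2.1⟩, fun h => ⟨h.1, h.2, (extChartAt (𝓡 m) c).map_target h.1⟩⟩

/-- The volume measures of two charts agree on the intersection of their domains. -/
theorem chartVolume_eq_of_subset (c c' : M) {A : Set M} (hA : MeasurableSet A)
    (h : A ⊆ (extChartAt (𝓡 m) c).source) (h' : A ⊆ (extChartAt (𝓡 m) c').source) :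
    chartVolume (m := m) c A = chartVolume (m := m) c' A := by
  rw [chartVolume_apply c hA, chartVolume_apply c' hA]
  set B := (extChartAt (𝓡 m) c).target ∩ (extChartAt (𝓡 m) c).symm ⁻¹' A with hB
  set τ : EuclideanSpace ℝ (Fin m) → EuclideanSpace ℝ (Fin m) :=
    fun w => extChartAt (𝓡 m) c' ((extChartAt (𝓡 m) c).symm w) with hτ
  have hex : ∀ u ∈ B, ∃ L : EuclideanSpace ℝ (Fin m) →L[ℝ] EuclideanSpace ℝ (Fin m),
      HasFDerivAt τ L u ∧ volDensity c u = |L.det| * volDensity c' (τ u) := fun u hu =>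
    volDensity_transition hu.1 (h' hu.2)
  choose! L hL hdens using hex
  have himage : τ '' B = (extChartAt (𝓡 m) c').target ∩ (extChartAt (𝓡 m) c').symm ⁻¹' A := by
    ext w
    constructor
    · rintro ⟨u, hu, rfl⟩
      refine ⟨(extChartAt (𝓡 m) c').map_source (h' hu.2), ?_⟩
      simp only [hτ, Set.mem_preimage]
      rw [(extChartAt (𝓡 m) c').left_inv (h' hu.2)]
      exact hu.2
    · rintro ⟨hw, hwA⟩
      have hs := h hwA
      refine ⟨extChartAt (𝓡 m) c ((extChartAt (𝓡 m) c').symm w),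
        ⟨(extChartAt (𝓡 m) c).map_source hs, ?_⟩, ?_⟩
      · rw [Set.mem_preimage, (extChartAt (𝓡 m) c).left_inv hs]
        exact hwA
      · simp only [hτ]
        rw [(extChartAt (𝓡 m) c).left_inv hs, (extChartAt (𝓡 m) c').right_inv hw]
  have hinj : Set.InjOn τ B := by
    intro u hu v hv huv
    have h1 := (extChartAt (𝓡 m) c').injOn (h' hu.2) (h' hv.2) huv
    exact (extChartAt (𝓡 m) c).symm.injOn hu.1 hv.1 h1
  rw [← himage, lintegral_image_eq_lintegral_abs_det_fderiv_mul volume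
    (measurableSet_extChartAt_target_inter c hA) (fun u hu => (hL u hu).hasFDerivWithinAt) hinj]
  refine setLIntegral_congr_fun (measurableSet_extChartAt_target_inter c hA) fun u hu => ?_
  rw [hdens u hu, ENNReal.ofReal_mul (abs_nonneg _)]

/-- The Riemannian volume measure restricts to the volume measure of a chart. -/
theorem riemannianVolume_restrict (c : M) :
    (riemannianVolume m M).restrict (extChartAt (𝓡 m) c).source = chartVolume (m := m) c := by
  have hU : MeasurableSet (extChartAt (𝓡 m) c).source :=
    (isOpen_extChartAt_source (I := 𝓡 m) c).measurableSet
  -- The supremum is controlled by one explicit upper bound: the measure of the chart at `c`,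
  -- increased to `⊤` off its domain, dominates every chart measure because the densities agree on
  -- overlaps.
  have hle : riemannianVolume m M ≤
      chartVolume (m := m) c + (⊤ : Measure M).restrict (extChartAt (𝓡 m) c).sourceᶜ := by
    refine iSup_le fun c' => ?_
    rw [← Measure.restrict_add_restrict_compl (μ := chartVolume (m := m) c') hU]
    refine add_le_add ?_ (Measure.restrict_mono le_rfl le_top)
    refine Measure.le_iff.2 fun A hA => ?_
    rw [Measure.restrict_apply hA, ← chartVolume_inter_source c' (hA.inter hU),
      ← chartVolume_eq_of_subset c c' ((hA.inter hU).inter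
        (isOpen_extChartAt_source c').measurableSet)
        (Set.inter_subset_left.trans Set.inter_subset_right) Set.inter_subset_right]
    exact measure_mono (Set.inter_subset_left.trans Set.inter_subset_left)
  refine le_antisymm ?_ ?_
  · refine Measure.le_iff.2 fun A hA => ?_
    rw [Measure.restrict_apply hA]
    refine (hle _).trans ?_
    rw [Measure.add_apply, Measure.restrict_apply (hA.inter hU)]
    have h1 : A ∩ (extChartAt (𝓡 m) c).source ∩ (extChartAt (𝓡 m) c).sourceᶜ = ∅ := by
      rw [Set.inter_assoc, Set.inter_compl_self, Set.inter_empty]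
    rw [h1, measure_empty, add_zero]
    exact measure_mono Set.inter_subset_left
  · refine Measure.le_iff.2 fun A hA => ?_
    rw [Measure.restrict_apply hA, ← chartVolume_inter_source c hA]
    exact le_iSup (fun c => chartVolume (m := m) c) c _

/-- Around each point there is a coordinate neighbourhood inside a compact part of the chart target,
where the density is bounded. On compact `M` this makes continuous functions integrable. -/
instance : IsLocallyFiniteMeasure (riemannianVolume m M) := by
  refine ⟨fun x => ?_⟩
  have hx := mem_extChartAt_source (I := 𝓡 m) x
  have hT := (isOpen_extChartAt_target (I := 𝓡 m) x).mem_nhds (mem_extChartAt_target x)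
  obtain ⟨K, hK, hKT, hKc⟩ := local_compact_nhds hT
  obtain ⟨O, hOK, hO, hxO⟩ := mem_nhds_iff.1 hK
  set A := (extChartAt (𝓡 m) x).source ∩ extChartAt (𝓡 m) x ⁻¹' O with hA
  have hAo : IsOpen A := (continuousOn_extChartAt x).isOpen_inter_preimage
    (isOpen_extChartAt_source x) hO
  refine ⟨A, hAo.mem_nhds ⟨hx, hxO⟩, ?_⟩
  have h1 : riemannianVolume m M A = chartVolume (m := m) x A := by
    rw [← riemannianVolume_restrict x, Measure.restrict_apply hAo.measurableSet,
      Set.inter_eq_left.2 Set.inter_subset_left]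
  rw [h1, chartVolume_apply x hAo.measurableSet]
  have hcont : ContinuousOn (volDensity (m := m) x) K := fun u hu =>
    (contDiffAt_volDensity (hKT hu)).continuousAt.continuousWithinAt
  refine (lintegral_mono_set (t := K) ?_).trans_lt ?_
  · rintro u ⟨hu, huA⟩
    have h2 := huA.2
    rw [Set.mem_preimage, (extChartAt (𝓡 m) x).right_inv hu] at h2
    exact hOK h2
  · obtain ⟨C, hC⟩ := hKc.exists_bound_of_continuousOn hcont
    refine (setLIntegral_mono' (g := fun _ => ENNReal.ofReal C) hKc.measurableSet fun u hu =>
      ENNReal.ofReal_le_ofReal ((le_abs_self _).trans (hC u hu))).trans_lt ?_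
    rw [setLIntegral_const]
    exact ENNReal.mul_lt_top ENNReal.ofReal_lt_top hKc.measure_lt_top

/-- Integration of a function supported in a chart domain. -/
theorem integral_riemannianVolume_eq {f : M → ℝ} (hf : Continuous f)
    (hsupp : ∀ q ∉ (extChartAt (𝓡 m) c).source, f q = 0) :
    ∫ q, f q ∂(riemannianVolume m M) =
      ∫ u in (extChartAt (𝓡 m) c).target,
        volDensity c u * f ((extChartAt (𝓡 m) c).symm u) := by
  rw [← setIntegral_eq_integral_of_forall_compl_eq_zero hsupp, riemannianVolume_restrict,
    chartVolume, integral_map (aemeasurable_extChartAt_symm c) hf.aestronglyMeasurable,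
    integral_withDensity_eq_integral_toReal_smul₀ (aemeasurable_volDensity c)
      (Filter.Eventually.of_forall fun _ => ENNReal.ofReal_lt_top)]
  refine setIntegral_congr_fun (isOpen_extChartAt_target c).measurableSet fun u hu => ?_
  simp only [smul_eq_mul]
  rw [ENNReal.toReal_ofReal (volDensity_pos hu).le]

end VolumeMeasure

/-! ### Calculus of the divergence -/

section Divergence

variable {E : Type*} [NormedAddCommGroup E] [NormedSpace ℝ E] [FiniteDimensional ℝ E]
  {H : Type*} [TopologicalSpace H] {I : ModelWithCorners ℝ E H}
  {M : Type*} [TopologicalSpace M] [ChartedSpace H M] [IsManifold I ∞ M]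
  [RiemannianBundle (fun x : M => TangentSpace I x)]
  [IsContMDiffRiemannianBundle I ∞ E (fun x : M => TangentSpace I x)]
  {x : M} {X Y : Π x : M, TangentSpace I x}

theorem divergence_congr (hX : SmoothFieldAt I X x) (hY : SmoothFieldAt I Y x)
    (h : ∀ᶠ y in nhds x, X y = Y y) : divergence X x = divergence Y x := by
  rw [divergence, divergence, conn_congr hX.diff hY.diff h]

theorem divergence_add (hX : SmoothFieldAt I X x) (hY : SmoothFieldAt I Y x) :
    divergence (fun y => X y + Y y) x = divergence X x + divergence Y x := by
  simp only [divergence_eq_sum _ (stdOrthonormalBasis ℝ (TangentSpace I x)),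
    conn_add hX.diff hY.diff, inner_add_left, Finset.sum_add_distrib]

theorem divergence_smul {f : M → ℝ} (hf : CMDiffAt ∞ f x) (hX : SmoothFieldAt I X x) :
    divergence (fun y => f y • X y) x = f x * divergence X x + mvfderiv I f x (X x) := by
  set b := stdOrthonormalBasis ℝ (TangentSpace I x)
  have h1 : mvfderiv I f x (X x) = ∑ i, mvfderiv I f x (b i) * inner ℝ (X x) (b i) := by
    nth_rw 1 [← b.sum_repr' (X x)]
    rw [map_sum]
    refine Finset.sum_congr rfl fun i _ => ?_
    rw [map_smul, real_inner_comm, smul_eq_mul, mul_comm]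
  simp only [divergence_eq_sum _ b, conn_smul (hf.mdifferentiableAt (by simp)) hX.diff,
    inner_add_left, inner_smul_left, Finset.sum_add_distrib, RCLike.conj_to_real]
  rw [← Finset.mul_sum, h1]

theorem divergence_zero : divergence (fun y : M => (0 : TangentSpace I y)) x = 0 := by
  have h := divergence_smul (f := fun _ : M => (0 : ℝ)) contMDiffAt_const (smoothFieldAt_zero x)
    (I := I)
  simp only [smul_zero, zero_mul, zero_add, map_zero] at h
  exact h

theorem divergence_sum {ι : Type*} {s : Finset ι} {X : ι → Π x : M, TangentSpace I x}
    (h : ∀ i ∈ s, SmoothFieldAt I (X i) x) :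
    divergence (fun y => ∑ i ∈ s, X i y) x = ∑ i ∈ s, divergence (X i) x := by
  classical
  induction s using Finset.induction_on with
  | empty => simpa using! divergence_zero
  | insert a s ha ih =>
    simp only [Finset.mem_insert, forall_eq_or_imp] at h
    simp only [Finset.sum_insert ha]
    rw [divergence_add h.1 (SmoothFieldAt.sum h.2), ih h.2]

theorem contMDiffAt_divergence (hX : SmoothFieldAt I X x) : CMDiffAt ∞ (divergence X) x := by
  obtain ⟨s, u, hu, hxu, hs, ho⟩ := exists_orthonormal_frame I x
  have h1 : CMDiffAt ∞ (fun y => ∑ i, (inner ℝ (leviCivita I M X y (s i y)) (s i y) : ℝ)) x :=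
    ContMDiffAt.sum fun i _ => (hX.covDeriv (hs i x hxu)).contMDiffAt_inner (hs i x hxu)
  refine h1.congr_of_eventuallyEq ?_
  filter_upwards [hu.mem_nhds hxu] with y hy
  rw [divergence_eq_sum X (orthonormalBasisOfFamily (ho y hy))]
  simp

end Divergence

/-! ### The divergence theorem -/

section DivergenceTheorem

variable {m : ℕ} {M : Type*} [TopologicalSpace M] [ChartedSpace (EuclideanSpace ℝ (Fin m)) M]
  [IsManifold (𝓡 m) ∞ M]
  [RiemannianBundle (fun x : M => TangentSpace (𝓡 m) x)]
  [IsContMDiffRiemannianBundle (𝓡 m) ∞ (EuclideanSpace ℝ (Fin m))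
    (fun x : M => TangentSpace (𝓡 m) x)]
  {c p : M} {u : EuclideanSpace ℝ (Fin m)} {Y : Π x : M, TangentSpace (𝓡 m) x}

/-- The components of `√(det g) Y` in the chart at `c`. -/
noncomputable def densityCoord (c : M) (Y : Π x : M, TangentSpace (𝓡 m) x) (k : Fin m)
    (u : EuclideanSpace ℝ (Fin m)) : ℝ :=
  volDensity c u * chartCoord (𝓡 m) c ((extChartAt (𝓡 m) c).symm u)
    (Y ((extChartAt (𝓡 m) c).symm u)) k

theorem chartCoord_zero (c p : M) : chartCoord (𝓡 m) c p 0 = 0 := map_zero _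

theorem contMDiffAt_chartCoord_apply (hp : p ∈ (extChartAt (𝓡 m) c).source)
    (hY : SmoothFieldAt (𝓡 m) Y p) (k : Fin m) :
    ContMDiffAt (𝓡 m) 𝓘(ℝ, ℝ) ∞ (fun q => chartCoord (𝓡 m) c q (Y q) k) p :=
  (EuclideanSpace.proj k : EuclideanSpace ℝ (Fin m) →L[ℝ] ℝ).contDiff.contDiffAt.comp_contMDiffAt
    (contMDiffAt_chartCoord hp hY)

theorem contDiffAt_chartCoord_symm (hu : u ∈ (extChartAt (𝓡 m) c).target)
    (hY : SmoothFieldAt (𝓡 m) Y ((extChartAt (𝓡 m) c).symm u)) (k : Fin m) :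
    ContDiffAt ℝ ∞ (fun w => chartCoord (𝓡 m) c ((extChartAt (𝓡 m) c).symm w)
      (Y ((extChartAt (𝓡 m) c).symm w)) k) u :=
  (ContMDiffAt.comp u (contMDiffAt_chartCoord_apply ((extChartAt (𝓡 m) c).map_target hu) hY k)
    (contMDiffAt_extChartAt_symm hu)).contDiffAt

/-- The divergence in coordinates. -/
theorem sum_fderiv_densityCoord (hu : u ∈ (extChartAt (𝓡 m) c).target)
    (hY : SmoothFieldAt (𝓡 m) Y ((extChartAt (𝓡 m) c).symm u)) :
    ∑ k, fderiv ℝ (densityCoord c Y k) u (EuclideanSpace.single k (1 : ℝ)) =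
      volDensity c u * divergence Y ((extChartAt (𝓡 m) c).symm u) := by
  set p := (extChartAt (𝓡 m) c).symm u with hpdef
  have hp : p ∈ (extChartAt (𝓡 m) c).source := (extChartAt (𝓡 m) c).map_target hu
  have hc := fun k => contMDiffAt_chartCoord_apply hp hY k
  have hs := fun k => smoothFieldAt_coordField (m := m) hp k
  -- Near `p` the field is `∑ Yᵏ ∂ₖ`. The product rule splits its divergence into `Yᵏ div ∂ₖ`,
  -- matching the derivative of the density, and `∂ₖ Yᵏ`.
  have h1 : divergence Y p = ∑ k, (chartCoord (𝓡 m) c p (Y p) k * divergence (coordField c k) p +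
      mvfderiv (𝓡 m) (fun q => chartCoord (𝓡 m) c q (Y q) k) p (coordField c k p)) := by
    rw [divergence_congr hY (SmoothFieldAt.sum (s := Finset.univ)
      (X := fun k q => chartCoord (𝓡 m) c q (Y q) k • coordField c k q)
        fun k _ => (hs k).smul (hc k)), divergence_sum fun k _ => (hs k).smul (hc k)]
    · exact Finset.sum_congr rfl fun k _ => divergence_smul (hc k) (hs k)
    · filter_upwards [(isOpen_extChartAt_source (I := 𝓡 m) c).mem_nhds hp] with q hq
      exact (sum_chartCoord_smul hq (Y q)).symm
  rw [h1, Finset.mul_sum]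
  refine Finset.sum_congr rfl fun k _ => ?_
  have h2 := fderiv_comp_extChartAt_symm hu ((hc k).mdifferentiableAt (by simp))
    (EuclideanSpace.single k (1 : ℝ))
  have h3 : fderiv ℝ (densityCoord c Y k) u = _ := fderiv_fun_mul
    ((contDiffAt_volDensity hu).differentiableAt (by simp))
    ((contDiffAt_chartCoord_symm hu hY k).differentiableAt (by simp))
  rw [h3]
  simp only [add_apply, smul_apply, smul_eq_mul]
  rw [h2, fderiv_volDensity hu, ← hpdef]
  simp only [coordField]
  ring

/-- Integration by parts against the constant function `1`. -/
theorem integral_fderiv_eq_zero {f : EuclideanSpace ℝ (Fin m) → ℝ} (hf : ContDiff ℝ 1 f)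
    (hs : HasCompactSupport f) (v : EuclideanSpace ℝ (Fin m)) : ∫ u, fderiv ℝ f u v = 0 := by
  have h1 : Integrable f := hf.continuous.integrable_of_hasCompactSupport hs
  have h2 : Integrable (fun u => fderiv ℝ f u v) :=
    ((hf.continuous_fderiv (by simp)).clm_apply continuous_const).integrable_of_hasCompactSupport
      (hs.fderiv_apply (𝕜 := ℝ) v)
  have h3 := integral_mul_fderiv_eq_neg_fderiv_mul_of_integrable
    (μ := (volume : Measure (EuclideanSpace ℝ (Fin m)))) (f := fun _ => (1 : ℝ)) (g := f) (v := v)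
    (by simp) (by simpa using h2) (by simpa using h1) (fun _ _ => differentiableAt_const _)
    (fun u _ => (hf.differentiable (by simp)) u)
  simpa using h3

variable [MeasurableSpace M] [BorelSpace M] [T2Space M] [CompactSpace M]

/-- The divergence theorem for a vector field supported in a chart domain. -/
theorem integral_divergence_eq_zero_of_subset (hY : ∀ x, SmoothFieldAt (𝓡 m) Y x) {K : Set M}
    (hK : IsClosed K) (hKc : K ⊆ (extChartAt (𝓡 m) c).source) (h0 : ∀ q ∉ K, Y q = 0) :
    ∫ q, divergence Y q ∂(riemannianVolume m M) = 0 := by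
  classical
  have hcont : Continuous (divergence Y) :=
    continuous_iff_continuousAt.2 fun q => (contMDiffAt_divergence (hY q)).continuousAt
  have hdiv0 : ∀ q ∉ K, divergence Y q = 0 := by
    intro q hq
    rw [divergence_congr (hY q) (smoothFieldAt_zero q), divergence_zero]
    filter_upwards [hK.isOpen_compl.mem_nhds hq] with y hy using h0 y hy
  rw [integral_riemannianVolume_eq hcont fun q hq => hdiv0 q fun h => hq (hKc h)]
  set T := (extChartAt (𝓡 m) c).target with hT
  have hTo : IsOpen T := isOpen_extChartAt_target c
  set K' := extChartAt (𝓡 m) c '' K with hK'def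
  have hK' : IsCompact K' := hK.isCompact.image_of_continuousOn
    ((continuousOn_extChartAt c).mono hKc)
  have hK'T : K' ⊆ T := by
    rintro _ ⟨q, hq, rfl⟩
    exact (extChartAt (𝓡 m) c).map_source (hKc hq)
  -- Extension by zero outside the chart target. It stays `C¹` on the whole Euclidean space because
  -- the components already vanish off the compact image `K'` of the support.
  set F : Fin m → EuclideanSpace ℝ (Fin m) → ℝ := fun k => T.indicator (densityCoord c Y k) with hF
  have hF0 : ∀ k, ∀ u ∉ K', F k u = 0 := by
    intro k u hu
    by_cases huT : u ∈ T
    · rw [hF]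
      simp only
      rw [Set.indicator_of_mem huT, densityCoord, h0]
      · rw [chartCoord_zero]
        simp
      · intro hq
        exact hu ⟨_, hq, (extChartAt (𝓡 m) c).right_inv huT⟩
    · simp [hF, huT]
  have hFT : ∀ k, ∀ u ∈ T, F k =ᶠ[nhds u] densityCoord c Y k := by
    intro k u hu
    filter_upwards [hTo.mem_nhds hu] with w hw
    simp [hF, hw]
  have hFK : ∀ k, ∀ u ∉ K', F k =ᶠ[nhds u] fun _ => 0 := by
    intro k u hu
    filter_upwards [hK'.isClosed.isOpen_compl.mem_nhds hu] with w hw using hF0 k w hw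
  have hsmooth : ∀ k, ContDiff ℝ 1 (F k) := by
    intro k
    refine contDiff_iff_contDiffAt.2 fun u => ?_
    by_cases hu : u ∈ K'
    · refine ContDiffAt.congr_of_eventuallyEq ?_ (hFT k u (hK'T hu))
      exact ((contDiffAt_volDensity (hK'T hu)).mul
        (contDiffAt_chartCoord_symm (hK'T hu) (hY _) k)).of_le (by simp)
    · exact contDiffAt_const.congr_of_eventuallyEq (hFK k u hu)
  have hcomp : ∀ k, HasCompactSupport (F k) := fun k => HasCompactSupport.intro hK' (hF0 k)
  have hint : ∀ k, Integrable (fun u => fderiv ℝ (F k) u (EuclideanSpace.single k (1 : ℝ))) :=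
    fun k => (((hsmooth k).continuous_fderiv (by simp)).clm_apply
      continuous_const).integrable_of_hasCompactSupport ((hcomp k).fderiv_apply (𝕜 := ℝ) _)
  have h1 : ∫ u in T, volDensity c u * divergence Y ((extChartAt (𝓡 m) c).symm u) =
      ∫ u in T, ∑ k, fderiv ℝ (F k) u (EuclideanSpace.single k (1 : ℝ)) := by
    refine setIntegral_congr_fun hTo.measurableSet fun u hu => ?_
    rw [← sum_fderiv_densityCoord hu (hY _)]
    exact Finset.sum_congr rfl fun k _ => by rw [(hFT k u hu).fderiv_eq]
  rw [h1, setIntegral_eq_integral_of_forall_compl_eq_zero, integral_finsetSum _ fun k _ => hint k]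
  · exact Finset.sum_eq_zero fun k _ => integral_fderiv_eq_zero (hsmooth k) (hcomp k) _
  · intro u hu
    refine Finset.sum_eq_zero fun k _ => ?_
    rw [(hFK k u fun h => hu (hK'T h)).fderiv_eq]
    simp

/-- The divergence theorem on a closed Riemannian manifold. -/
theorem integral_divergence_eq_zero (hY : ∀ x, SmoothFieldAt (𝓡 m) Y x) :
    ∫ q, divergence Y q ∂(riemannianVolume m M) = 0 := by
  obtain ⟨f, hf⟩ := SmoothPartitionOfUnity.exists_isSubordinate_chartAt_source (I := 𝓡 m) (M := M)
  -- Compactness leaves finitely many nonzero members of the partition of unity, so the sum commutes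
  -- with divergence and integral.
  have hfin : {i | (Function.support (f i)).Nonempty}.Finite :=
    f.locallyFinite.finite_nonempty_of_compact
  have hfs : ∀ i x, ContMDiffAt (𝓡 m) 𝓘(ℝ, ℝ) ∞ (f i) x := fun i x => (f i).contMDiff x
  have hfY : ∀ i x, SmoothFieldAt (𝓡 m) (fun q => f i q • Y q) x := fun i x =>
    (hY x).smul (hfs i x)
  have hsum : ∀ q, ∑ i ∈ hfin.toFinset, f i q • Y q = Y q := by
    intro q
    rw [← Finset.sum_smul]
    have h1 := f.sum_eq_one (Set.mem_univ q)
    rw [finsum_eq_sum_of_support_subset (s := hfin.toFinset)] at h1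
    · rw [h1, one_smul]
    · intro i hi
      simp only [Set.Finite.coe_toFinset, Set.mem_ofPred_eq]
      exact ⟨q, hi⟩
  have h1 : ∀ q, divergence Y q =
      ∑ i ∈ hfin.toFinset, divergence (fun q => f i q • Y q) q := by
    intro q
    rw [← divergence_sum fun i _ => hfY i q]
    simp only [hsum]
  simp only [h1]
  rw [integral_finsetSum]
  · refine Finset.sum_eq_zero fun i _ => ?_
    refine integral_divergence_eq_zero_of_subset (c := i) (hfY i) (isClosed_tsupport (f i)) ?_ ?_
    · rw [extChartAt_source]
      exact hf i
    · intro q hq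
      rw [image_eq_zero_of_notMem_tsupport hq, zero_smul]
  · intro i _
    have hc : Continuous (divergence fun q => f i q • Y q) :=
      continuous_iff_continuousAt.2 fun q => (contMDiffAt_divergence (hfY i q)).continuousAt
    exact hc.integrable_of_hasCompactSupport (HasCompactSupport.of_compactSpace _)

end DivergenceTheorem

/-! ### Continuity of the scalar curvatures -/

section Continuity

variable {E : Type*} [NormedAddCommGroup E] [NormedSpace ℝ E] [FiniteDimensional ℝ E]
  {H : Type*} [TopologicalSpace H] {I : ModelWithCorners ℝ E H}
  {M : Type*} [TopologicalSpace M] [ChartedSpace H M] [IsManifold I ∞ M]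
  [RiemannianBundle (fun x : M => TangentSpace I x)]
  [IsContMDiffRiemannianBundle I ∞ E (fun x : M => TangentSpace I x)]
  {x : M} {X Y Z : Π x : M, TangentSpace I x}

theorem smoothFieldAt_curvatureField (hX : SmoothFieldAt I X x) (hY : SmoothFieldAt I Y x)
    (hZ : SmoothFieldAt I Z x) : SmoothFieldAt I (curvatureField X Y Z) x :=
  (((hZ.covDeriv hY).covDeriv hX).sub ((hZ.covDeriv hX).covDeriv hY)).sub
    (hZ.covDeriv (hX.lieBracket hY))

/-- The standard orthonormal bases in the definition need not vary continuously with the point;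
basis independence allows a local smooth frame instead. -/
theorem continuous_starScalarCurvature {J : Π x : M, TangentSpace I x →L[ℝ] TangentSpace I x}
    (hJ : ∀ {x : M} {X : Π x : M, TangentSpace I x}, SmoothFieldAt I X x →
      SmoothFieldAt I (fun y => J y (X y)) x) :
    Continuous (starScalarCurvature J) := by
  refine continuous_iff_continuousAt.2 fun x => ?_
  obtain ⟨s, u, hu, hxu, hs, ho⟩ := exists_orthonormal_frame I x
  have h1 : CMDiffAt ∞ (fun y => ∑ i, ∑ j, (inner ℝ
      (curvatureField (s i) (s j) (fun q => J q (s j q)) y) (J y (s i y)) : ℝ)) x :=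
    ContMDiffAt.sum fun i _ => ContMDiffAt.sum fun j _ =>
      (smoothFieldAt_curvatureField (hs i x hxu) (hs j x hxu)
        (hJ (hs j x hxu))).contMDiffAt_inner (hJ (hs i x hxu))
  refine h1.continuousAt.congr ?_
  filter_upwards [hu.mem_nhds hxu] with y hy
  rw [starScalarCurvature_eq_sum J (orthonormalBasisOfFamily (ho y hy))]
  refine Finset.sum_congr rfl fun i _ => Finset.sum_congr rfl fun j _ => ?_
  rw [← curvature_apply (hs i y hy) (hs j y hy) (hJ (hs j y hy))]
  simp

/-- With the identity in place of `J`, the `*`-scalar curvature is the scalar curvature; the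
continuity argument uses only that the endomorphism field preserves smooth fields. -/
theorem continuous_scalarCurvature : Continuous (scalarCurvature I (M := M)) :=
  continuous_starScalarCurvature (J := fun _ => ContinuousLinearMap.id ℝ _) fun hX => hX

end Continuity

end SUStr

theorem mainTheorem7 (n : ℕ) (M : Type*) [TopologicalSpace M] [T2Space M] [CompactSpace M]
    [MeasurableSpace M] [BorelSpace M]
    [ChartedSpace (EuclideanSpace ℝ (Fin (2 * n))) M] [IsManifold (𝓡 (2 * n)) ∞ M]
    [RiemannianBundle (fun x : M => TangentSpace (𝓡 (2 * n)) x)]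
    [IsContMDiffRiemannianBundle (𝓡 (2 * n)) ∞ (EuclideanSpace ℝ (Fin (2 * n)))
      (fun x : M => TangentSpace (𝓡 (2 * n)) x)]
    (S : SUStr.SUStructure n M) (hS : S.IsTypeW1W5) :
    Integrable (fun x : M => SUStr.scalarCurvature (𝓡 (2 * n)) x)
        (SUStr.riemannianVolume (2 * n) M) ∧
      Integrable (fun x : M => SUStr.starScalarCurvature S.J x)
        (SUStr.riemannianVolume (2 * n) M) ∧
      ∫ x : M, SUStr.scalarCurvature (𝓡 (2 * n)) x ∂(SUStr.riemannianVolume (2 * n) M) =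
        5 * ∫ x : M, SUStr.starScalarCurvature S.J x ∂(SUStr.riemannianVolume (2 * n) M) := by
  have integrable : ∀ {f : M → ℝ}, Continuous f → Integrable f (SUStr.riemannianVolume (2 * n) M) :=
    fun hf => hf.integrable_of_hasCompactSupport (HasCompactSupport.of_compactSpace _)
  have h1 : Integrable (fun x : M => SUStr.scalarCurvature (𝓡 (2 * n)) x)
      (SUStr.riemannianVolume (2 * n) M) := integrable SUStr.continuous_scalarCurvature
  have h2 : Integrable (fun x : M => SUStr.starScalarCurvature S.J x)
      (SUStr.riemannianVolume (2 * n) M) :=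
    integrable (SUStr.continuous_starScalarCurvature S.isAlmostHermitian.smooth)
  refine ⟨h1, h2, ?_⟩
  -- For `n = 0` the form `Ψ` gives no control of `θ`, but the tangent spaces are zero and both
  -- curvatures are empty sums.
  rcases eq_or_ne n 0 with rfl | hn
  · have h3 : ∀ x : M, IsEmpty (Fin (Module.finrank ℝ (TangentSpace (𝓡 (2 * 0)) x))) := by
      intro x
      have h4 : Module.finrank ℝ (TangentSpace (𝓡 (2 * 0)) x) = 0 :=
        finrank_euclideanSpace_fin (𝕜 := ℝ) (n := 2 * 0)
      rw [h4]
      infer_instance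
    simp [SUStr.scalarCurvature, SUStr.starScalarCurvature]
  · obtain ⟨a, ζ, D, h⟩ := hS.exists_torsion
    have hζ := (h.isW1W5Connection hn).smooth_vec
    have h3 : Integrable (SUStr.divergence ζ) (SUStr.riemannianVolume (2 * n) M) :=
      integrable (continuous_iff_continuousAt.2 fun x =>
        (SUStr.contMDiffAt_divergence (hζ x)).continuousAt)
    simp only [h.scalarCurvature_eq hn]
    rw [integral_add (h2.const_mul 5) (h3.const_mul _), integral_const_mul, integral_const_mul,
      SUStr.integral_divergence_eq_zero hζ, mul_zero, add_zero]
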